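/- **Setting.** All trees are finite, and uniqueness is up to isomorphism. The boundary of a tree $T$ is its set of leaves (vertices of degree one). A real $\lambda\ge 0$ is a Steklov eigenvalue of $T$ if there is a nonzero $f:V(T)\to\mathbb R$ with $\sum_{w\sim v}(f(v)-f(w))=0$ at every non-leaf $v$ and $f(\omega)-f(\omega')=\lambda f(\omega)$ at every leaf $\omega$ with neighbour $\omega'$. Let $\lambda_2(T)$ be the smallest nonzero Steklov eigenvalue of $T$. An extremizer is a tree that maximizes $\lambda_2$ among all trees with $n$ vertices and diameter $2r+1$. The spider $S(\ell_1,\dots,\ell_b)$ is obtained by gluing together one endpoint of each of $b$ paths of lengths $\ell_1,\dots,\ell_b$. For $b\ge2$, $c\ge 1$ and $0\le t\le b-2$ let $\mathrm{AS}(r,b,c,t)$ be the spider with branch lengths $r+1$, $r$, $t$ copies of $c+1$ and $b-2-t$ copies of $c$. **Theorem 4.3.** Let $r\ge 2$, $s=\lceil r/2\rceil$, $n\ge 2r+2$ and $M=n-2r-2$. Put $q_-=\max\{1,\lfloor M/s\rfloor\}$ and $q_+=\lceil M/s\rceil$ and, for $M\ge 1$, write $M=q_\pm c_\pm+t_\pm$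 with $0\le t_\pm<q_\pm$. Let $I_r=\left(\frac1{r+1},\frac1r\right)$. 1. If $M=0$, then the unique extremizer is the path $P_{2r+2}$ on $2r+2$ vertices. 2. If $1\le M<s$, then $q_-=q_+=1$, and the unique extremizer is $\mathrm{AS}(r,3,M,0)=S(r+1,r,M)$. 3. If $M\ge 1$ and $s\mid M$, then $q_-=q_+=M/s$, and the unique extremizer is $\mathrm{AS}(r,\frac Ms+2,s,0)$. 4. Suppose $M=ks+t$ with $1\le t\le s-1$ and $k\ge s$. Put $A_{k,t}=\mathrm{AS}(r,k+2,s,t)$ and $B_{k,t}=\mathrm{AS}(r,k+3,s-1,k+t-s+1)$. Every extremizer is $A_{k,t}$ or $B_{k,t}$. More precisely: - (a) if $r=2s$ and $2t\le s-1$, the unique extremizer is $A_{k,t}$; - (b) if $r=2s-1$ and $2t\ge s-1$, the unique extremizer is $B_{k,t}$; - (c) in the remaining cases ($r=2s$ and $2t\ge s$, or $r=2s-1$ and $2t\le s-2$) the polynomial $P_{s,t}(\lambda)=1-3s\lambda+(2s^2+s-2t-1)\lambda^2$ has a unique root $\zeta=\zeta_{s,t}$ in $I_r$. With $$\kappa_{r,t}=-(1-s\zeta)\left(\frac1{1-(r+1)\zeta}+\frac1{1-r\zeta}+\frac{t-s+1}{1-s\zeta}+\frac{s-t}{1-(s-1)\zeta}\right),$$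 the unique extremizer is $A_{k,t}$ if $k>\kappa_{r,t}$, the unique extremizer is $B_{k,t}$ if $k<\kappa_{r,t}$, and both are extremizers if $k=\kappa_{r,t}$. 5. Suppose $M=ks+t$ with $1\le k\le s-1$ and $1\le t\le s-1$. Every extremizer is $T_-=\mathrm{AS}(r,q_-+2,c_-,t_-)$ or $T_+=\mathrm{AS}(r,q_++2,c_+,t_+)$. For each sign, $\lambda_2(T_\pm)$ is the unique root in $I_r$ of $$\frac1{1-(r+1)\lambda}+\frac1{1-r\lambda}+\frac{t_\pm}{1-(c_\pm+1)\lambda}+\frac{q_\pm-t_\pm}{1-c_\pm\lambda}=0.$$ The tree with the larger root is the unique extremizer; if the two roots are equal, both trees are extremizers. For fixed $r$, only finitely many orders $n$ fall into this case. -/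

import Mathlib

namespace SteklovTree

section Steklov

variable {V : Type*} [Fintype V]

/-- A leaf is a vertex of degree one; the leaves form the boundary. -/
def IsLeaf (G : SimpleGraph V) (v : V) : Prop :=
  (G.neighborSet v).ncard = 1

open scoped Classical in
/-- The combinatorial Laplacian `Δ f (v) = ∑_{w ∼ v} (f v - f w)`. -/
noncomputable def laplacian (G : SimpleGraph V) (f : V → ℝ) (v : V) : ℝ :=
  ∑ w : V, if G.Adj v w then f v - f w else 0

/-- `μ ≥ 0` is a Steklov eigenvalue of `G` with leaf boundary: some nonzero `f` is harmonic off the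
leaves and satisfies `f ω - f ω' = μ f ω` at each leaf `ω`, where `ω'` is its neighbour. -/
def IsSteklovEigenvalue (G : SimpleGraph V) (μ : ℝ) : Prop :=
  0 ≤ μ ∧ ∃ f : V → ℝ, f ≠ 0 ∧
    (∀ v, ¬ IsLeaf G v → laplacian G f v = 0) ∧
    (∀ ω ω', IsLeaf G ω → G.Adj ω ω' → f ω - f ω' = μ * f ω)

/-- The first nonzero Steklov eigenvalue. For a finite tree with at least two vertices the set below
is finite and nonempty, so that the infimum is its least element. -/
noncomputable def lambda2 (G : SimpleGraph V) : ℝ :=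
  sInf {μ : ℝ | μ ≠ 0 ∧ IsSteklovEigenvalue G μ}

/-- `G` is a tree of order `n` and diameter `D`. -/
def IsAdmissible (n D : ℕ) (G : SimpleGraph V) : Prop :=
  G.IsTree ∧ Fintype.card V = n ∧ G.diam = D

/-- `G` maximizes `lambda2` among the trees of order `n` and diameter `D`. Up to isomorphism every
graph of order `n` has vertex set `Fin n`, so the competitors are taken there. -/
def IsExtremizer (n D : ℕ) (G : SimpleGraph V) : Prop :=
  IsAdmissible n D G ∧
    ∀ H : SimpleGraph (Fin n), IsAdmissible n D H → lambda2 H ≤ lambda2 G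

/-- `S` is an extremizer, and it is the only one up to isomorphism. -/
def IsUniqueExtremizer (n D : ℕ) (S : SimpleGraph V) : Prop :=
  IsExtremizer n D S ∧
    ∀ G : SimpleGraph (Fin n), IsExtremizer n D G → Nonempty (G ≃g S)

end Steklov

/-- Every extremizer is isomorphic to `A` or to `B`. -/
def OnlyCandidates {V W : Type*} (n D : ℕ) (A : SimpleGraph V) (B : SimpleGraph W) : Prop :=
  ∀ G : SimpleGraph (Fin n), IsExtremizer n D G → Nonempty (G ≃g A) ∨ Nonempty (G ≃g B)

/-- The spider with branch lengths `ℓ i`: the center is `none`, and `some ⟨i, j⟩` is the vertex of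
the `i`-th branch at distance `j + 1` from the center. -/
def spider {ι : Type*} (ℓ : ι → ℕ) : SimpleGraph (Option (Σ i, Fin (ℓ i))) :=
  SimpleGraph.fromRel fun x y =>
    match x, y with
    | none, some v => (v.2 : ℕ) = 0
    | some v, some w => v.1 = w.1 ∧ (v.2 : ℕ) + 1 = (w.2 : ℕ)
    | _, none => False

/-- Branch lengths of the generalized almost seesaw tree: `r + 1`, `r`, then `t` copies of `c + 1`
and `b - 2 - t` copies of `c`. -/
def asLengths (r b c t : ℕ) (i : Fin b) : ℕ :=
  if (i : ℕ) = 0 then r + 1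
  else if (i : ℕ) = 1 then r
  else if (i : ℕ) < t + 2 then c + 1
  else c

/-- The generalized almost seesaw tree `AS(r, b, c, t)` (used for `2 ≤ b`, `1 ≤ c`, `t ≤ b - 2`). -/
abbrev almostSeesaw (r b c t : ℕ) :
    SimpleGraph (Option (Σ i : Fin b, Fin (asLengths r b c t i))) :=
  spider (asLengths r b c t)

/-- `q₋ = max {1, ⌊M / s⌋}`. -/
def qMinus (s M : ℕ) : ℕ := max 1 (M / s)

/-- `q₊ = ⌈M / s⌉`. -/
def qPlus (s M : ℕ) : ℕ := ⌈(M : ℚ) / (s : ℚ)⌉₊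

/-- The candidate `AS(r, q + 2, c, t)` with `q` lateral branches of total length `M`, where
`M = q c + t` and `0 ≤ t < q`. -/
abbrev candidate (r M q : ℕ) :
    SimpleGraph (Option (Σ i : Fin (q + 2), Fin (asLengths r (q + 2) (M / q) (M % q) i))) :=
  almostSeesaw r (q + 2) (M / q) (M % q)

/-- The left-hand side of the root equation of `AS(r, q + 2, c, t)`. -/
noncomputable def rootFunction (r q c t : ℕ) (x : ℝ) : ℝ :=
  1 / (1 - ((r : ℝ) + 1) * x) + 1 / (1 - (r : ℝ) * x)
    + (t : ℝ) / (1 - ((c : ℝ) + 1) * x) + ((q : ℝ) - (t : ℝ)) / (1 - (c : ℝ) * x)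

/-- The interval `I_r = (1 / (r + 1), 1 / r)`. -/
def rootInterval (r : ℕ) : Set ℝ := Set.Ioo (1 / ((r : ℝ) + 1)) (1 / (r : ℝ))

/-- `x` is the unique zero of `F` in `I`. -/
def IsUniqueRoot (F : ℝ → ℝ) (I : Set ℝ) (x : ℝ) : Prop :=
  x ∈ I ∧ F x = 0 ∧ ∀ y ∈ I, F y = 0 → y = x

/-- `P_{s,t}(x) = 1 - 3 s x + (2 s² + s - 2 t - 1) x²`. -/
def thresholdPoly (s t : ℕ) (x : ℝ) : ℝ :=
  1 - 3 * (s : ℝ) * x + (2 * (s : ℝ) ^ 2 + (s : ℝ) - 2 * (t : ℝ) - 1) * x ^ 2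

/-- The threshold `κ_{r,t}`, as a function of the root `z` of `P_{s,t}` in `I_r`. -/
noncomputable def kappa (r s t : ℕ) (z : ℝ) : ℝ :=
  -(1 - (s : ℝ) * z) *
    (1 / (1 - ((r : ℝ) + 1) * z) + 1 / (1 - (r : ℝ) * z)
      + ((t : ℝ) - (s : ℝ) + 1) / (1 - (s : ℝ) * z)
      + ((s : ℝ) - (t : ℝ)) / (1 - ((s : ℝ) - 1) * z))

/-- `A_{k,t} = AS(r, k + 2, s, t)`. -/
abbrev treeA (r s k t : ℕ) := almostSeesaw r (k + 2) s t

/-- `B_{k,t} = AS(r, k + 3, s - 1, k + t - s + 1)` (used for `1 ≤ s ≤ k`). -/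
abbrev treeB (r s k t : ℕ) := almostSeesaw r (k + 3) (s - 1) (k + t + 1 - s)

end SteklovTree

open SteklovTree

/-! The proof bounds `lambda2` from above by a dual variational principle and reads off the equality
case. Put a charge `Q` of total zero on the leaves and let the flow through an edge be the total
charge below it. Then `lambda2` times the sum of the squared flows is at most the sum of the squared
charges (`IsRooted.lambda2_mul_le`), because a maximizing charge is, up to a factor, the boundary
trace of an eigenfunction.

A tree of diameter `2r+1` has a central edge `uv`. For `x` in `I_r` write `h(ℓ) = 1/(1 - ℓx)`; it is
positive for `ℓ ≤ r`, and `h(r+1) < 0`. Send one unit of flow across `uv`, charging each leaf at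
distance `ℓ` from the edge in proportion to `h(ℓ)`. On each side the charges have one sign, so every
other edge has squared flow at least the sum of the squared charges below it. What remains to
compare with `x` is `1/a + 1/b`, where `a` and `b` are the totals of `h` over the leaves of the two
sides. This is at most `x` as soon as `h(r+1) + h(r) + ∑ h(ℓ) ≥ 0`, the sum being over the leaves
other than the two ends of a diametral path, and then `lambda2 ≤ x`. Equality forces branching only
at one end of the central edge, so the tree is a spider (`IsAdmissible.lambda2_le`). Conversely,
`lambda2` of a spider with branches `r+1`, `r` and others of length at most `r` is the root in `I_r`
of the sum of its responses (`IsSeesawLike.lambda2_eq`).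

The problem is thereby reduced to minimizing `∑ h(ℓ)` over multisets of lengths `1 ≤ ℓ ≤ r` with
total at least `M`. By convexity, `h` lies above its chord through `c` and `c+1` at every integer,
so for a fixed number of branches the balanced lengths are best (`balanced_optimal`). The intercept
of that chord has the sign of `1 - (2c+1)x`, which on `I_r` is positive for `c < s` and negative for
`c ≥ s`. Hence extra branches are penalized in the first case and missing ones in the second, and
only the numbers of branches next to `M/s` survive (`balancedOrWorse_or`).

For large quotient, the root functions of the two survivors differ by a negative multiple of
`P_{s,t}`, which does not involve `k`. The winner is decided by the side of `ζ` on which the roots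
lie, and this is the comparison of `k` with `κ`. -/

namespace SteklovTree

/-! ### Rooted trees: ancestors, leaves, Laplacian, depth. -/

/-- `G` is a tree rooted at `o` with parent function `p` and depth function `d`. -/
structure IsRooted {V : Type*} (G : SimpleGraph V) (o : V) (p : V → V) (d : V → ℕ) : Prop where
  adj_iff : ∀ x y, G.Adj x y ↔ (x ≠ o ∧ p x = y) ∨ (y ≠ o ∧ p y = x)
  parent_root : p o = o
  depth_root : d o = 0
  depth_parent : ∀ x, x ≠ o → d x = d (p x) + 1

/-- `z` is a descendant of `x` (possibly `x` itself). -/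
def Below {V : Type*} (p : V → V) (x z : V) : Prop := ∃ j, p^[j] z = x

namespace IsRooted

variable {V : Type*} {G : SimpleGraph V} {o : V} {p : V → V} {d : V → ℕ}

theorem depth_eq_zero (h : IsRooted G o p d) {x : V} : d x = 0 ↔ x = o := by
  constructor
  · intro hx
    by_contra hne
    have := h.depth_parent x hne
    omega
  · rintro rfl
    exact h.depth_root

theorem adj_parent (h : IsRooted G o p d) {x : V} (hx : x ≠ o) : G.Adj x (p x) :=
  (h.adj_iff x (p x)).2 (Or.inl ⟨hx, rfl⟩)

theorem depth_iterate (h : IsRooted G o p d) (j : ℕ) (z : V) : d (p^[j] z) = d z - j := by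
  induction j generalizing z with
  | zero => simp
  | succ j ih =>
    rw [Function.iterate_succ_apply, ih]
    by_cases hz : z = o
    · subst hz
      simp [h.parent_root, h.depth_root]
    · have := h.depth_parent z hz
      omega

theorem below_refl (p : V → V) (x : V) : Below p x x := ⟨0, rfl⟩

theorem below_root (h : IsRooted G o p d) (z : V) : Below p o z :=
  ⟨d z, h.depth_eq_zero.1 (by rw [h.depth_iterate]; omega)⟩

/-- The root is a fixed point of `p`, so the number of iterations in `Below` is not determined. The
depth difference is a canonical choice, and it makes the ancestor of a given depth unique. -/
theorem below_iff_iterate (h : IsRooted G o p d) {x z : V} :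
    Below p x z ↔ d x ≤ d z ∧ p^[d z - d x] z = x := by
  constructor
  · rintro ⟨j, rfl⟩
    have hd := h.depth_iterate j z
    refine ⟨by omega, ?_⟩
    by_cases hj : j ≤ d z
    · rw [hd]
      congr 2
      omega
    · have h1 : p^[j] z = o := h.depth_eq_zero.1 (by omega)
      rw [h1, h.depth_root]
      exact h.depth_eq_zero.1 (by rw [h.depth_iterate]; omega)
  · rintro ⟨-, hz⟩
    exact ⟨_, hz⟩

theorem Below.trans {x y z : V} (hxy : Below p x y) (hyz : Below p y z) : Below p x z := by
  obtain ⟨i, rfl⟩ := hxy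
  obtain ⟨j, rfl⟩ := hyz
  exact ⟨i + j, Function.iterate_add_apply p i j z⟩

/-- Two ancestors of the same vertex with the same depth agree. -/
theorem below_unique (h : IsRooted G o p d) {x y z : V} (hx : Below p x z) (hy : Below p y z)
    (hd : d x = d y) : x = y := by
  rw [h.below_iff_iterate] at hx hy
  rw [← hx.2, ← hy.2, hd]

/-- Two ancestors of the same vertex are comparable. -/
theorem below_of_le (h : IsRooted G o p d) {x y z : V} (hx : Below p x z) (hy : Below p y z)
    (hd : d x ≤ d y) : Below p x y := by
  rw [h.below_iff_iterate] at hx hy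
  refine ⟨d y - d x, ?_⟩
  rw [← hy.2, ← Function.iterate_add_apply]
  rw [hy.2]
  convert hx.2 using 2
  omega

theorem eq_or_below_parent (p : V → V) {x z : V} :
    Below p x z ↔ x = z ∨ Below p x (p z) := by
  constructor
  · rintro ⟨j, rfl⟩
    cases j with
    | zero => exact Or.inl rfl
    | succ j => exact Or.inr ⟨j, (Function.iterate_succ_apply p j z).symm⟩
  · rintro (rfl | ⟨j, rfl⟩)
    · exact ⟨0, rfl⟩
    · exact ⟨j + 1, Function.iterate_succ_apply p j z⟩

theorem not_below_parent (h : IsRooted G o p d) {z : V} (hz : z ≠ o) : ¬ Below p z (p z) := by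
  intro hb
  have := (h.below_iff_iterate.1 hb).1
  have := h.depth_parent z hz
  omega

theorem not_below_root (h : IsRooted G o p d) {x : V} (hx : x ≠ o) : ¬ Below p x o := by
  intro hb
  have := (h.below_iff_iterate.1 hb).1
  rw [h.depth_root] at this
  exact hx (h.depth_eq_zero.1 (by omega))

/-- A proper descendant of `x` is a descendant of exactly one child of `x`. -/
theorem exists_child (h : IsRooted G o p d) {x z : V} (hb : Below p x z) (hne : z ≠ x) :
    ∃ c, c ≠ o ∧ p c = x ∧ Below p c z := by
  obtain ⟨hd, hj⟩ := h.below_iff_iterate.1 hb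
  obtain ⟨k, hk⟩ : ∃ k, d z - d x = k + 1 := by
    refine ⟨d z - d x - 1, ?_⟩
    rcases Nat.eq_zero_or_pos (d z - d x) with h0 | h0
    · rw [h0] at hj
      exact absurd hj hne
    · omega
  refine ⟨p^[k] z, ?_, ?_, k, rfl⟩
  · intro ho
    have := h.depth_iterate k z
    rw [ho, h.depth_root] at this
    omega
  · rw [← Function.iterate_succ_apply' p k z, Nat.succ_eq_add_one, ← hk, hj]

theorem reachable_root (h : IsRooted G o p d) (x : V) : G.Reachable x o := by
  induction hn : d x generalizing x with
  | zero => rw [h.depth_eq_zero.1 hn]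
  | succ n ih =>
    have hx : x ≠ o := fun e => by rw [e, h.depth_root] at hn; omega
    have := h.depth_parent x hx
    exact (h.adj_parent hx).reachable.trans (ih (p x) (by omega))

theorem connected (h : IsRooted G o p d) : G.Connected :=
  { preconnected := fun x y => (h.reachable_root x).trans (h.reachable_root y).symm
    nonempty := ⟨o⟩ }

theorem parent_edge_injective (h : IsRooted G o p d) {x y : V} (hx : x ≠ o) (hy : y ≠ o)
    (he : s(x, p x) = s(y, p y)) : x = y := by
  rcases Sym2.eq_iff.1 he with ⟨h1, -⟩ | ⟨h1, h2⟩
  · exact h1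
  · have a := h.depth_parent x hx
    have b := h.depth_parent y hy
    rw [h2] at a
    rw [← h1] at b
    omega

/-- Each vertex other than the root owns the edge to its parent, and every edge arises once, so a
connected graph with one edge fewer than vertices is obtained. -/
theorem isTree [Finite V] (h : IsRooted G o p d) : G.IsTree := by
  rw [SimpleGraph.isTree_iff_connected_and_card]
  refine ⟨h.connected, ?_⟩
  have e : {x : V // x ≠ o} ≃ G.edgeSet := by
    refine Equiv.ofBijective
      (fun x => ⟨s(x.1, p x.1), h.adj_parent x.2⟩) ⟨?_, ?_⟩
    · intro x y hxy
      exact Subtype.ext (h.parent_edge_injective x.2 y.2 (congrArg Subtype.val hxy))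
    · rintro ⟨e, he⟩
      induction e with
      | _ x y =>
        rcases (h.adj_iff x y).1 he with ⟨hx, rfl⟩ | ⟨hy, rfl⟩
        · exact ⟨⟨x, hx⟩, rfl⟩
        · exact ⟨⟨y, hy⟩, Subtype.ext Sym2.eq_swap⟩
  classical
  have := Fintype.ofFinite V
  rw [← Nat.card_congr e, Nat.card_eq_fintype_card, Nat.card_eq_fintype_card,
    Fintype.card_subtype_compl, Fintype.card_subtype_eq]
  have : 0 < Fintype.card V := Fintype.card_pos_iff.2 ⟨o⟩
  omega

theorem neighborSet_eq (h : IsRooted G o p d) {x : V} (hx : x ≠ o) :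
    G.neighborSet x = insert (p x) {c | c ≠ o ∧ p c = x} := by
  ext y
  simp only [SimpleGraph.mem_neighborSet, h.adj_iff, Set.mem_insert_iff, Set.mem_ofPred_eq]
  constructor
  · rintro (⟨-, e⟩ | e)
    · exact Or.inl e.symm
    · exact Or.inr e
  · rintro (e | e)
    · exact Or.inl ⟨hx, e.symm⟩
    · exact Or.inr e

/-- A vertex different from the root is a leaf if and only if it has no child. -/
theorem isLeaf_iff (h : IsRooted G o p d) {x : V} (hx : x ≠ o) :
    IsLeaf G x ↔ ∀ c, c ≠ o → p c ≠ x := by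
  unfold IsLeaf
  rw [h.neighborSet_eq hx, Set.ncard_eq_one]
  constructor
  · rintro ⟨a, ha⟩ c hc hcx
    have h1 : p x ∈ ({a} : Set V) := ha ▸ Set.mem_insert _ _
    have h2 : c ∈ ({a} : Set V) := ha ▸ Set.mem_insert_of_mem _ ⟨hc, hcx⟩
    have h3 : c = p x := by rw [h1, h2]
    have a1 := h.depth_parent x hx
    have a2 := h.depth_parent c hc
    rw [hcx, h3] at a2
    omega
  · intro hc
    refine ⟨p x, ?_⟩
    have : {c | c ≠ o ∧ p c = x} = ∅ := by
      ext c
      simpa using hc c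
    rw [this]
    simp

/-- Below every vertex other than the root there is a leaf. -/
theorem exists_leaf_below [Finite V] (h : IsRooted G o p d) {x : V} (hx : x ≠ o) :
    ∃ z, z ≠ o ∧ IsLeaf G z ∧ Below p x z := by
  obtain ⟨z, hz, hmax⟩ := Set.exists_max_image {z | Below p x z} d (Set.toFinite _)
    ⟨x, below_refl p x⟩
  have hzo : z ≠ o := by
    rintro rfl
    exact h.not_below_root hx hz
  refine ⟨z, hzo, ?_, hz⟩
  rw [h.isLeaf_iff hzo]
  rintro c hc rfl
  have h1 := hmax c ((eq_or_below_parent p).2 (Or.inr hz))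
  have h2 := h.depth_parent c hc
  omega

open scoped Classical in
theorem sum_below_eq [Fintype V] (h : IsRooted G o p d) (θ : V → ℝ) {z : V} (hz : z ≠ o) :
    (∑ x, if x ≠ o ∧ Below p x z then θ x else 0)
      = θ z + ∑ x, if x ≠ o ∧ Below p x (p z) then θ x else 0 := by
  have hs : θ z = ∑ x, if x = z then θ x else 0 := by simp
  rw [hs, ← Finset.sum_add_distrib]
  refine Finset.sum_congr rfl fun x _ => ?_
  by_cases hx : x = o
  · have : x ≠ z := fun e => hz (e.symm.trans hx)
    simp [hx, hz.symm]
  · have h1 := eq_or_below_parent p (x := x) (z := z)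
    by_cases hxz : x = z
    · subst hxz
      simp [h.not_below_parent hx, hx, below_refl]
    · simp [h1, hxz]

open scoped Classical in
theorem sum_below_root [Fintype V] (h : IsRooted G o p d) (θ : V → ℝ) :
    (∑ x, if x ≠ o ∧ Below p x o then θ x else 0) = 0 := by
  refine Finset.sum_eq_zero fun x _ => ?_
  rw [if_neg]
  rintro ⟨hx, hb⟩
  exact h.not_below_root hx hb

open scoped Classical in
/-- The number of proper ancestors-or-self other than the root is the depth. -/
theorem sum_below_one [Fintype V] (h : IsRooted G o p d) (z : V) :
    (∑ x, if x ≠ o ∧ Below p x z then (1 : ℝ) else 0) = d z := by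
  induction hn : d z generalizing z with
  | zero =>
    rw [h.depth_eq_zero.1 hn, h.sum_below_root]
    simp
  | succ n ih =>
    have hz : z ≠ o := fun e => by rw [e, h.depth_root] at hn; omega
    have hd := h.depth_parent z hz
    rw [h.sum_below_eq (fun _ => 1) hz, ih (p z) (by omega)]
    push_cast
    ring

open scoped Classical in
/-- The total mass below `x` is the mass at `x` plus the masses below the children of `x`. -/
theorem sum_children [Fintype V] (h : IsRooted G o p d) (Q : V → ℝ) (x : V) :
    (∑ z, if Below p x z then Q z else 0)
      = Q x + ∑ c, if c ≠ o ∧ p c = x then ∑ z, if Below p c z then Q z else 0 else 0 := by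
  have h1 : (∑ c, if c ≠ o ∧ p c = x then ∑ z, if Below p c z then Q z else 0 else 0)
      = ∑ z, ∑ c, if (c ≠ o ∧ p c = x) ∧ Below p c z then Q z else 0 := by
    rw [Finset.sum_comm]
    refine Finset.sum_congr rfl fun c _ => ?_
    by_cases hc : c ≠ o ∧ p c = x
    · simp only [hc, true_and, if_true, not_false_eq_true, ne_eq]
    · simp only [hc, false_and, if_false, Finset.sum_const_zero]
  have h2 : Q x = ∑ z, if z = x then Q z else 0 := by simp
  rw [h1, h2, ← Finset.sum_add_distrib]
  refine Finset.sum_congr rfl fun z _ => ?_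
  by_cases hb : Below p x z
  · by_cases hzx : z = x
    · subst hzx
      rw [if_pos hb, if_pos rfl, Finset.sum_eq_zero, add_zero]
      rintro c -
      rw [if_neg]
      rintro ⟨⟨hc, hcz⟩, hbc⟩
      have := (h.below_iff_iterate.1 hbc).1
      have := h.depth_parent c hc
      rw [hcz] at this
      omega
    · obtain ⟨c, hc, hcx, hcz⟩ := h.exists_child hb hzx
      rw [if_pos hb, if_neg hzx, Finset.sum_eq_single c, if_pos ⟨⟨hc, hcx⟩, hcz⟩, zero_add]
      · rintro c' - hne
        rw [if_neg]
        rintro ⟨⟨hc', hcx'⟩, hcz'⟩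
        have a := h.depth_parent c hc
        have b := h.depth_parent c' hc'
        rw [hcx] at a
        rw [hcx'] at b
        exact hne (h.below_unique hcz' hcz (by omega))
      · simp
  · have hzx : z ≠ x := by
      rintro rfl
      exact hb (below_refl p z)
    rw [if_neg hb, if_neg hzx, Finset.sum_eq_zero, add_zero]
    rintro c -
    rw [if_neg]
    rintro ⟨⟨-, rfl⟩, hbc⟩
    exact hb (Below.trans ⟨1, rfl⟩ hbc)

open scoped Classical in
theorem laplacian_eq [Fintype V] (h : IsRooted G o p d) (f : V → ℝ) {x : V} (hx : x ≠ o) :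
    laplacian G f x = (f x - f (p x)) - ∑ c, if c ≠ o ∧ p c = x then f c - f (p c) else 0 := by
  unfold laplacian
  have h1 : f x - f (p x) = ∑ w, if w = p x then f x - f w else 0 := by simp
  rw [h1, ← Finset.sum_sub_distrib]
  refine Finset.sum_congr rfl fun w _ => ?_
  by_cases hw : w = p x
  · subst hw
    have : ¬ (p x ≠ o ∧ p (p x) = x) := by
      rintro ⟨a, b⟩
      have := h.depth_parent x hx
      have := h.depth_parent _ a
      rw [b] at this
      omega
    rw [if_pos (h.adj_parent hx), if_pos rfl, if_neg this, sub_zero]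
  · by_cases hc : w ≠ o ∧ p w = x
    · rw [if_pos ((h.adj_iff x w).2 (Or.inr hc)), if_neg hw, if_pos hc, hc.2]
      ring
    · rw [if_neg, if_neg hw, if_neg hc, sub_zero]
      rw [h.adj_iff]
      rintro (⟨-, e⟩ | e)
      · exact hw e.symm
      · exact hc e

open scoped Classical in
theorem laplacian_root [Fintype V] (h : IsRooted G o p d) (f : V → ℝ) :
    laplacian G f o = - ∑ c, if c ≠ o ∧ p c = o then f c - f (p c) else 0 := by
  unfold laplacian
  rw [← Finset.sum_neg_distrib]
  refine Finset.sum_congr rfl fun w _ => ?_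
  by_cases hc : w ≠ o ∧ p w = o
  · rw [if_pos ((h.adj_iff o w).2 (Or.inr hc)), if_pos hc, hc.2]
    ring
  · rw [if_neg, if_neg hc, neg_zero]
    rw [h.adj_iff]
    rintro (⟨e, -⟩ | e)
    · exact e rfl
    · exact hc e

theorem dist_root (h : IsRooted G o p d) (x : V) : G.dist o x = d x := by
  refine le_antisymm ?_ ?_
  · induction hn : d x generalizing x with
    | zero => rw [h.depth_eq_zero.1 hn]; simp
    | succ n ih =>
      have hx : x ≠ o := fun e => by rw [e, h.depth_root] at hn; omega
      have h1 := h.depth_parent x hx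
      have h2 := ih (p x) (by omega)
      have h3 := h.connected.dist_triangle (u := o) (v := p x) (w := x)
      have h4 : G.dist (p x) x = 1 := SimpleGraph.dist_eq_one_iff_adj.2 (h.adj_parent hx).symm
      omega
  · obtain ⟨w, hw⟩ := h.connected.exists_walk_length_eq_dist o x
    rw [← hw]
    have key : ∀ {a b : V} (w : G.Walk a b), d b ≤ d a + w.length := by
      intro a b w
      induction w with
      | nil => simp
      | @cons a c b hadj w ih =>
        rw [SimpleGraph.Walk.length_cons]
        rcases (h.adj_iff a c).1 hadj with ⟨ha, rfl⟩ | ⟨hc, rfl⟩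
        · have := h.depth_parent a ha; omega
        · have := h.depth_parent c hc; omega
    simpa [h.depth_root] using key w

end IsRooted

/-! ### Lipschitz functions and rooting a tree at a vertex. -/

/-- An integer function changing by at most one along edges is `1`-Lipschitz for the distance. -/
theorem sub_le_dist {V : Type*} {G : SimpleGraph V} (hG : G.Connected) (φ : V → ℤ)
    (hφ : ∀ x y, G.Adj x y → φ x - φ y ≤ 1) (x y : V) : φ x - φ y ≤ G.dist x y := by
  obtain ⟨w, hw⟩ := hG.exists_walk_length_eq_dist x y
  rw [← hw]
  clear hw
  induction w with
  | nil => simp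
  | cons hadj w ih =>
    rw [SimpleGraph.Walk.length_cons]
    have := hφ _ _ hadj
    push_cast
    linarith

/-- Every tree can be rooted at any of its vertices. -/
theorem exists_isRooted {V : Type*} [Finite V] {G : SimpleGraph V} (hG : G.IsTree) (o : V) :
    ∃ p : V → V, IsRooted G o p (G.dist o) := by
  classical
  have hex : ∀ x, ∃ y, x ≠ o → G.Adj x y ∧ G.dist o x = G.dist o y + 1 := by
    intro x
    by_cases hx : x = o
    · exact ⟨o, fun h => absurd hx h⟩
    · obtain ⟨w, hw⟩ := hG.connected.exists_walk_length_eq_dist x o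
      cases w with
      | nil => exact absurd rfl hx
      | @cons _ y _ hadj w =>
        refine ⟨y, fun _ => ⟨hadj, ?_⟩⟩
        rw [SimpleGraph.Walk.length_cons] at hw
        have h1 : G.dist y o ≤ w.length := SimpleGraph.dist_le w
        have h2 := hG.connected.dist_triangle (u := x) (v := y) (w := o)
        have h3 : G.dist x y = 1 := SimpleGraph.dist_eq_one_iff_adj.2 hadj
        rw [SimpleGraph.dist_comm (u := o), SimpleGraph.dist_comm (u := o)]
        omega
  choose p₀ hp₀ using hex
  let p : V → V := fun x => if x = o then o else p₀ x
  have hpo : p o = o := if_pos rfl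
  have hp : ∀ x, x ≠ o → G.Adj x (p x) ∧ G.dist o x = G.dist o (p x) + 1 := by
    intro x hx
    have : p x = p₀ x := if_neg hx
    rw [this]
    exact hp₀ x hx
  have hinj : ∀ x y, x ≠ o → y ≠ o → s(x, p x) = s(y, p y) → x = y := by
    intro x y hx hy he
    rcases Sym2.eq_iff.1 he with ⟨h1, -⟩ | ⟨h1, h2⟩
    · exact h1
    · have a := (hp x hx).2
      have b := (hp y hy).2
      rw [h2] at a
      rw [← h1] at b
      omega
  have := Fintype.ofFinite V
  have hcard := hG.card_edgeFinset
  -- The parent edges are distinct, and there are as many of them as edges of the tree; hence every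
  -- edge is a parent edge.
  have himg : (Finset.univ.erase o).image (fun x => s(x, p x)) = G.edgeFinset := by
    refine Finset.eq_of_subset_of_card_le ?_ ?_
    · intro e he
      obtain ⟨x, hx, rfl⟩ := Finset.mem_image.1 he
      rw [SimpleGraph.mem_edgeFinset]
      exact (hp x (Finset.ne_of_mem_erase hx)).1
    · rw [Finset.card_image_of_injOn, Finset.card_erase_of_mem (Finset.mem_univ o),
        Finset.card_univ]
      · omega
      · intro x hx y hy he
        exact hinj x y (Finset.ne_of_mem_erase hx) (Finset.ne_of_mem_erase hy) he
  refine ⟨p, ⟨?_, hpo, SimpleGraph.dist_self, fun x hx => (hp x hx).2⟩⟩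
  intro x y
  constructor
  · intro hadj
    have he : s(x, y) ∈ G.edgeFinset := SimpleGraph.mem_edgeFinset.2 hadj
    rw [← himg] at he
    obtain ⟨z, hz, hze⟩ := Finset.mem_image.1 he
    have hzo := Finset.ne_of_mem_erase hz
    rcases Sym2.eq_iff.1 hze with ⟨rfl, rfl⟩ | ⟨rfl, rfl⟩
    · exact Or.inl ⟨hzo, rfl⟩
    · exact Or.inr ⟨hzo, rfl⟩
  · rintro (⟨hx, rfl⟩ | ⟨hy, rfl⟩)
    · exact (hp x hx).1
    · exact (hp y hy).1.symm

/-! ### Thomson's principle for Steklov eigenvalues. -/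

/-- The largest squared singular value of a linear map, with a singular vector. -/
theorem exists_max_singular {W E : Type*} [NormedAddCommGroup W] [InnerProductSpace ℝ W]
    [FiniteDimensional ℝ W] [NormedAddCommGroup E] [InnerProductSpace ℝ E]
    [FiniteDimensional ℝ E] (Θ : W →ₗ[ℝ] E) (w₀ : W) (h₀ : Θ w₀ ≠ 0) :
    ∃ (Λ : ℝ) (w : W), 0 < Λ ∧ w ≠ 0 ∧ ‖Θ w₀‖ ^ 2 ≤ Λ * ‖w₀‖ ^ 2 ∧
      ∀ w', inner ℝ (Θ w) (Θ w') = Λ * inner ℝ w w' := by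
  have hw₀ : w₀ ≠ 0 := by
    rintro rfl
    exact h₀ (map_zero Θ)
  have : Nontrivial W := ⟨⟨w₀, 0, hw₀⟩⟩
  let T : W →ₗ[ℝ] W := Θ.adjoint ∘ₗ Θ
  have hT : ∀ a b, inner ℝ (T a) b = inner ℝ (Θ a) (Θ b) := by
    intro a b
    exact LinearMap.adjoint_inner_left Θ b (Θ a)
  have hsym : T.IsSymmetric := by
    intro a b
    rw [hT, real_inner_comm (T b) a, hT, real_inner_comm]
  have hev := hsym.hasEigenvalue_iSup_of_finiteDimensional
  set Λ : ℝ := ⨆ x : { x : W // x ≠ 0 }, RCLike.re (inner ℝ (T ↑x) (x : W)) / ‖(x : W)‖ ^ 2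
    with hΛ
  obtain ⟨w, hw⟩ := hev.exists_hasEigenvector
  have hbdd : BddAbove (Set.range fun x : { x : W // x ≠ 0 } =>
      RCLike.re (inner ℝ (T ↑x) (x : W)) / ‖(x : W)‖ ^ 2) := by
    refine ⟨‖LinearMap.toContinuousLinearMap T‖, ?_⟩
    rintro _ ⟨x, rfl⟩
    exact (le_abs_self _).trans
      ((LinearMap.toContinuousLinearMap T).rayleighQuotient_le_norm (x : W))
  have hle : ‖Θ w₀‖ ^ 2 / ‖w₀‖ ^ 2 ≤ Λ := by
    have := le_ciSup hbdd ⟨w₀, hw₀⟩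
    rw [← hΛ] at this
    simpa [hT] using this
  have hpos : 0 < ‖w₀‖ ^ 2 := by positivity
  have hpos' : 0 < ‖Θ w₀‖ ^ 2 := by positivity
  refine ⟨Λ, w, lt_of_lt_of_le (div_pos hpos' hpos) hle, hw.2, ?_, ?_⟩
  · rwa [div_le_iff₀ hpos] at hle
  · intro w'
    rw [← hT, hw.apply_eq_smul]
    exact real_inner_smul_left w w' _

namespace IsRooted

variable {V : Type*} [Fintype V] {G : SimpleGraph V} {o : V} {p : V → V} {d : V → ℕ}

open scoped Classical in
/-- Thomson's principle: a balanced flow out of the leaves bounds `lambda2` from above. -/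
theorem lambda2_mul_le (h : IsRooted G o p d) (ho : ¬ IsLeaf G o) (Q : V → ℝ)
    (hQ : ∀ z, ¬ IsLeaf G z → Q z = 0) (hsum : ∑ z, Q z = 0) :
    lambda2 G * (∑ x, if x ≠ o then (∑ z, if Below p x z then Q z else 0) ^ 2 else 0)
      ≤ ∑ z, Q z ^ 2 := by
  by_cases h0 : (∑ x, if x ≠ o then (∑ z, if Below p x z then Q z else 0) ^ 2 else 0) = 0
  · rw [h0, mul_zero]
    positivity
  -- `W` is the space of balanced leaf charges. `Θ₀` sends a charge to its flow, the flow through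
  -- the edge from `x` to its parent being stored at `x` and the root getting `0`.
  let W : Submodule ℝ (EuclideanSpace ℝ V) :=
    { carrier := {q | (∀ z, ¬ IsLeaf G z → q z = 0) ∧ ∑ z, q z = 0}
      add_mem' := by
        rintro a b ⟨ha, ha'⟩ ⟨hb, hb'⟩
        refine ⟨fun z hz => ?_, ?_⟩
        · rw [PiLp.add_apply, ha z hz, hb z hz, add_zero]
        · simp only [PiLp.add_apply, Finset.sum_add_distrib, ha', hb', add_zero]
      zero_mem' := by simp
      smul_mem' := by
        rintro c a ⟨ha, ha'⟩
        refine ⟨fun z hz => ?_, ?_⟩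
        · rw [PiLp.smul_apply, ha z hz, smul_zero]
        · simp only [PiLp.smul_apply, ← Finset.smul_sum, ha', smul_zero] }
  let Θ₀ : EuclideanSpace ℝ V →ₗ[ℝ] EuclideanSpace ℝ V :=
    { toFun := fun q => WithLp.toLp 2 fun x =>
        if x ≠ o then ∑ z, if Below p x z then q z else 0 else 0
      map_add' := by
        intro a b
        ext x
        by_cases hx : x = o
        · simp [hx]
        · simp only [hx, ne_eq, not_false_eq_true, if_true, PiLp.add_apply,
            ← Finset.sum_add_distrib]
          exact Finset.sum_congr rfl fun z _ => by split_ifs <;> simp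
      map_smul' := by
        intro c a
        ext x
        by_cases hx : x = o
        · simp [hx]
        · simp only [hx, ne_eq, not_false_eq_true, if_true, PiLp.smul_apply, Finset.smul_sum,
            RingHom.id_apply]
          exact Finset.sum_congr rfl fun z _ => by split_ifs <;> simp }
  let Θ : W →ₗ[ℝ] EuclideanSpace ℝ V := Θ₀ ∘ₗ W.subtype
  have hΘ : ∀ (q : W) (x : V), Θ q x =
      if x ≠ o then ∑ z, if Below p x z then (q : EuclideanSpace ℝ V) z else 0 else 0 :=
    fun q x => rfl
  let q₀ : W := ⟨WithLp.toLp 2 Q, hQ, hsum⟩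
  have hq₀ : ‖Θ q₀‖ ^ 2
      = ∑ x, if x ≠ o then (∑ z, if Below p x z then Q z else 0) ^ 2 else 0 := by
    rw [EuclideanSpace.real_norm_sq_eq]
    refine Finset.sum_congr rfl fun x _ => ?_
    rw [hΘ]
    split_ifs
    · rfl
    · simp
  have hq₀' : ‖q₀‖ ^ 2 = ∑ z, Q z ^ 2 := EuclideanSpace.real_norm_sq_eq _
  obtain ⟨Λ, q, hΛ, hq, hle, heq⟩ := exists_max_singular Θ q₀ (by
    intro hz
    rw [hz] at hq₀
    exact h0 (by rw [← hq₀]; simp))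
  rw [hq₀, hq₀'] at hle
  obtain ⟨qf, hqf⟩ : ∃ qf : V → ℝ, qf = fun z => (q : EuclideanSpace ℝ V) z := ⟨_, rfl⟩
  have hqleaf : ∀ z, ¬ IsLeaf G z → qf z = 0 := by rw [hqf]; exact q.2.1
  have hqsum : ∑ z, qf z = 0 := by rw [hqf]; exact q.2.2
  obtain ⟨θ, hθ⟩ : ∃ θ : V → ℝ, θ = fun x => ∑ z, if Below p x z then qf z else 0 := ⟨_, rfl⟩
  -- The potential of the optimal flow: `θ` summed along the path from the root.
  obtain ⟨f, hf⟩ : ∃ f : V → ℝ, f = fun z => ∑ x, if x ≠ o ∧ Below p x z then θ x else 0 :=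
    ⟨_, rfl⟩
  have hfstep : ∀ z, z ≠ o → f z - f (p z) = θ z := by
    intro z hz
    have := h.sum_below_eq θ hz
    rw [hf]
    simp only
    rw [this]
    ring
  -- the pairing identity
  have hpair : ∀ Q' : V → ℝ, (∀ z, ¬ IsLeaf G z → Q' z = 0) → ∑ z, Q' z = 0 →
      ∑ z, (f z - Λ * qf z) * Q' z = 0 := by
    intro Q' h1 h2
    have h3 := heq ⟨WithLp.toLp 2 Q', h1, h2⟩
    have h4 : inner ℝ (Θ q) (Θ ⟨WithLp.toLp 2 Q', h1, h2⟩) = ∑ z, f z * Q' z := by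
      rw [PiLp.inner_apply, hf]
      have : ∀ z, (∑ x, if x ≠ o ∧ Below p x z then θ x else 0) * Q' z
          = ∑ x, if x ≠ o ∧ Below p x z then θ x * Q' z else 0 := by
        intro z
        rw [Finset.sum_mul]
        exact Finset.sum_congr rfl fun x _ => by split_ifs <;> simp
      simp only [this]
      rw [Finset.sum_comm]
      refine Finset.sum_congr rfl fun x _ => ?_
      rw [hΘ, hΘ]
      by_cases hx : x = o
      · simp [hx]
      · simp only [hx, ne_eq, not_false_eq_true, if_true, true_and]
        have : θ x = ∑ z, if Below p x z then (q : EuclideanSpace ℝ V) z else 0 := by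
          rw [hθ, hqf]
        rw [← this]
        simp only [RCLike.inner_apply, conj_trivial]
        rw [Finset.sum_mul]
        exact Finset.sum_congr rfl fun z _ => by split_ifs <;> simp [mul_comm]
    have h5 : inner ℝ q (⟨WithLp.toLp 2 Q', h1, h2⟩ : W) = ∑ z, qf z * Q' z := by
      rw [Submodule.coe_inner, PiLp.inner_apply, hqf]
      refine Finset.sum_congr rfl fun z _ => ?_
      simp [mul_comm]
    rw [h4, h5] at h3
    simp only [sub_mul, Finset.sum_sub_distrib, h3, mul_assoc, ← Finset.mul_sum, sub_self]
  -- Moving a unit of charge from `b` to `a` keeps the charge balanced, so it may be used in the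
  -- pairing.
  have hconst : ∀ a b, IsLeaf G a → IsLeaf G b → f a - Λ * qf a = f b - Λ * qf b := by
    intro a b ha hb
    have := hpair (fun z => (if z = a then 1 else 0) - if z = b then 1 else 0) ?_ ?_
    · simp only [mul_sub, Finset.sum_sub_distrib, mul_ite, mul_one, mul_zero, Finset.sum_ite_eq',
        Finset.mem_univ, if_true] at this
      linarith
    · intro z hz
      have h1 : z ≠ a := fun e => hz (e ▸ ha)
      have h2 : z ≠ b := fun e => hz (e ▸ hb)
      simp [h1, h2]
    · simp
  obtain ⟨ω₀, hω₀⟩ : ∃ ω, IsLeaf G ω := by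
    by_contra hne
    push Not at hne
    apply hq
    ext z
    have := hqleaf z (hne z)
    rw [hqf] at this
    exact this
  obtain ⟨c, hc⟩ : ∃ c, c = f ω₀ - Λ * qf ω₀ := ⟨_, rfl⟩
  have hleaf : ∀ ω, IsLeaf G ω → f ω - c = Λ * qf ω := by
    intro ω hω
    have := hconst ω ω₀ hω hω₀
    linarith
  -- The eigenfunction is `f - c`. Off the leaves it is harmonic because flow is conserved, and at
  -- the root because the total charge vanishes. At a leaf the increment of `f` is the charge, which
  -- is `(f - c) / Λ`.
  have heig : IsSteklovEigenvalue G (1 / Λ) := by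
    refine ⟨by positivity, fun z => f z - c, ?_, ?_, ?_⟩
    · intro hzero
      apply hq
      ext z
      have h1 : qf z = 0 := by
        by_cases hz : IsLeaf G z
        · have h2 := hleaf z hz
          have h3 : f z - c = 0 := congrFun hzero z
          rw [h3] at h2
          exact (mul_eq_zero.1 h2.symm).resolve_left hΛ.ne'
        · exact hqleaf z hz
      rw [hqf] at h1
      exact h1
    · intro x hx
      have hchild : (∑ y, if y ≠ o ∧ p y = x then (f y - c) - (f (p y) - c) else 0)
          = ∑ y, if y ≠ o ∧ p y = x then ∑ z, if Below p y z then qf z else 0 else 0 := by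
        refine Finset.sum_congr rfl fun y _ => ?_
        by_cases hy : y ≠ o ∧ p y = x
        · rw [if_pos hy, if_pos hy, sub_sub_sub_cancel_right, hfstep y hy.1, hθ]
        · rw [if_neg hy, if_neg hy]
      have hsc := h.sum_children qf x
      rw [hqleaf x hx, zero_add] at hsc
      by_cases hxo : x = o
      · subst hxo
        rw [h.laplacian_root, hchild, ← hsc]
        simp only [h.below_root, if_true, hqsum, neg_zero]
      · rw [h.laplacian_eq _ hxo, hchild, ← hsc, sub_sub_sub_cancel_right, hfstep x hxo, hθ,
          sub_self]
    · intro ω ω' hω hadj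
      have hωo : ω ≠ o := fun e => ho (e ▸ hω)
      have hnc := (h.isLeaf_iff hωo).1 hω
      have hpω : p ω = ω' := by
        rcases (h.adj_iff ω ω').1 hadj with ⟨-, e⟩ | ⟨h1, h2⟩
        · exact e
        · exact absurd h2 (hnc ω' h1)
      have hsc := h.sum_children qf ω
      have hz : (∑ y, if y ≠ o ∧ p y = ω then ∑ z, if Below p y z then qf z else 0 else 0)
          = 0 := by
        refine Finset.sum_eq_zero fun y _ => ?_
        rw [if_neg]
        rintro ⟨h1, h2⟩
        exact hnc y h1 h2
      rw [hz, add_zero] at hsc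
      simp only
      rw [hleaf ω hω, ← hpω]
      have h1 : θ ω = qf ω := by rw [hθ]; exact hsc
      have h2 := hfstep ω hωo
      have h3 := hleaf ω hω
      field_simp
      linarith
  have hl2 : lambda2 G ≤ 1 / Λ := by
    refine csInf_le ⟨0, ?_⟩ ⟨by positivity, heig⟩
    rintro μ ⟨-, hμ⟩
    exact hμ.1
  have hnn : 0 ≤ ∑ x, if x ≠ o then (∑ z, if Below p x z then Q z else 0) ^ 2 else 0 := by
    rw [← hq₀]
    positivity
  calc _ ≤ 1 / Λ * (∑ x, if x ≠ o then (∑ z, if Below p x z then Q z else 0) ^ 2 else 0) :=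
        mul_le_mul_of_nonneg_right hl2 hnn
    _ ≤ 1 / Λ * (Λ * ∑ z, Q z ^ 2) := mul_le_mul_of_nonneg_left hle (by positivity)
    _ = ∑ z, Q z ^ 2 := by field_simp

end IsRooted

/-! ### Path responses and the central edge of a tree of odd diameter. -/

/-- The response `1 / (1 - ℓ x)` of a path of length `ℓ` at the spectral parameter `x`. -/
noncomputable def legResponse (x : ℝ) (ℓ : ℕ) : ℝ := 1 / (1 - (ℓ : ℝ) * x)

theorem one_sub_pos_of_mem {r ℓ : ℕ} {x : ℝ} (hr : 1 ≤ r) (hx : x ∈ rootInterval r)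
    (hℓ : ℓ ≤ r) : 0 < 1 - (ℓ : ℝ) * x := by
  have hr' : (0 : ℝ) < r := by exact_mod_cast hr
  have h0 : 0 < x := lt_trans (by positivity) hx.1
  have h1 : x * r < 1 := (lt_div_iff₀ hr').1 hx.2
  have h2 : (ℓ : ℝ) ≤ r := by exact_mod_cast hℓ
  nlinarith

theorem pos_of_mem {r : ℕ} {x : ℝ} (hx : x ∈ rootInterval r) : 0 < x :=
  lt_trans (by positivity) hx.1

theorem legResponse_pos {r ℓ : ℕ} {x : ℝ} (hr : 1 ≤ r) (hx : x ∈ rootInterval r)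
    (hℓ : ℓ ≤ r) : 0 < legResponse x ℓ :=
  one_div_pos.2 (one_sub_pos_of_mem hr hx hℓ)

theorem one_sub_succ_neg {r : ℕ} {x : ℝ} (hx : x ∈ rootInterval r) :
    1 - ((r : ℝ) + 1) * x < 0 := by
  have h1 : 1 < x * ((r : ℝ) + 1) := (div_lt_iff₀ (by positivity)).1 hx.1
  linarith

/-- The edge `u v` is the centre of the tree `G` of diameter `2 r + 1`, and `x₀`, `y₀` are the
ends of a diametral path, on the sides of `v` and `u`. -/
structure IsCenterEdge {V : Type*} (G : SimpleGraph V) (r : ℕ) (u v x₀ y₀ : V) : Prop where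
  adj : G.Adj u v
  dist_vx : G.dist v x₀ = r
  dist_ux : G.dist u x₀ = r + 1
  dist_uy : G.dist u y₀ = r
  dist_vy : G.dist v y₀ = r + 1
  le_of_v : ∀ w, G.dist v w < G.dist u w → G.dist v w ≤ r
  le_of_u : ∀ w, G.dist u w < G.dist v w → G.dist u w ≤ r

theorem IsCenterEdge.symm {V : Type*} {G : SimpleGraph V} {r : ℕ} {u v x₀ y₀ : V}
    (h : IsCenterEdge G r u v x₀ y₀) : IsCenterEdge G r v u y₀ x₀ :=
  ⟨h.adj.symm, h.dist_uy, h.dist_vy, h.dist_vx, h.dist_ux, h.le_of_u, h.le_of_v⟩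

namespace IsRooted

variable {V : Type*} {G : SimpleGraph V} {u : V} {p : V → V} {d : V → ℕ}

/-- The distance between vertices separated by the edge from the root to its child `v`. -/
theorem le_dist_of_separated (h : IsRooted G u p d) {v z w : V} (hpv : p v = u)
    (hz : Below p v z) (hw : ¬ Below p v w) : d z + d w ≤ G.dist z w := by
  classical
  -- The depth, counted positively beyond `v` and negatively elsewhere, is `1`-Lipschitz: across the
  -- edge from `u` to `v` it goes from `0` to `1`.
  have key := sub_le_dist h.connected (fun z => if Below p v z then (d z : ℤ) else -(d z : ℤ))
    (by
      have step : ∀ x, x ≠ u →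
          |(if Below p v x then (d x : ℤ) else -(d x : ℤ))
            - (if Below p v (p x) then (d (p x) : ℤ) else -(d (p x) : ℤ))| ≤ 1 := by
        intro x hx
        have h1 := h.depth_parent x hx
        have h2 := eq_or_below_parent p (x := v) (z := x)
        by_cases hxv : v = x
        · subst hxv
          have h3 : d (p v) = 0 := by rw [hpv, h.depth_root]
          simp [below_refl, h3, h1]
        · have h4 : Below p v x ↔ Below p v (p x) := by simpa [hxv] using h2
          by_cases hb : Below p v (p x)
          · rw [if_pos hb, if_pos (h4.2 hb), h1]
            simp
          · rw [if_neg hb, if_neg (fun e => hb (h4.1 e)), h1]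
            simp
      intro x y hxy
      rcases (h.adj_iff x y).1 hxy with ⟨hx, rfl⟩ | ⟨hy, rfl⟩
      · exact (abs_le.1 (step x hx)).2
      · have := (abs_le.1 (step y hy)).1
        linarith) z w
  simp only [hz, hw, if_true, if_false] at key
  omega

theorem dist_iterate_le (h : IsRooted G u p d) (j : ℕ) (z : V) (hj : j ≤ d z) :
    G.dist (p^[j] z) z ≤ j := by
  induction j generalizing z with
  | zero => simp
  | succ j ih =>
    have hzu : z ≠ u := fun e => by rw [e, h.depth_root] at hj; omega
    have h1 := h.depth_parent z hzu
    rw [Function.iterate_succ_apply]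
    have h2 := ih (p z) (by omega)
    have h3 := h.connected.dist_triangle (u := p^[j] (p z)) (v := p z) (w := z)
    have h4 : G.dist (p z) z = 1 := SimpleGraph.dist_eq_one_iff_adj.2 (h.adj_parent hzu).symm
    omega

theorem dist_of_below (h : IsRooted G u p (G.dist u)) {v w : V} (hv : v ≠ u) (hpv : p v = u)
    (hw : Below p v w) : G.dist u w = G.dist v w + 1 := by
  have h0 : G.dist u v = 1 := by
    have := h.depth_parent v hv
    rw [hpv, h.depth_root] at this
    exact this
  have h1 := h.connected.dist_triangle (u := u) (v := v) (w := w)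
  have h2 : G.dist u w ≥ 1 + G.dist v w := by
    obtain ⟨hle, hj⟩ := h.below_iff_iterate.1 hw
    have := h.dist_iterate_le (G.dist u w - G.dist u v) w (by omega)
    rw [hj] at this
    omega
  omega

theorem dist_of_not_below (h : IsRooted G u p (G.dist u)) {v w : V} (hv : v ≠ u)
    (hpv : p v = u) (hw : ¬ Below p v w) : G.dist v w = G.dist u w + 1 := by
  have h0 : G.dist u v = 1 := by
    have := h.depth_parent v hv
    rw [hpv, h.depth_root] at this
    exact this
  have h1 := h.connected.dist_triangle (u := v) (v := u) (w := w)
  have h2 := h.le_dist_of_separated hpv (below_refl p v) hw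
  rw [SimpleGraph.dist_comm (u := v) (v := u)] at h1
  omega

theorem parent_of_adj (h : IsRooted G u p d) {v : V} (hv : G.Adj u v) : v ≠ u ∧ p v = u := by
  rcases (h.adj_iff u v).1 hv with ⟨e, -⟩ | e
  · exact absurd rfl e
  · exact e

end IsRooted

/-- A tree of diameter `2 r + 1` has a central edge. -/
theorem exists_isCenterEdge {V : Type*} [Finite V] {G : SimpleGraph V} (hG : G.IsTree) {r : ℕ}
    (hd : G.diam = 2 * r + 1) : ∃ u v x₀ y₀, IsCenterEdge G r u v x₀ y₀ := by
  have := hG.connected.nonempty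
  obtain ⟨y₀, x₀, hxy⟩ := G.exists_dist_eq_diam
  rw [hd] at hxy
  have hle : ∀ a b, G.dist a b ≤ 2 * r + 1 := by
    intro a b
    rw [← hd]
    exact SimpleGraph.dist_le_diam (SimpleGraph.connected_iff_ediam_ne_top.1 hG.connected)
  obtain ⟨p, hp⟩ := exists_isRooted hG y₀
  -- On a path of length `2r+1` from `x₀` to `y₀`, the vertex `v` after `r` steps and its successor
  -- `u` are the two middle ones.
  obtain ⟨v, hv⟩ : ∃ v, v = p^[r] x₀ := ⟨_, rfl⟩
  obtain ⟨u, hu⟩ : ∃ u, u = p v := ⟨_, rfl⟩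
  have h1 : G.dist y₀ v = r + 1 := by rw [hv, hp.depth_iterate, hxy]; omega
  have hvy : v ≠ y₀ := fun e => by rw [e, SimpleGraph.dist_self] at h1; omega
  have h2 := hp.depth_parent v hvy
  have hadj : G.Adj v u := hu ▸ hp.adj_parent hvy
  have huv : G.dist v u = 1 := SimpleGraph.dist_eq_one_iff_adj.2 hadj
  rw [← hu] at h2
  have h3 := hp.dist_iterate_le r x₀ (by omega)
  rw [← hv] at h3
  have h4 := hG.connected.dist_triangle (u := y₀) (v := v) (w := x₀)
  have h5 := hG.connected.dist_triangle (u := y₀) (v := u) (w := x₀)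
  have h6 := hG.connected.dist_triangle (u := u) (v := v) (w := x₀)
  rw [SimpleGraph.dist_comm (u := u) (v := v)] at h6
  obtain ⟨p', hp'⟩ := exists_isRooted hG u
  obtain ⟨hvu, hpv⟩ := hp'.parent_of_adj hadj.symm
  have e1 : G.dist v x₀ = r := by omega
  have e2 : G.dist u x₀ = r + 1 := by omega
  have e3 : G.dist u y₀ = r := by rw [SimpleGraph.dist_comm]; omega
  have e4 : G.dist v y₀ = r + 1 := by rw [SimpleGraph.dist_comm]; omega
  have bx : Below p' v x₀ := by
    by_contra hb
    have := hp'.dist_of_not_below hvu hpv hb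
    omega
  have bY : ¬ Below p' v y₀ := by
    intro hb
    have := hp'.dist_of_below hvu hpv hb
    omega
  refine ⟨u, v, x₀, y₀, hadj.symm, e1, e2, e3, e4, ?_, ?_⟩
  · intro w hw
    have hb : Below p' v w := by
      by_contra hb
      have := hp'.dist_of_not_below hvu hpv hb
      omega
    have a1 := hp'.le_dist_of_separated hpv hb bY
    have a2 := hle w y₀
    omega
  · intro w hw
    have hb : ¬ Below p' v w := by
      intro hb
      have := hp'.dist_of_below hvu hpv hb
      omega
    have a1 := hp'.le_dist_of_separated hpv bx hb
    have a2 := hle x₀ w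
    omega

/-- Used for the charges below one edge: when they have a common sign, the squared flow dominates
the sum of their squares. -/
theorem sum_sq_le_sq_sum_of_mul_nonneg {ι : Type*} [Fintype ι] (a : ι → ℝ)
    (ha : ∀ i j, 0 ≤ a i * a j) : ∑ i, a i ^ 2 ≤ (∑ i, a i) ^ 2 := by
  rw [pow_two (∑ i, a i), Finset.sum_mul_sum]
  refine Finset.sum_le_sum fun i _ => ?_
  rw [pow_two]
  exact Finset.single_le_sum (f := fun j => a i * a j) (fun j _ => ha i j) (Finset.mem_univ i)

theorem mul_eq_zero_of_sq_sum_eq {ι : Type*} [Fintype ι] (a : ι → ℝ)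
    (ha : ∀ i j, 0 ≤ a i * a j) (h : (∑ i, a i) ^ 2 ≤ ∑ i, a i ^ 2) {i j : ι} (hij : i ≠ j) :
    a i * a j = 0 := by
  classical
  by_contra hne
  have hpos : 0 < a i * a j := lt_of_le_of_ne (ha i j) (Ne.symm hne)
  refine absurd h (not_le.2 ?_)
  rw [pow_two (∑ i, a i), Finset.sum_mul_sum]
  refine Finset.sum_lt_sum (fun k _ => ?_) ⟨i, Finset.mem_univ i, ?_⟩
  · rw [pow_two]
    exact Finset.single_le_sum (f := fun j => a k * a j) (fun j _ => ha k j) (Finset.mem_univ k)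
  · have h1 : ∑ k ∈ {i, j}, a i * a k ≤ ∑ k, a i * a k :=
      Finset.sum_le_sum_of_subset_of_nonneg (Finset.subset_univ _) fun k _ _ => ha i k
    rw [Finset.sum_pair hij] at h1
    nlinarith

/-- The Rayleigh quotient of the balanced flow across the central edge. -/
theorem inv_add_inv_le {g A B x R : ℝ} (hA : 0 ≤ A) (hB : 0 ≤ B) (hx : 1 - (R + 1) * x < 0)
    (hx' : 0 < 1 - R * x) (hg : g = 1 / (1 - R * x))
    (hAB : -(1 / (1 - (R + 1) * x) + g) ≤ A + B) :
    1 / (g + A) + 1 / (g + B) ≤ x ∧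
      (x ≤ 1 / (g + A) + 1 / (g + B) →
        A * B = 0 ∧ A + B = -(1 / (1 - (R + 1) * x) + g)) := by
  have hgpos : 0 < g := by rw [hg]; positivity
  have h0 : 1 / (1 - (R + 1) * x) = - (1 / ((R + 1) * x - 1)) := by
    rw [← neg_sub, div_neg]
  rw [h0] at hAB ⊢
  have hc : 0 < (R + 1) * x - 1 := by linarith
  have h1 : 1 / ((R + 1) * x - 1) ≤ g + (A + B) := by linarith
  have h2 : 1 / (g + (A + B)) ≤ (R + 1) * x - 1 := by
    rw [div_le_iff₀ (by positivity)]
    rw [div_le_iff₀ hc] at h1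
    linarith
  have h3 : 1 / g = 1 - R * x := by rw [hg, one_div_one_div]
  -- For a fixed sum `A + B`, the reciprocals add up to the most when `A` or `B` vanishes; the
  -- identity gives the exact gap. The bounds `h2` and `h3` for the extreme case add up to `x`.
  have h4 : 1 / (g + (A + B)) + 1 / g - (1 / (g + A) + 1 / (g + B))
      = (2 * g + A + B) * (A * B) / ((g * (g + (A + B))) * ((g + A) * (g + B))) := by
    field_simp
    ring
  have h5 : 0 ≤ (2 * g + A + B) * (A * B) / ((g * (g + (A + B))) * ((g + A) * (g + B))) := by
    positivity
  refine ⟨by linarith, fun hle => ⟨?_, ?_⟩⟩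
  · by_contra hne
    have hABpos : 0 < A * B := lt_of_le_of_ne (mul_nonneg hA hB) (Ne.symm hne)
    have h6 : 0 < (2 * g + A + B) * (A * B) / ((g * (g + (A + B))) * ((g + A) * (g + B))) := by
      positivity
    linarith
  · have h7 : (R + 1) * x - 1 ≤ 1 / (g + (A + B)) := by linarith
    rw [le_div_iff₀ (by positivity)] at h7
    have h8 : g + (A + B) ≤ 1 / ((R + 1) * x - 1) := by
      rw [le_div_iff₀ hc]
      linarith
    linarith

/-! ### Leaves and their distances to the central edge. -/

section Test

variable {V : Type*} {G : SimpleGraph V} {r : ℕ} {u v x₀ y₀ : V} {p : V → V}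

theorem IsCenterEdge.below_iff (hc : IsCenterEdge G r u v x₀ y₀)
    (h : IsRooted G u p (G.dist u)) (w : V) : Below p v w ↔ G.dist v w < G.dist u w := by
  obtain ⟨hvu, hpv⟩ := h.parent_of_adj hc.adj
  constructor
  · intro hb
    have := h.dist_of_below hvu hpv hb
    omega
  · intro hlt
    by_contra hb
    have := h.dist_of_not_below hvu hpv hb
    omega

theorem IsCenterEdge.not_isLeaf (hc : IsCenterEdge G r u v x₀ y₀) (hr : 1 ≤ r)
    (h : IsRooted G u p (G.dist u)) : ¬ IsLeaf G u ∧ ¬ IsLeaf G v := by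
  obtain ⟨hvu, hpv⟩ := h.parent_of_adj hc.adj
  constructor
  · have hy : y₀ ≠ u := fun e => by
      have := hc.dist_uy
      rw [e, SimpleGraph.dist_self] at this
      omega
    obtain ⟨c, hcu, hpc, hcy⟩ := h.exists_child (h.below_root y₀) hy
    have hcv : c ≠ v := by
      rintro rfl
      have h1 := (hc.below_iff h y₀).1 hcy
      rw [hc.dist_uy, hc.dist_vy] at h1
      omega
    intro hl
    obtain ⟨a, ha⟩ := Set.ncard_eq_one.1 hl
    have h1 : v ∈ G.neighborSet u := hc.adj
    have h2 : c ∈ G.neighborSet u := (h.adj_iff u c).2 (Or.inr ⟨hcu, hpc⟩)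
    rw [ha] at h1 h2
    exact hcv (h2.trans h1.symm)
  · intro hl
    have hxv : x₀ ≠ v := fun e => by
      have := hc.dist_vx
      rw [e, SimpleGraph.dist_self] at this
      omega
    have hb : Below p v x₀ := (hc.below_iff h x₀).2 (by rw [hc.dist_ux, hc.dist_vx]; omega)
    obtain ⟨c, hcu, hpc, -⟩ := h.exists_child hb hxv
    exact (h.isLeaf_iff hvu).1 hl c hcu hpc

/-- A child of `x₀` would lie on the side of `v` at distance `r + 1` from `v`. -/
theorem IsCenterEdge.isLeaf_x (hc : IsCenterEdge G r u v x₀ y₀)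
    (h : IsRooted G u p (G.dist u)) : IsLeaf G x₀ := by
  obtain ⟨hvu, hpv⟩ := h.parent_of_adj hc.adj
  have hb : Below p v x₀ := (hc.below_iff h x₀).2 (by rw [hc.dist_ux, hc.dist_vx]; omega)
  have hx : x₀ ≠ u := by
    rintro rfl
    exact h.not_below_root hvu hb
  rw [h.isLeaf_iff hx]
  rintro c hcu rfl
  have hbc : Below p v c := (IsRooted.eq_or_below_parent p).2 (Or.inr hb)
  have h1 := h.depth_parent c hcu
  have h2 := h.dist_of_below hvu hpv hbc
  have h3 := hc.le_of_v c (by omega)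
  have h4 := hc.dist_ux
  omega

theorem IsCenterEdge.min_dist_bounds (hc : IsCenterEdge G r u v x₀ y₀) (hr : 1 ≤ r)
    (h : IsRooted G u p (G.dist u)) {z : V} (hz : IsLeaf G z) :
    1 ≤ min (G.dist u z) (G.dist v z) ∧ min (G.dist u z) (G.dist v z) ≤ r := by
  obtain ⟨hvu, hpv⟩ := h.parent_of_adj hc.adj
  obtain ⟨hu, hv⟩ := hc.not_isLeaf hr h
  have h1 : z ≠ u := fun e => hu (e ▸ hz)
  have h2 : z ≠ v := fun e => hv (e ▸ hz)
  have h3 := h.connected.pos_dist_of_ne h1.symm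
  have h4 := h.connected.pos_dist_of_ne h2.symm
  refine ⟨by omega, ?_⟩
  by_cases hb : Below p v z
  · have := h.dist_of_below hvu hpv hb
    have := hc.le_of_v z (by omega)
    omega
  · have := h.dist_of_not_below hvu hpv hb
    have := hc.le_of_u z (by omega)
    omega

variable [Fintype V]

open scoped Classical in
/-- The leaves other than the two ends of the diametral path. -/
noncomputable def extraLeaves (G : SimpleGraph V) (x₀ y₀ : V) : Finset V :=
  Finset.univ.filter fun z => IsLeaf G z ∧ z ≠ x₀ ∧ z ≠ y₀

/-- The distances of the extra leaves to the central edge. -/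
noncomputable def extraLengths (G : SimpleGraph V) (u v x₀ y₀ : V) : Multiset ℕ :=
  (extraLeaves G x₀ y₀).val.map fun z => min (G.dist u z) (G.dist v z)

open scoped Classical in
theorem sum_leaves (hx : IsLeaf G x₀) (hy : IsLeaf G y₀) (hxy : x₀ ≠ y₀) (f : V → ℝ) :
    (∑ z, if IsLeaf G z then f z else 0) = f x₀ + (f y₀ + ∑ z ∈ extraLeaves G x₀ y₀, f z) := by
  have h1 : Finset.univ.filter (fun z => IsLeaf G z)
      = insert x₀ (insert y₀ (extraLeaves G x₀ y₀)) := by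
    ext z
    simp only [extraLeaves, Finset.mem_filter, Finset.mem_univ, true_and, Finset.mem_insert]
    by_cases h1 : z = x₀
    · simp [h1, hx]
    · by_cases h2 : z = y₀
      · simp [h2, hy]
      · simp [h1, h2]
  rw [← Finset.sum_filter, h1, Finset.sum_insert, Finset.sum_insert]
  · simp [extraLeaves]
  · simp [extraLeaves, hxy]

open scoped Classical in
theorem IsCenterEdge.sum_ancestors (hc : IsCenterEdge G r u v x₀ y₀)
    (h : IsRooted G u p (G.dist u)) (z : V) :
    (∑ x, if (x ≠ u ∧ x ≠ v) ∧ Below p x z then (1 : ℝ) else 0)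
      = (min (G.dist u z) (G.dist v z) : ℕ) := by
  obtain ⟨hvu, hpv⟩ := h.parent_of_adj hc.adj
  have h1 := h.sum_below_one z
  have h2 : (∑ x, if x ≠ u ∧ Below p x z then (1 : ℝ) else 0)
      = (∑ x, if (x ≠ u ∧ x ≠ v) ∧ Below p x z then (1 : ℝ) else 0)
        + ∑ x, if x = v then (if Below p v z then (1 : ℝ) else 0) else 0 := by
    rw [← Finset.sum_add_distrib]
    refine Finset.sum_congr rfl fun x _ => ?_
    by_cases hxv : x = v
    · subst hxv
      simp [hvu]
    · simp [hxv]
  rw [Finset.sum_ite_eq' Finset.univ v, if_pos (Finset.mem_univ v), h1] at h2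
  by_cases hb : Below p v z
  · have := h.dist_of_below hvu hpv hb
    rw [if_pos hb, this] at h2
    rw [min_eq_right (by omega)]
    push_cast at h2
    linarith
  · have := h.dist_of_not_below hvu hpv hb
    rw [if_neg hb] at h2
    rw [min_eq_left (by omega)]
    linarith

-- Double counting of pairs of a leaf and an ancestor-or-self outside the central edge. A leaf
-- occurs as often as its distance to the edge, and each of the `2r + M` vertices off the edge
-- occurs at least once. The ends `x₀` and `y₀` account for `r` pairs each.
open scoped Classical in
theorem IsCenterEdge.le_sum_extraLengths (hc : IsCenterEdge G r u v x₀ y₀)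
    (h : IsRooted G u p (G.dist u)) (hx : IsLeaf G x₀) (hy : IsLeaf G y₀) {M : ℕ}
    (hM : Fintype.card V = 2 * r + 2 + M) : M ≤ (extraLengths G u v x₀ y₀).sum := by
  have hxy : x₀ ≠ y₀ := by
    rintro rfl
    have h1 := hc.dist_ux
    have h2 := hc.dist_uy
    omega
  have huv : u ≠ v := hc.adj.ne
  have h1 := sum_leaves hx hy hxy (fun z => ((min (G.dist u z) (G.dist v z) : ℕ) : ℝ))
  rw [hc.dist_ux, hc.dist_vx, hc.dist_uy, hc.dist_vy, min_eq_right (by omega : r ≤ r + 1),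
    min_eq_left (by omega : r ≤ r + 1)] at h1
  have h2 : (∑ z, if IsLeaf G z then ((min (G.dist u z) (G.dist v z) : ℕ) : ℝ) else 0)
      = ∑ x, if x ≠ u ∧ x ≠ v then
          ∑ z, if IsLeaf G z ∧ Below p x z then (1 : ℝ) else 0 else 0 := by
    have h3 : ∀ z, (if IsLeaf G z then ((min (G.dist u z) (G.dist v z) : ℕ) : ℝ) else 0)
        = ∑ x, if (x ≠ u ∧ x ≠ v) ∧ IsLeaf G z ∧ Below p x z then (1 : ℝ) else 0 := by
      intro z
      by_cases hz : IsLeaf G z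
      · rw [if_pos hz, ← hc.sum_ancestors h]
        simp [hz]
      · simp [hz]
    simp only [h3]
    rw [Finset.sum_comm]
    refine Finset.sum_congr rfl fun x _ => ?_
    by_cases hxx : x ≠ u ∧ x ≠ v
    · simp only [hxx, true_and, if_true, ne_eq, not_false_eq_true, and_self]
    · simp only [hxx, false_and, if_false, Finset.sum_const_zero]
  have h3 : (∑ x, if x ≠ u ∧ x ≠ v then (1 : ℝ) else 0) ≤ ∑ x, if x ≠ u ∧ x ≠ v then
          ∑ z, if IsLeaf G z ∧ Below p x z then (1 : ℝ) else 0 else 0 := by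
    refine Finset.sum_le_sum fun x _ => ?_
    by_cases hxx : x ≠ u ∧ x ≠ v
    · rw [if_pos hxx, if_pos hxx]
      obtain ⟨z, -, hz, hb⟩ := h.exists_leaf_below hxx.1
      have := Finset.single_le_sum (f := fun z => if IsLeaf G z ∧ Below p x z then (1 : ℝ) else 0)
        (fun z _ => by split_ifs <;> norm_num) (Finset.mem_univ z)
      simpa [hz, hb] using this
    · rw [if_neg hxx, if_neg hxx]
  have h4 : (∑ x, if x ≠ u ∧ x ≠ v then (1 : ℝ) else 0) = Fintype.card V - 2 := by
    have h5 : Finset.univ.filter (fun x => x ≠ u ∧ x ≠ v) = Finset.univ \ {u, v} := by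
      ext x
      simp
    have h6 : ({u, v} : Finset V).card = 2 := Finset.card_pair huv
    have h7 := Finset.card_sdiff_add_card_eq_card (Finset.subset_univ ({u, v} : Finset V))
    rw [← Finset.sum_filter, h5, Finset.sum_const, nsmul_eq_mul, mul_one]
    rw [h6, Finset.card_univ] at h7
    rw [← h7]
    push_cast
    ring
  have h5 : ((extraLengths G u v x₀ y₀).sum : ℝ)
      = ∑ z ∈ extraLeaves G x₀ y₀, ((min (G.dist u z) (G.dist v z) : ℕ) : ℝ) := by
    rw [← Nat.cast_sum]
    rfl
  rw [← h2, h1, h4, hM, ← h5] at h3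
  generalize (extraLengths G u v x₀ y₀).sum = S at h3 ⊢
  push_cast at h3
  have : (M : ℝ) ≤ S := by linarith
  exact_mod_cast this

end Test

/-! ### The test flow across the central edge and its energy. -/

section Test

variable {V : Type*} [Fintype V] {G : SimpleGraph V} {r : ℕ} {u v x₀ y₀ : V} {p : V → V} {x : ℝ}

open scoped Classical in
/-- The total response of the leaves on the side of `u`. -/
noncomputable def sideResponse (G : SimpleGraph V) (x : ℝ) (u v : V) : ℝ :=
  ∑ z, if IsLeaf G z then
    (if G.dist u z < G.dist v z then legResponse x (G.dist u z) else 0) else 0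

open scoped Classical in
/-- The balanced flow across the central edge. -/
noncomputable def centralFlow (G : SimpleGraph V) (x : ℝ) (u v : V) (z : V) : ℝ :=
  if IsLeaf G z then
    (if G.dist u z < G.dist v z then legResponse x (G.dist u z) / sideResponse G x u v else 0)
    - (if G.dist v z < G.dist u z then legResponse x (G.dist v z) / sideResponse G x v u else 0)
  else 0

open scoped Classical in
theorem IsCenterEdge.sideResponse_eq (hc : IsCenterEdge G r u v x₀ y₀)
    (hx₀ : IsLeaf G x₀) (hy₀ : IsLeaf G y₀) (x : ℝ) :
    sideResponse G x u v = legResponse x r + ∑ z ∈ extraLeaves G x₀ y₀,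
      if G.dist u z < G.dist v z then legResponse x (G.dist u z) else 0 := by
  have hxy : x₀ ≠ y₀ := by
    rintro rfl
    have h1 := hc.dist_ux
    have h2 := hc.dist_uy
    omega
  unfold sideResponse
  rw [sum_leaves hx₀ hy₀ hxy, hc.dist_ux, hc.dist_vx, hc.dist_uy, hc.dist_vy,
    if_neg (by omega), if_pos (by omega), zero_add]

open scoped Classical in
theorem IsCenterEdge.sideResponse_pos (hc : IsCenterEdge G r u v x₀ y₀) (hr : 1 ≤ r)
    (hx : x ∈ rootInterval r) (hx₀ : IsLeaf G x₀) (hy₀ : IsLeaf G y₀) :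
    0 < sideResponse G x u v := by
  rw [hc.sideResponse_eq hx₀ hy₀]
  refine add_pos_of_pos_of_nonneg (legResponse_pos hr hx le_rfl) (Finset.sum_nonneg fun z _ => ?_)
  split_ifs with h
  · exact (legResponse_pos hr hx (hc.le_of_u z h)).le
  · exact le_rfl

theorem centralFlow_sum {a b : ℝ} (ha : sideResponse G x u v = a) (hb : sideResponse G x v u = b)
    (ha0 : a ≠ 0) (hb0 : b ≠ 0) : ∑ z, centralFlow G x u v z = 0 := by
  classical
  have h1 : ∀ z, centralFlow G x u v z
      = (if IsLeaf G z then
          (if G.dist u z < G.dist v z then legResponse x (G.dist u z) else 0) else 0) / a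
        - (if IsLeaf G z then
          (if G.dist v z < G.dist u z then legResponse x (G.dist v z) else 0) else 0) / b := by
    intro z
    unfold centralFlow
    rw [ha, hb]
    split_ifs <;> simp
  simp only [h1, Finset.sum_sub_distrib, ← Finset.sum_div]
  have h2 : (∑ z, if IsLeaf G z then
      (if G.dist u z < G.dist v z then legResponse x (G.dist u z) else 0) else 0) = a := by
    rw [← ha]; rfl
  have h3 : (∑ z, if IsLeaf G z then
      (if G.dist v z < G.dist u z then legResponse x (G.dist v z) else 0) else 0) = b := by
    rw [← hb]; rfl
  rw [h2, h3, div_self ha0, div_self hb0, sub_self]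

-- The central edge carries one unit; this produces the summand `1` in the energy.
open scoped Classical in
theorem IsCenterEdge.centralFlow_below (hc : IsCenterEdge G r u v x₀ y₀)
    (h : IsRooted G u p (G.dist u)) (hb0 : sideResponse G x v u ≠ 0) :
    (∑ z, if Below p v z then centralFlow G x u v z else 0) = -1 := by
  have h1 : ∀ z, (if Below p v z then centralFlow G x u v z else 0)
      = - ((if IsLeaf G z then
          (if G.dist v z < G.dist u z then legResponse x (G.dist v z) else 0) else 0)
            / sideResponse G x v u) := by
    intro z
    rw [hc.below_iff h]
    unfold centralFlow
    by_cases h2 : G.dist v z < G.dist u z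
    · have h3 : ¬ G.dist u z < G.dist v z := by omega
      simp only [h2, h3, if_true, if_false]
      split_ifs <;> simp
    · simp [h2]
  simp only [h1, Finset.sum_neg_distrib, ← Finset.sum_div]
  rw [neg_inj]
  exact div_self hb0

/-- The weighted norm of the central flow. -/
theorem IsCenterEdge.centralFlow_norm (hc : IsCenterEdge G r u v x₀ y₀) (hr : 1 ≤ r)
    (hx : x ∈ rootInterval r)
    (ha0 : sideResponse G x u v ≠ 0) (hb0 : sideResponse G x v u ≠ 0) :
    ∑ z, centralFlow G x u v z ^ 2 * (1 - (min (G.dist u z) (G.dist v z) : ℕ) * x)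
      = 1 / sideResponse G x u v + 1 / sideResponse G x v u := by
  classical
  obtain ⟨a, ha⟩ : ∃ a, sideResponse G x u v = a := ⟨_, rfl⟩
  obtain ⟨b, hb⟩ : ∃ b, sideResponse G x v u = b := ⟨_, rfl⟩
  -- The weight `1 - ℓ x` is the inverse of the response, so it cancels one of the two factors in
  -- the squared charge.
  have h1 : ∀ z, centralFlow G x u v z ^ 2 * (1 - (min (G.dist u z) (G.dist v z) : ℕ) * x)
      = (if IsLeaf G z then
          (if G.dist u z < G.dist v z then legResponse x (G.dist u z) else 0) else 0) / a ^ 2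
        + (if IsLeaf G z then
          (if G.dist v z < G.dist u z then legResponse x (G.dist v z) else 0) else 0) / b ^ 2 := by
    intro z
    unfold centralFlow
    rw [ha, hb]
    by_cases hz : IsLeaf G z
    · simp only [if_pos hz]
      rcases lt_trichotomy (G.dist u z) (G.dist v z) with h2 | h2 | h2
      · rw [if_pos h2, if_neg (by omega), if_pos h2, if_neg (by omega), min_eq_left h2.le]
        have := one_sub_pos_of_mem hr hx (hc.le_of_u z h2)
        unfold legResponse
        field_simp
        ring
      · rw [if_neg (by omega), if_neg (by omega), if_neg (by omega), if_neg (by omega)]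
        simp
      · rw [if_pos h2, if_neg (by omega), if_pos h2, if_neg (by omega), min_eq_right h2.le]
        have := one_sub_pos_of_mem hr hx (hc.le_of_v z h2)
        unfold legResponse
        field_simp
        ring
    · simp [hz]
  simp only [h1, Finset.sum_add_distrib, ← Finset.sum_div]
  have h2 : (∑ z, if IsLeaf G z then
      (if G.dist u z < G.dist v z then legResponse x (G.dist u z) else 0) else 0) = a := by
    rw [← ha]; rfl
  have h3 : (∑ z, if IsLeaf G z then
      (if G.dist v z < G.dist u z then legResponse x (G.dist v z) else 0) else 0) = b := by
    rw [← hb]; rfl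
  rw [h2, h3, ha, hb]
  rw [ha] at ha0
  rw [hb] at hb0
  field_simp

-- All leaves below a vertex other than `u` lie on the same side of the central edge, so their
-- charges have the same sign. That these charges do not vanish is what rules out branching in the
-- case of equality.
open scoped Classical in
theorem IsCenterEdge.centralFlow_mul_nonneg (hc : IsCenterEdge G r u v x₀ y₀) (hr : 1 ≤ r)
    (hx : x ∈ rootInterval r) (h : IsRooted G u p (G.dist u))
    (ha0 : 0 < sideResponse G x u v) (hb0 : 0 < sideResponse G x v u) {y : V}
    (hyu : y ≠ u) (i j : V) :
    0 ≤ (if Below p y i then centralFlow G x u v i else 0)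
        * (if Below p y j then centralFlow G x u v j else 0) ∧
      (IsLeaf G i → IsLeaf G j → Below p y i → Below p y j →
        (if Below p y i then centralFlow G x u v i else 0)
        * (if Below p y j then centralFlow G x u v j else 0) ≠ 0) := by
  obtain ⟨hvu, hpv⟩ := h.parent_of_adj hc.adj
  by_cases hi : Below p y i ∧ IsLeaf G i
  · by_cases hj : Below p y j ∧ IsLeaf G j
    · rw [if_pos hi.1, if_pos hj.1]
      have hside : ∀ z, Below p y z → (Below p v z ↔ Below p v y) := by
        intro z hz
        constructor
        · intro hvz
          refine h.below_of_le hvz hz ?_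
          have h1 := h.depth_parent v hvu
          rw [hpv, h.depth_root] at h1
          have h2 : G.dist u y ≠ 0 := fun e => hyu (h.depth_eq_zero.1 e)
          omega
        · intro hvy
          exact IsRooted.Below.trans hvy hz
      suffices hpos : 0 < centralFlow G x u v i * centralFlow G x u v j from
        ⟨hpos.le, fun _ _ _ _ => hpos.ne'⟩
      by_cases hvy : Below p v y
      · have neg : ∀ z, Below p y z → IsLeaf G z → centralFlow G x u v z < 0 := by
          intro z hz hl
          have h1 := (hc.below_iff h z).1 ((hside z hz).2 hvy)
          unfold centralFlow
          rw [if_pos hl, if_neg (by omega), if_pos h1, zero_sub]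
          exact neg_neg_of_pos (div_pos (legResponse_pos hr hx (hc.le_of_v z h1)) hb0)
        exact mul_pos_of_neg_of_neg (neg i hi.1 hi.2) (neg j hj.1 hj.2)
      · have pos : ∀ z, Below p y z → IsLeaf G z → 0 < centralFlow G x u v z := by
          intro z hz hl
          have hb : ¬ Below p v z := fun e => hvy ((hside z hz).1 e)
          have h1 := h.dist_of_not_below hvu hpv hb
          unfold centralFlow
          rw [if_pos hl, if_pos (by omega), if_neg (by omega), sub_zero]
          exact div_pos (legResponse_pos hr hx (hc.le_of_u z (by omega))) ha0
        exact mul_pos (pos i hi.1 hi.2) (pos j hj.1 hj.2)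
    · have h0 : (if Below p y j then centralFlow G x u v j else 0) = 0 := by
        by_cases hb : Below p y j
        · have hl : ¬ IsLeaf G j := fun e => hj ⟨hb, e⟩
          simp [centralFlow, hl]
        · simp [hb]
      rw [h0, mul_zero]
      exact ⟨le_rfl, fun _ a _ b => absurd ⟨b, a⟩ hj⟩
  · have h0 : (if Below p y i then centralFlow G x u v i else 0) = 0 := by
      by_cases hb : Below p y i
      · have hl : ¬ IsLeaf G i := fun e => hi ⟨hb, e⟩
        simp [centralFlow, hl]
      · simp [hb]
    rw [h0, zero_mul]
    exact ⟨le_rfl, fun a _ b _ => absurd ⟨b, a⟩ hi⟩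

/-- The bound for `lambda2` by the central flow, with the equality case. -/
theorem IsCenterEdge.lambda2_le (hc : IsCenterEdge G r u v x₀ y₀) (hr : 1 ≤ r)
    (hx : x ∈ rootInterval r) (h : IsRooted G u p (G.dist u)) (hx₀ : IsLeaf G x₀)
    (hy₀ : IsLeaf G y₀)
    (hopt : -(legResponse x (r + 1) + legResponse x r)
      ≤ ((extraLengths G u v x₀ y₀).map (legResponse x)).sum) :
    lambda2 G ≤ x ∧ (x ≤ lambda2 G →
      (∀ y, y ≠ u → y ≠ v → ∀ z z', IsLeaf G z → IsLeaf G z' → Below p y z → Below p y z' →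
        z = z') ∧
      ((extraLengths G u v x₀ y₀).map (legResponse x)).sum
        = -(legResponse x (r + 1) + legResponse x r) ∧
      ((∀ z ∈ extraLeaves G x₀ y₀, G.dist u z < G.dist v z) ∨
        ∀ z ∈ extraLeaves G x₀ y₀, G.dist v z < G.dist u z)) := by
  classical
  obtain ⟨hvu, hpv⟩ := h.parent_of_adj hc.adj
  have hcases : ∀ z, G.dist u z < G.dist v z ∨ G.dist v z < G.dist u z := by
    intro z
    by_cases hb : Below p v z
    · exact Or.inr ((hc.below_iff h z).1 hb)
    · have := h.dist_of_not_below hvu hpv hb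
      exact Or.inl (by omega)
  have ha := hc.sideResponse_eq hx₀ hy₀ x
  have hb := hc.symm.sideResponse_eq hy₀ hx₀ x
  have ha0 := hc.sideResponse_pos hr hx hx₀ hy₀
  have hb0 := hc.symm.sideResponse_pos hr hx hy₀ hx₀
  have hcomm : extraLeaves G y₀ x₀ = extraLeaves G x₀ y₀ := by
    ext z
    simp only [extraLeaves, Finset.mem_filter, Finset.mem_univ, true_and]
    tauto
  rw [hcomm] at hb
  obtain ⟨A, hA⟩ : ∃ A, A = ∑ z ∈ extraLeaves G x₀ y₀,
      if G.dist u z < G.dist v z then legResponse x (G.dist u z) else 0 := ⟨_, rfl⟩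
  obtain ⟨B, hB⟩ : ∃ B, B = ∑ z ∈ extraLeaves G x₀ y₀,
      if G.dist v z < G.dist u z then legResponse x (G.dist v z) else 0 := ⟨_, rfl⟩
  have hAterm : ∀ z, 0 ≤ if G.dist u z < G.dist v z then legResponse x (G.dist u z) else 0 := by
    intro z
    split_ifs with hz
    · exact (legResponse_pos hr hx (hc.le_of_u z hz)).le
    · exact le_rfl
  have hBterm : ∀ z, 0 ≤ if G.dist v z < G.dist u z then legResponse x (G.dist v z) else 0 := by
    intro z
    split_ifs with hz
    · exact (legResponse_pos hr hx (hc.le_of_v z hz)).le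
    · exact le_rfl
  have hA0 : 0 ≤ A := hA ▸ Finset.sum_nonneg fun z _ => hAterm z
  have hB0 : 0 ≤ B := hB ▸ Finset.sum_nonneg fun z _ => hBterm z
  have hAB : ((extraLengths G u v x₀ y₀).map (legResponse x)).sum = A + B := by
    rw [hA, hB, ← Finset.sum_add_distrib, extraLengths, Multiset.map_map]
    refine Finset.sum_congr rfl fun z _ => ?_
    rcases hcases z with hz | hz
    · rw [if_pos hz, if_neg (by omega), add_zero, Function.comp, min_eq_left hz.le]
    · rw [if_pos hz, if_neg (by omega), zero_add, Function.comp, min_eq_right hz.le]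
  rw [← hA] at ha
  rw [← hB] at hb
  rw [hAB] at hopt ⊢
  have hnum := inv_add_inv_le (R := (r : ℝ)) (g := legResponse x r) hA0 hB0 (one_sub_succ_neg hx)
    (one_sub_pos_of_mem hr hx le_rfl) rfl (by
      have : legResponse x (r + 1) = 1 / (1 - ((r : ℝ) + 1) * x) := by
        unfold legResponse
        push_cast
        rfl
      rw [← this]
      exact hopt)
  have hsucc : 1 / (1 - ((r : ℝ) + 1) * x) = legResponse x (r + 1) := by
    unfold legResponse
    push_cast
    rfl
  rw [← ha, ← hb, hsucc] at hnum
  -- energies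
  obtain ⟨q, hq⟩ : ∃ q, q = centralFlow G x u v := ⟨_, rfl⟩
  have hflow := h.lambda2_mul_le (hc.not_isLeaf hr h).1 q
    (by
      intro z hz
      rw [hq]
      simp [centralFlow, hz])
    (by rw [hq]; exact centralFlow_sum rfl rfl ha0.ne' hb0.ne')
  have hnorm := hc.centralFlow_norm hr hx ha0.ne' hb0.ne'
  have hbelow := hc.centralFlow_below (x := x) h hb0.ne'
  have hmul := fun y hyu i j => hc.centralFlow_mul_nonneg hr hx h ha0 hb0 (y := y) hyu i j
  rw [← hq] at hnorm hbelow hmul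
  obtain ⟨θ, hθ⟩ : ∃ θ : V → ℝ, ∀ y, θ y = ∑ z, if Below p y z then q z else 0 :=
    ⟨_, fun _ => rfl⟩
  obtain ⟨ν, hν⟩ : ∃ ν : V → ℝ, ∀ y, ν y = ∑ z, (if Below p y z then q z else 0) ^ 2 :=
    ⟨_, fun _ => rfl⟩
  simp only [← hθ] at hflow hbelow
  have hsplit : (∑ y, if y ≠ u then θ y ^ 2 else 0)
      = 1 + ∑ y, if y ≠ u ∧ y ≠ v then θ y ^ 2 else 0 := by
    have h1 : (1 : ℝ) = ∑ y, if y = v then θ y ^ 2 else 0 := by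
      rw [Finset.sum_ite_eq' Finset.univ v, if_pos (Finset.mem_univ v), hbelow]
      norm_num
    rw [h1, ← Finset.sum_add_distrib]
    refine Finset.sum_congr rfl fun y _ => ?_
    by_cases hyv : y = v
    · subst hyv
      simp [hvu]
    · simp [hyv]
  have hle : ∀ y, (if y ≠ u ∧ y ≠ v then ν y else 0) ≤ if y ≠ u ∧ y ≠ v then θ y ^ 2 else 0 := by
    intro y
    split_ifs with hy
    · rw [hν, hθ]
      exact sum_sq_le_sq_sum_of_mul_nonneg _ fun i j => (hmul y hy.1 i j).1
    · exact le_rfl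
  -- Without cross terms, the square of the charge of `z` is counted once for each edge on its way
  -- to the central edge.
  have hνsum : (∑ y, if y ≠ u ∧ y ≠ v then ν y else 0)
      = ∑ z, q z ^ 2 * (min (G.dist u z) (G.dist v z) : ℕ) := by
    have h1 : ∀ z, q z ^ 2 * ((min (G.dist u z) (G.dist v z) : ℕ) : ℝ)
        = ∑ y, if (y ≠ u ∧ y ≠ v) ∧ Below p y z then q z ^ 2 else 0 := by
      intro z
      rw [← hc.sum_ancestors h, Finset.mul_sum]
      exact Finset.sum_congr rfl fun y _ => by split_ifs <;> simp
    simp only [h1]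
    rw [Finset.sum_comm]
    refine Finset.sum_congr rfl fun y _ => ?_
    by_cases hy : y ≠ u ∧ y ≠ v
    · rw [if_pos hy, hν]
      exact Finset.sum_congr rfl fun z _ => by simp [hy]
    · simp [hy]
  have hsumle := Finset.sum_le_sum fun y (_ : y ∈ Finset.univ) => hle y
  have hnorm' : ∑ z, q z ^ 2 - x * ∑ z, q z ^ 2 * (min (G.dist u z) (G.dist v z) : ℕ)
      = 1 / sideResponse G x u v + 1 / sideResponse G x v u := by
    rw [← hnorm, Finset.mul_sum, ← Finset.sum_sub_distrib]
    exact Finset.sum_congr rfl fun z _ => by ring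
  rw [← hνsum] at hnorm'
  rw [hsplit] at hflow
  have hxpos := pos_of_mem hx
  obtain ⟨E, hE⟩ : ∃ E, E = ∑ y, if y ≠ u ∧ y ≠ v then θ y ^ 2 else 0 := ⟨_, rfl⟩
  obtain ⟨N, hN⟩ : ∃ N, N = ∑ y, if y ≠ u ∧ y ≠ v then ν y else 0 := ⟨_, rfl⟩
  rw [← hE] at hflow hsumle
  rw [← hN] at hsumle hnorm'
  have hE0 : 0 ≤ E := hE ▸ Finset.sum_nonneg fun y _ => by split_ifs <;> positivity
  have hmulle : x * N ≤ x * E := mul_le_mul_of_nonneg_left hsumle hxpos.le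
  -- With `a`, `b` the side responses, `lambda2 * (1 + E) ≤ ∑ q² = 1/a + 1/b + x N ≤ x + x E`. If `x
  -- ≤ lambda2`, every inequality is an equality: then `E = N`, so no cross terms occur, and `1/a +
  -- 1/b = x`.
  refine ⟨?_, fun hge => ?_⟩
  · by_contra hlt
    push Not at hlt
    have : x * (1 + E) < lambda2 G * (1 + E) := mul_lt_mul_of_pos_right hlt (by linarith)
    linarith [hnum.1]
  · have h1 : x * (1 + E) ≤ lambda2 G * (1 + E) := mul_le_mul_of_nonneg_right hge (by linarith)
    have h2 := hnum.2 (by linarith)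
    have h3 : E ≤ N := le_of_mul_le_mul_left (by linarith [hnum.1]) hxpos
    refine ⟨?_, h2.2, ?_⟩
    · intro y hyu hyv z z' hz hz' hbz hbz'
      by_contra hne
      have h4 : θ y ^ 2 ≤ ν y := by
        have h5 : E = N := le_antisymm h3 hsumle
        rw [hE, hN] at h5
        have h6 := (Finset.sum_eq_sum_iff_of_le fun y _ => hle y).1 h5.symm y (Finset.mem_univ y)
        rw [if_pos ⟨hyu, hyv⟩, if_pos ⟨hyu, hyv⟩] at h6
        exact h6.ge
      rw [hθ, hν] at h4
      exact (hmul y hyu z z').2 hz hz' hbz hbz'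
        (mul_eq_zero_of_sq_sum_eq _ (fun i j => (hmul y hyu i j).1) h4 hne)
    · rcases mul_eq_zero.1 h2.1 with h4 | h4
      · right
        intro z hz
        rw [hA] at h4
        have h5 := (Finset.sum_eq_zero_iff_of_nonneg fun z _ => hAterm z).1 h4 z hz
        refine (hcases z).resolve_left fun h6 => ?_
        rw [if_pos h6] at h5
        exact (legResponse_pos hr hx (hc.le_of_u z h6)).ne' h5
      · left
        intro z hz
        rw [hB] at h4
        have h5 := (Finset.sum_eq_zero_iff_of_nonneg fun z _ => hBterm z).1 h4 z hz
        refine (hcases z).resolve_right fun h6 => ?_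
        rw [if_pos h6] at h5
        exact (legResponse_pos hr hx (hc.le_of_v z h6)).ne' h5

end Test

/-! ### Invariance under isomorphism. -/

section Iso

variable {V W : Type*} {G : SimpleGraph V} {H : SimpleGraph W}

theorem isLeaf_iso (e : G ≃g H) (v : V) : IsLeaf H (e v) ↔ IsLeaf G v := by
  unfold IsLeaf
  rw [← Nat.card_coe_set_eq, ← Nat.card_coe_set_eq, Nat.card_congr (e.mapNeighborSet v)]

theorem laplacian_iso [Fintype V] [Fintype W] (e : G ≃g H) (f : W → ℝ) (v : V) :
    laplacian H f (e v) = laplacian G (f ∘ e) v := by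
  unfold laplacian
  rw [← Equiv.sum_comp e.toEquiv]
  refine Finset.sum_congr rfl fun w _ => ?_
  have h : H.Adj (e v) (e w) ↔ G.Adj v w := e.map_adj_iff
  by_cases hw : G.Adj v w
  · exact (if_pos (h.2 hw)).trans (if_pos hw).symm
  · exact (if_neg (mt h.1 hw)).trans (if_neg hw).symm

theorem IsSteklovEigenvalue.of_iso [Fintype V] [Fintype W] (e : G ≃g H) {μ : ℝ}
    (h : IsSteklovEigenvalue H μ) : IsSteklovEigenvalue G μ := by
  obtain ⟨h0, f, hf, hlap, hbd⟩ := h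
  refine ⟨h0, f ∘ e, ?_, ?_, ?_⟩
  · intro hz
    apply hf
    ext w
    have := congrFun hz (e.symm w)
    simpa using this
  · intro v hv
    rw [← laplacian_iso]
    exact hlap _ (by rwa [isLeaf_iso])
  · intro ω ω' hω hadj
    exact hbd _ _ ((isLeaf_iso e ω).2 hω) (e.map_adj_iff.2 hadj)

theorem lambda2_iso [Fintype V] [Fintype W] (e : G ≃g H) : lambda2 G = lambda2 H := by
  unfold lambda2
  congr 1
  ext μ
  exact and_congr_right fun _ => ⟨fun h => h.of_iso e.symm, fun h => h.of_iso e⟩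

theorem dist_map_le (hG : G.Connected) (e : G ≃g H) (a b : V) : H.dist (e a) (e b) ≤ G.dist a b := by
  obtain ⟨w, hw⟩ := hG.exists_walk_length_eq_dist a b
  rw [← hw, ← SimpleGraph.Walk.length_map e.toHom w]
  exact SimpleGraph.dist_le _

theorem diam_le_of_iso [Finite V] [Finite W] (hG : G.Connected) (hH : H.Connected) (e : G ≃g H) :
    H.diam ≤ G.diam := by
  have := hH.nonempty
  have := hG.nonempty
  obtain ⟨a, b, hab⟩ := H.exists_dist_eq_diam
  have h1 := dist_map_le hG e (e.symm a) (e.symm b)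
  have h2 : G.dist (e.symm a) (e.symm b) ≤ G.diam :=
    SimpleGraph.dist_le_diam (SimpleGraph.connected_iff_ediam_ne_top.1 hG)
  simp only [RelIso.apply_symm_apply] at h1
  omega

theorem IsAdmissible.of_iso [Fintype V] [Fintype W] {n D : ℕ} (e : G ≃g H)
    (h : IsAdmissible n D G) : IsAdmissible n D H := by
  obtain ⟨h1, h2, h3⟩ := h
  have h4 : H.IsTree := e.isTree_iff.1 h1
  refine ⟨h4, ?_, ?_⟩
  · rw [← h2, Fintype.card_congr e.toEquiv]
  · rw [← h3]
    exact le_antisymm (diam_le_of_iso h1.connected h4.connected e)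
      (diam_le_of_iso h4.connected h1.connected e.symm)

theorem IsExtremizer.of_iso [Fintype V] [Fintype W] {n D : ℕ} (e : G ≃g H)
    (h : IsExtremizer n D G) : IsExtremizer n D H :=
  ⟨h.1.of_iso e, fun K hK => lambda2_iso e ▸ h.2 K hK⟩

theorem IsUniqueExtremizer.of_iso [Fintype V] [Fintype W] {n D : ℕ} (e : G ≃g H)
    (h : IsUniqueExtremizer n D G) : IsUniqueExtremizer n D H :=
  ⟨h.1.of_iso e, fun K hK => (h.2 K hK).map fun e' => e'.trans e⟩

/-- An extremizer on `Fin n` is not beaten by any admissible tree. -/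
theorem IsExtremizer.lambda2_le [Fintype V] [Fintype W] {n D : ℕ} (h : IsExtremizer n D G)
    (hH : IsAdmissible n D H) : lambda2 H ≤ lambda2 G := by
  let e : W ≃ Fin n := Fintype.equivFinOfCardEq hH.2.1
  let i : H ≃g H.map e.toEmbedding := SimpleGraph.Iso.map e H
  rw [lambda2_iso i]
  exact h.2 _ (hH.of_iso i)

/-- A parent preserving bijection of rooted trees is an isomorphism. -/
theorem IsRooted.nonempty_iso {o : V} {p : V → V} {d : V → ℕ} {o' : W} {p' : W → W} {d' : W → ℕ}
    (h : IsRooted G o p d) (h' : IsRooted H o' p' d') (e : V ≃ W) (ho : e o = o')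
    (hp : ∀ x, x ≠ o → e (p x) = p' (e x)) : Nonempty (G ≃g H) := by
  refine ⟨⟨e, ?_⟩⟩
  intro x y
  rw [h.adj_iff, h'.adj_iff, ← ho, e.injective.ne_iff, e.injective.ne_iff]
  refine or_congr (and_congr_right fun hx => ?_) (and_congr_right fun hy => ?_)
  · rw [← hp x hx, e.injective.eq_iff]
  · rw [← hp y hy, e.injective.eq_iff]

end Iso

/-! ### Spiders as rooted trees and their recognition. -/

section Spider

variable {ι : Type*} {ℓ : ι → ℕ}

/-- The parent function of a spider rooted at its centre. -/
def spiderParent (ℓ : ι → ℕ) : Option (Σ i, Fin (ℓ i)) → Option (Σ i, Fin (ℓ i))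
  | none => none
  | some ⟨i, ⟨0, _⟩⟩ => none
  | some ⟨i, ⟨j + 1, hj⟩⟩ => some ⟨i, ⟨j, by omega⟩⟩

/-- The depth function of a spider rooted at its centre. -/
def spiderDepth (ℓ : ι → ℕ) : Option (Σ i, Fin (ℓ i)) → ℕ
  | none => 0
  | some v => v.2 + 1

theorem spider_isRooted (ℓ : ι → ℕ) :
    IsRooted (spider ℓ) none (spiderParent ℓ) (spiderDepth ℓ) where
  adj_iff := by
    have key : ∀ i j, ∀ x : Option (Σ i, Fin (ℓ i)),
        spiderParent ℓ (some ⟨i, j⟩) = x ↔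
          (match x, some (⟨i, j⟩ : Σ i, Fin (ℓ i)) with
            | none, some v => (v.2 : ℕ) = 0
            | some v, some w => v.1 = w.1 ∧ (v.2 : ℕ) + 1 = (w.2 : ℕ)
            | _, none => False) := by
      rintro i ⟨j, hj⟩ (_ | ⟨i', j', hj'⟩) <;> cases j
      · simp [spiderParent]
      · simp [spiderParent]
      · simp [spiderParent]
      · simp only [spiderParent, Option.some.injEq, Sigma.mk.injEq, Nat.add_right_cancel_iff]
        constructor
        · rintro ⟨rfl, h⟩
          rw [heq_eq_eq, Fin.mk.injEq] at h
          exact ⟨rfl, h.symm⟩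
        · rintro ⟨rfl, rfl⟩
          exact ⟨rfl, HEq.rfl⟩
    have hne : ∀ x : Option (Σ i, Fin (ℓ i)), x ≠ none → spiderParent ℓ x ≠ x := by
      rintro (_ | ⟨i, _ | j, hj⟩) hx
      · exact absurd rfl hx
      · simp [spiderParent]
      · simp [spiderParent]
    intro x y
    rw [spider, SimpleGraph.fromRel_adj]
    constructor
    · rintro ⟨hxy, h | h⟩
      · rcases y with _ | ⟨i, j⟩
        · exact absurd h (by simp)
        · exact Or.inr ⟨by simp, (key i j x).2 h⟩
      · rcases x with _ | ⟨i, j⟩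
        · exact absurd h (by simp)
        · exact Or.inl ⟨by simp, (key i j y).2 h⟩
    · rintro (⟨hx, rfl⟩ | ⟨hy, rfl⟩)
      · refine ⟨(hne x hx).symm, Or.inr ?_⟩
        rcases x with _ | ⟨i, j⟩
        · exact absurd rfl hx
        · exact (key i j _).1 rfl
      · refine ⟨hne y hy, Or.inl ?_⟩
        rcases y with _ | ⟨i, j⟩
        · exact absurd rfl hy
        · exact (key i j _).1 rfl
  parent_root := rfl
  depth_root := rfl
  depth_parent := by
    rintro (_ | ⟨i, _ | j, hj⟩) hx
    · exact absurd rfl hx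
    · rfl
    · rfl

theorem exists_equiv_of_map_eq {ι κ α : Type*} [Fintype ι] [Fintype κ] {f : ι → α} {g : κ → α}
    (h : Finset.univ.val.map f = Finset.univ.val.map g) : ∃ e : ι ≃ κ, ∀ i, g (e i) = f i := by
  classical
  have hc : ∀ c, Fintype.card {i // f i = c} = Fintype.card {j // g j = c} := by
    intro c
    have := congrArg (Multiset.count c) h
    rw [Multiset.count_map, Multiset.count_map] at this
    rw [Fintype.card_subtype, Fintype.card_subtype]
    simpa [Finset.card, eq_comm] using this
  exact ⟨Equiv.ofFiberEquiv fun c => Fintype.equivOfCardEq (hc c), Equiv.ofFiberEquiv_map _⟩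

theorem spider_iso_of_map_eq {κ : Type*} [Fintype ι] [Fintype κ] {ℓ' : κ → ℕ}
    (h : Finset.univ.val.map ℓ = Finset.univ.val.map ℓ') :
    Nonempty (spider ℓ ≃g spider ℓ') := by
  obtain ⟨e, he⟩ := exists_equiv_of_map_eq h
  let E : (Σ i, Fin (ℓ i)) ≃ Σ k, Fin (ℓ' k) :=
    Equiv.sigmaCongr e fun i => finCongr (he i).symm
  refine (spider_isRooted ℓ).nonempty_iso (spider_isRooted ℓ') (Equiv.optionCongr E) rfl ?_
  rintro (_ | ⟨i, _ | j, hj⟩) hx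
  · exact absurd rfl hx
  · rfl
  · rfl

/-- A rooted tree in which every vertex other than the root lies on a unique path to a leaf is a
spider. -/
theorem IsRooted.nonempty_iso_spider {V : Type*} [Finite V] {G : SimpleGraph V} {o : V}
    {p : V → V} {d : V → ℕ} (h : IsRooted G o p d)
    (hu : ∀ y, y ≠ o → ∀ z z', IsLeaf G z → IsLeaf G z' → Below p y z → Below p y z' → z = z') :
    Nonempty (G ≃g spider fun z : {z // IsLeaf G z} => d z) := by
  -- The pair `(z, j)` goes to the vertex of depth `j + 1` on the path from the root to the leaf
  -- `z`. A root that is itself a leaf has depth `0` and contributes an empty branch.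
  let φ : Option (Σ z : {z // IsLeaf G z}, Fin (d z)) → V :=
    fun a => a.elim o fun w => p^[d w.1 - 1 - w.2] w.1
  have hd : ∀ a, d (φ a) = spiderDepth (fun z : {z // IsLeaf G z} => d z) a := by
    rintro (_ | ⟨z, j, hj⟩)
    · exact h.depth_root
    · simp only [φ, spiderDepth, Option.elim_some, h.depth_iterate]
      omega
  have hφo : ∀ a, a ≠ none → φ a ≠ o := by
    rintro (_ | ⟨z, j, hj⟩) ha hao
    · exact ha rfl
    · have := hd (some ⟨z, j, hj⟩)
      rw [hao, h.depth_root] at this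
      simp [spiderDepth] at this
  have hbij : Function.Bijective φ := by
    constructor
    · rintro (_ | ⟨z, j, hj⟩) (_ | ⟨z', j', hj'⟩) hab
      · rfl
      · exact absurd hab.symm (hφo (some ⟨z', j', hj'⟩) (by simp))
      · exact absurd hab (hφo (some ⟨z, j, hj⟩) (by simp))
      · have h1 := (hd (some ⟨z, j, hj⟩)).symm.trans ((congrArg d hab).trans (hd _))
        simp only [spiderDepth] at h1
        have hz : z = z' := Subtype.ext
          (hu (φ (some ⟨z, j, hj⟩)) (hφo _ (by simp)) z z' z.2 z'.2 ⟨_, rfl⟩ (hab ▸ ⟨_, rfl⟩))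
        subst hz
        have hj : j = j' := by omega
        subst hj
        rfl
    · intro y
      by_cases hy : y = o
      · exact ⟨none, hy.symm⟩
      · obtain ⟨z, hzo, hz, hb⟩ := h.exists_leaf_below hy
        obtain ⟨hle, hit⟩ := h.below_iff_iterate.1 hb
        have hy0 : d y ≠ 0 := fun e => hy (h.depth_eq_zero.1 e)
        refine ⟨some ⟨⟨z, hz⟩, ⟨d y - 1, by simp only; omega⟩⟩, ?_⟩
        simp only [φ, Option.elim_some]
        rw [← hit]
        congr 1
        rw [hit]
        omega
  obtain ⟨e⟩ := (spider_isRooted fun z : {z // IsLeaf G z} => d z).nonempty_iso h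
    (Equiv.ofBijective φ hbij) rfl (by
      rintro (_ | ⟨z, _ | j, hj⟩) hx
      · exact absurd rfl hx
      · simp only [Equiv.ofBijective_apply, spiderParent, φ, Option.elim_some]
        refine (h.depth_eq_zero.1 ?_).symm
        rw [← Function.iterate_succ_apply' p, h.depth_iterate]
        omega
      · simp only [Equiv.ofBijective_apply, spiderParent, φ, Option.elim_some]
        rw [← Function.iterate_succ_apply' p]
        congr 1
        omega)
  exact ⟨e.symm⟩

end Spider

/-! ### The value of `lambda2` for a spider with one branch of length `r + 1`. -/

/-- The branch lengths `ℓ` are `r + 1` at `i₀`, `r` at `i₁` and between `1` and `r` elsewhere. -/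
structure IsSeesawLike {ι : Type*} (r : ℕ) (ℓ : ι → ℕ) (i₀ i₁ : ι) : Prop where
  ne : i₁ ≠ i₀
  long : ℓ i₀ = r + 1
  short : ℓ i₁ = r
  le : ∀ i, i ≠ i₀ → ℓ i ≤ r
  pos : ∀ i, 1 ≤ ℓ i

/-- Below `1 / r`, the response of each branch increases as long as its denominator does not
change sign. -/
theorem legResponse_lt {ℓ : ℕ} {x y : ℝ} (hℓ : 1 ≤ ℓ) (hxy : x < y)
    (h : 0 < (1 - (ℓ : ℝ) * x) * (1 - (ℓ : ℝ) * y)) : legResponse x ℓ < legResponse y ℓ := by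
  have h1 : legResponse y ℓ - legResponse x ℓ
      = ℓ * (y - x) / ((1 - (ℓ : ℝ) * x) * (1 - (ℓ : ℝ) * y)) := by
    obtain ⟨hx, hy⟩ := mul_ne_zero_iff.1 h.ne'
    unfold legResponse
    field_simp
    ring
  have h2 : (0 : ℝ) < ℓ := by exact_mod_cast hℓ
  have h3 : 0 < ℓ * (y - x) / ((1 - (ℓ : ℝ) * x) * (1 - (ℓ : ℝ) * y)) :=
    div_pos (mul_pos h2 (by linarith)) h
  linarith

theorem cast_succ_mul (r : ℕ) (x : ℝ) : (((r + 1 : ℕ) : ℝ)) * x = ((r : ℝ) + 1) * x := by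
  push_cast
  rfl

namespace IsSeesawLike

variable {ι : Type*} {r : ℕ} {ℓ : ι → ℕ} {i₀ i₁ : ι}

theorem r_pos (h : IsSeesawLike r ℓ i₀ i₁) : 1 ≤ r := h.short ▸ h.pos i₁

theorem not_isLeaf_center (h : IsSeesawLike r ℓ i₀ i₁) : ¬ IsLeaf (spider ℓ) none := by
  intro hl
  obtain ⟨a, ha⟩ := Set.ncard_eq_one.1 hl
  have hm : ∀ i, some ⟨i, ⟨0, h.pos i⟩⟩ ∈ (spider ℓ).neighborSet none := fun i =>
    ((spider_isRooted ℓ).adj_iff _ _).2 (Or.inr ⟨by simp, rfl⟩)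
  rw [ha] at hm
  have := (hm i₀).trans (hm i₁).symm
  simp only [Option.some.injEq, Sigma.mk.injEq] at this
  exact h.ne this.1.symm

variable [Fintype ι]

theorem sum_lt (h : IsSeesawLike r ℓ i₀ i₁) {x y : ℝ} (hx : x ∈ rootInterval r)
    (hy : y ∈ rootInterval r) (hxy : x < y) :
    ∑ i, legResponse x (ℓ i) < ∑ i, legResponse y (ℓ i) := by
  refine Finset.sum_lt_sum_of_nonempty ⟨i₀, Finset.mem_univ _⟩ fun i _ => ?_
  refine legResponse_lt (h.pos i) hxy ?_
  by_cases hi : i = i₀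
  · rw [hi, h.long, cast_succ_mul, cast_succ_mul]
    exact mul_pos_of_neg_of_neg (one_sub_succ_neg hx) (one_sub_succ_neg hy)
  · exact mul_pos (one_sub_pos_of_mem h.r_pos hx (h.le i hi))
      (one_sub_pos_of_mem h.r_pos hy (h.le i hi))

theorem sum_split [DecidableEq ι] (h : IsSeesawLike r ℓ i₀ i₁) (x : ℝ) :
    ∑ i, legResponse x (ℓ i) = legResponse x (r + 1)
      + ∑ i ∈ Finset.univ.erase i₀, legResponse x (ℓ i) := by
  rw [← Finset.add_sum_erase _ _ (Finset.mem_univ i₀), h.long]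

/-- The root equation of the spider has a root. -/
theorem exists_root (h : IsSeesawLike r ℓ i₀ i₁) :
    ∃ x ∈ rootInterval r, ∑ i, legResponse x (ℓ i) = 0 := by
  classical
  have hr := h.r_pos
  have hr' : (0 : ℝ) < r := by exact_mod_cast hr
  obtain ⟨N, hN⟩ : ∃ N : ℝ, N = (Finset.univ.erase i₀).card := ⟨_, rfl⟩
  have hN1 : 1 ≤ N := by
    rw [hN]
    exact_mod_cast Finset.card_pos.2 ⟨i₁, Finset.mem_erase.2 ⟨h.ne, Finset.mem_univ _⟩⟩
  have hD : 0 < N * (r + 1) + r := by positivity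
  -- `a` is the root when all `N` other branches have length `r`, the largest possible sum; `b` is
  -- the root when only one branch of length `r` is kept. The true root lies between them.
  obtain ⟨a, ha⟩ : ∃ a : ℝ, a = (N + 1) / (N * (r + 1) + r) := ⟨_, rfl⟩
  obtain ⟨b, hb⟩ : ∃ b : ℝ, b = 2 / (2 * r + 1) := ⟨_, rfl⟩
  have hab : a ≤ b := by
    rw [ha, hb, div_le_div_iff₀ hD (by positivity)]
    nlinarith
  have ha1 : 1 / ((r : ℝ) + 1) < a := by
    rw [ha, div_lt_div_iff₀ (by positivity) hD]
    nlinarith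
  have hb1 : b < 1 / (r : ℝ) := by
    rw [hb, div_lt_div_iff₀ (by positivity) hr']
    nlinarith
  have hsub : Set.Icc a b ⊆ rootInterval r := fun z hz =>
    ⟨lt_of_lt_of_le ha1 hz.1, lt_of_le_of_lt hz.2 hb1⟩
  have haI : a ∈ rootInterval r := hsub ⟨le_rfl, hab⟩
  have hbI : b ∈ rootInterval r := hsub ⟨hab, le_rfl⟩
  have hcont : ContinuousOn (fun x => ∑ i, legResponse x (ℓ i)) (Set.Icc a b) := by
    refine continuousOn_finsetSum _ fun i _ => ?_
    unfold legResponse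
    refine ContinuousOn.div continuousOn_const (by fun_prop) fun z hz => ?_
    by_cases hi : i = i₀
    · rw [hi, h.long, cast_succ_mul]
      exact (one_sub_succ_neg (hsub hz)).ne
    · exact (one_sub_pos_of_mem hr (hsub hz) (h.le i hi)).ne'
  have hlow : ∑ i, legResponse a (ℓ i) ≤ 0 := by
    rw [h.sum_split]
    have h1 : ∑ i ∈ Finset.univ.erase i₀, legResponse a (ℓ i) ≤ N * legResponse a r := by
      rw [hN, ← nsmul_eq_mul]
      refine Finset.sum_le_card_nsmul _ _ _ fun i hi => ?_
      have h2 := h.le i (Finset.ne_of_mem_erase hi)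
      have h3 : ((ℓ i : ℕ) : ℝ) ≤ r := by exact_mod_cast h2
      refine one_div_le_one_div_of_le (one_sub_pos_of_mem hr haI le_rfl) ?_
      have := pos_of_mem haI
      nlinarith
    have h2 : legResponse a (r + 1) + N * legResponse a r = 0 := by
      have h3 := one_sub_pos_of_mem hr haI le_rfl
      have h4 := one_sub_succ_neg haI
      unfold legResponse
      rw [cast_succ_mul]
      field_simp
      rw [ha]
      field_simp
      ring
    linarith
  have hhigh : 0 ≤ ∑ i, legResponse b (ℓ i) := by
    rw [h.sum_split]
    have h1 : legResponse b r ≤ ∑ i ∈ Finset.univ.erase i₀, legResponse b (ℓ i) := by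
      rw [← h.short]
      refine Finset.single_le_sum (f := fun i => legResponse b (ℓ i)) (fun i hi => ?_)
        (Finset.mem_erase.2 ⟨h.ne, Finset.mem_univ _⟩)
      exact (legResponse_pos hr hbI (h.le i (Finset.ne_of_mem_erase hi))).le
    have h2 : legResponse b (r + 1) + legResponse b r = 0 := by
      have h3 := one_sub_pos_of_mem hr hbI le_rfl
      have h4 := one_sub_succ_neg hbI
      unfold legResponse
      rw [cast_succ_mul]
      field_simp
      rw [hb]
      field_simp
      ring
    linarith
  obtain ⟨x, hx, hx0⟩ := intermediate_value_Icc hab hcont ⟨hlow, hhigh⟩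
  exact ⟨x, hsub hx, hx0⟩

theorem isUniqueRoot (h : IsSeesawLike r ℓ i₀ i₁) {x : ℝ} (hx : x ∈ rootInterval r)
    (h0 : ∑ i, legResponse x (ℓ i) = 0) :
    IsUniqueRoot (fun y => ∑ i, legResponse y (ℓ i)) (rootInterval r) x := by
  refine ⟨hx, h0, fun y hy hy0 => ?_⟩
  simp only at hy0
  rcases lt_trichotomy x y with hxy | hxy | hxy
  · have := h.sum_lt hx hy hxy
    linarith
  · exact hxy.symm
  · have := h.sum_lt hy hx hxy
    linarith

theorem diam_spider (h : IsSeesawLike r ℓ i₀ i₁) : (spider ℓ).diam = 2 * r + 1 := by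
  have hR := spider_isRooted ℓ
  have hC := hR.connected
  refine le_antisymm ?_ ?_
  · obtain ⟨z, w, hzw⟩ := (spider ℓ).exists_dist_eq_diam
    rw [← hzw]
    by_contra hlt
    have h1 := hC.dist_triangle (u := z) (v := none) (w := w)
    rw [SimpleGraph.dist_comm (u := z) (v := none), hR.dist_root, hR.dist_root] at h1
    have hle : ∀ z, spiderDepth ℓ z ≤ r + 1 := by
      rintro (_ | ⟨i, j, hj⟩)
      · simp [spiderDepth]
      · simp only [spiderDepth]
        by_cases hi : i = i₀
        · subst hi
          have := h.long
          omega
        · have := h.le i hi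
          omega
    -- A distance above `2r + 1` would need two distinct vertices of depth `r + 1`, but the end of
    -- the long branch is the only one.
    have hz : ∀ z, spiderDepth ℓ z = r + 1 →
        z = some ⟨i₀, ⟨r, by rw [h.long]; omega⟩⟩ := by
      rintro (_ | ⟨i, j, hj⟩) hz
      · simp [spiderDepth] at hz
      · simp only [spiderDepth] at hz
        have hi : i = i₀ := by
          by_contra hi
          have := h.le i hi
          omega
        subst hi
        have : j = r := by omega
        subst this
        rfl
    have h2 := hle z
    have h3 := hle w
    have h4 := hz z (by omega)
    have h5 := hz w (by omega)
    rw [h4, h5, SimpleGraph.dist_self] at hlt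
    omega
  · classical
    -- The depth, with positive sign on the long branch and negative sign elsewhere, separates the
    -- ends of the branches `i₀` and `i₁` by `2r + 1`.
    let φ : Option (Σ i, Fin (ℓ i)) → ℤ := fun z =>
      z.elim 0 fun w => if w.1 = i₀ then (w.2 : ℤ) + 1 else -((w.2 : ℤ) + 1)
    have hφ : ∀ z, z ≠ none → |φ z - φ (spiderParent ℓ z)| ≤ 1 := by
      rintro (_ | ⟨i, _ | j, hj⟩) hz
      · exact absurd rfl hz
      · simp only [φ, spiderParent, Option.elim_some, Option.elim_none]
        split_ifs <;> simp
      · simp only [φ, spiderParent, Option.elim_some]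
        split_ifs <;> simp
    have h1 := sub_le_dist hC φ (by
      intro x y hxy
      rcases (hR.adj_iff x y).1 hxy with ⟨hx, rfl⟩ | ⟨hy, rfl⟩
      · exact (abs_le.1 (hφ x hx)).2
      · have := (abs_le.1 (hφ y hy)).1
        linarith) (some ⟨i₀, ⟨r, by rw [h.long]; omega⟩⟩)
      (some ⟨i₁, ⟨r - 1, by have := h.short; have := h.pos i₁; omega⟩⟩)
    have h2 : (spider ℓ).dist (some ⟨i₀, ⟨r, by rw [h.long]; omega⟩⟩)
      (some ⟨i₁, ⟨r - 1, by have := h.short; have := h.pos i₁; omega⟩⟩) ≤ (spider ℓ).diam :=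
      SimpleGraph.dist_le_diam (SimpleGraph.connected_iff_ediam_ne_top.1 hC)
    have hr := h.r_pos
    simp only [φ, Option.elim_some, if_true, if_neg h.ne] at h1
    omega

theorem isAdmissible (h : IsSeesawLike r ℓ i₀ i₁) {n : ℕ} (hn : n = 1 + ∑ i, ℓ i) :
    IsAdmissible n (2 * r + 1) (spider ℓ) := by
  refine ⟨(spider_isRooted ℓ).isTree, ?_, h.diam_spider⟩
  rw [Fintype.card_option, Fintype.card_sigma, hn]
  simp [add_comm]

end IsSeesawLike

section Legs

variable {ι : Type*} {ℓ : ι → ℕ}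

theorem spider_isLeaf_iff (i : ι) (j : ℕ) (hj : j < ℓ i) :
    IsLeaf (spider ℓ) (some ⟨i, ⟨j, hj⟩⟩) ↔ j + 1 = ℓ i := by
  rw [(spider_isRooted ℓ).isLeaf_iff (by simp)]
  constructor
  · intro h
    by_contra hne
    exact h (some ⟨i, ⟨j + 1, by omega⟩⟩) (by simp) rfl
  · rintro h (_ | ⟨i', _ | j', hj'⟩) hc
    · exact absurd rfl hc
    · simp [spiderParent]
    · simp only [spiderParent, ne_eq, Option.some.injEq, Sigma.mk.injEq, not_and]
      rintro rfl h'
      rw [heq_eq_eq, Fin.mk.injEq] at h'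
      omega

theorem spider_laplacian_leg [Fintype ι] (f : Option (Σ i, Fin (ℓ i)) → ℝ) (i : ι) (j : ℕ)
    (hj : j + 1 < ℓ i) :
    laplacian (spider ℓ) f (some ⟨i, ⟨j, by omega⟩⟩)
      = (f (some ⟨i, ⟨j, by omega⟩⟩) - f (spiderParent ℓ (some ⟨i, ⟨j, by omega⟩⟩)))
        - (f (some ⟨i, ⟨j + 1, hj⟩⟩) - f (some ⟨i, ⟨j, by omega⟩⟩)) := by
  classical
  rw [(spider_isRooted ℓ).laplacian_eq f (by simp)]
  congr 1
  rw [Finset.sum_eq_single (some ⟨i, ⟨j + 1, hj⟩⟩), if_pos ⟨by simp, rfl⟩]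
  · rfl
  · rintro (_ | ⟨i', _ | j', hj'⟩) - hne
    · simp
    · simp [spiderParent]
    · rw [if_neg]
      rintro ⟨-, h⟩
      apply hne
      simp only [spiderParent, Option.some.injEq, Sigma.mk.injEq] at h
      obtain ⟨rfl, h⟩ := h
      rw [heq_eq_eq, Fin.mk.injEq] at h
      subst h
      rfl
  · simp

theorem spider_laplacian_center [Fintype ι] (hℓ : ∀ i, 1 ≤ ℓ i)
    (f : Option (Σ i, Fin (ℓ i)) → ℝ) :
    laplacian (spider ℓ) f none = - ∑ i, (f (some ⟨i, ⟨0, hℓ i⟩⟩) - f none) := by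
  classical
  rw [(spider_isRooted ℓ).laplacian_root, Fintype.sum_option, Fintype.sum_sigma]
  congr 1
  rw [if_neg (by simp), zero_add]
  refine Finset.sum_congr rfl fun i _ => ?_
  rw [Finset.sum_eq_single ⟨0, hℓ i⟩, if_pos ⟨by simp, rfl⟩]
  · rfl
  · rintro ⟨_ | j, hj⟩ - hne
    · exact absurd rfl hne
    · simp [spiderParent]
  · simp

/-- A function on a spider which is harmonic off the leaves is affine on each branch. -/
theorem spider_affine [Fintype ι] (hℓ : ∀ i, 1 ≤ ℓ i) (f : Option (Σ i, Fin (ℓ i)) → ℝ)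
    (hf : ∀ v, ¬ IsLeaf (spider ℓ) v → laplacian (spider ℓ) f v = 0) (i : ι) (j : ℕ)
    (hj : j < ℓ i) :
    f (some ⟨i, ⟨j, hj⟩⟩) - f (spiderParent ℓ (some ⟨i, ⟨j, hj⟩⟩))
        = f (some ⟨i, ⟨0, hℓ i⟩⟩) - f none ∧
      f (some ⟨i, ⟨j, hj⟩⟩) = f none + (j + 1) * (f (some ⟨i, ⟨0, hℓ i⟩⟩) - f none) := by
  induction j with
  | zero =>
    refine ⟨rfl, ?_⟩
    push_cast
    ring
  | succ j ih =>
    obtain ⟨h1, h2⟩ := ih (by omega)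
    have h3 := hf (some ⟨i, ⟨j, by omega⟩⟩) (by rw [spider_isLeaf_iff]; omega)
    rw [spider_laplacian_leg f i j hj, h1] at h3
    refine ⟨?_, ?_⟩
    · simp only [spiderParent]
      linarith
    · push_cast
      linarith

end Legs

namespace IsSeesawLike

variable {ι : Type*} [Fintype ι] {r : ℕ} {ℓ : ι → ℕ} {i₀ i₁ : ι}

/-- The eigenfunction is `1` at the centre and affine with slope `x h(ℓ i)` on branch `i`, which
solves the boundary condition at the tip. Harmonicity at the centre is the root equation. -/
theorem isSteklovEigenvalue (h : IsSeesawLike r ℓ i₀ i₁) {x : ℝ} (hx : x ∈ rootInterval r)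
    (h0 : ∑ i, legResponse x (ℓ i) = 0) : IsSteklovEigenvalue (spider ℓ) x := by
  have hden : ∀ i, 1 - (ℓ i : ℝ) * x ≠ 0 := by
    intro i
    by_cases hi : i = i₀
    · rw [hi, h.long, cast_succ_mul]
      exact (one_sub_succ_neg hx).ne
    · exact (one_sub_pos_of_mem h.r_pos hx (h.le i hi)).ne'
  let f : Option (Σ i, Fin (ℓ i)) → ℝ := fun z =>
    z.elim 1 fun w => 1 + ((w.2 : ℕ) + 1 : ℝ) * (x * legResponse x (ℓ w.1))
  have hstep : ∀ i j, f (some ⟨i, j⟩) - f (spiderParent ℓ (some ⟨i, j⟩))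
      = x * legResponse x (ℓ i) := by
    rintro i ⟨_ | j, hj⟩
    · simp [f, spiderParent]
    · simp only [f, spiderParent, Option.elim_some]
      push_cast
      ring
  refine ⟨(pos_of_mem hx).le, f, ?_, ?_, ?_⟩
  · intro hz
    have := congrFun hz none
    simp [f] at this
  · rintro (_ | ⟨i, j, hj⟩) hv
    · rw [spider_laplacian_center h.pos, neg_eq_zero]
      have : ∀ i, f (some ⟨i, ⟨0, h.pos i⟩⟩) - f none = x * legResponse x (ℓ i) := fun i =>
        hstep i ⟨0, h.pos i⟩
      simp only [this, ← Finset.mul_sum, h0, mul_zero]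
    · rw [spider_isLeaf_iff] at hv
      have hj' : j + 1 < ℓ i := by omega
      rw [spider_laplacian_leg f i j hj', hstep]
      have := hstep i ⟨j + 1, hj'⟩
      simp only [spiderParent] at this
      rw [this, sub_self]
  · rintro (_ | ⟨i, j, hj⟩) ω' hω hadj
    · exact absurd hω h.not_isLeaf_center
    · have hR := spider_isRooted ℓ
      have hω' : spiderParent ℓ (some ⟨i, ⟨j, hj⟩⟩) = ω' := by
        rcases (hR.adj_iff _ _).1 hadj with ⟨-, e⟩ | ⟨h1, h2⟩
        · exact e
        · exact absurd h2 ((hR.isLeaf_iff (by simp)).1 hω ω' h1)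
      rw [spider_isLeaf_iff] at hω
      rw [← hω', hstep]
      simp only [f, Option.elim_some]
      have h1 : ((j : ℝ) + 1) = ℓ i := by exact_mod_cast hω
      rw [h1]
      have h2 := hden i
      have h3 : legResponse x (ℓ i) * (1 - ℓ i * x) = 1 := one_div_mul_cancel h2
      linear_combination x * h3

/-- An eigenfunction is affine on the branches, and its slopes `σ i` sum to zero. For `μ < x`, a
zero at the centre kills all slopes except that of `i₀`, hence that one too. Otherwise `μ` solves
the root equation; it cannot be at most `1/(r+1)`, where all responses would be positive, nor in
`I_r` below `x`, by monotonicity. -/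
theorem le_of_isSteklovEigenvalue (h : IsSeesawLike r ℓ i₀ i₁) {x μ : ℝ}
    (hx : x ∈ rootInterval r) (h0 : ∑ i, legResponse x (ℓ i) = 0) (hμ : μ ≠ 0)
    (hev : IsSteklovEigenvalue (spider ℓ) μ) : x ≤ μ := by
  obtain ⟨hμ0, f, hf, hlap, hbd⟩ := hev
  have hμpos : 0 < μ := lt_of_le_of_ne hμ0 hμ.symm
  by_contra hlt
  push Not at hlt
  have hr := h.r_pos
  obtain ⟨σ, hσ⟩ : ∃ σ : ι → ℝ, ∀ i, σ i = f (some ⟨i, ⟨0, h.pos i⟩⟩) - f none :=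
    ⟨_, fun _ => rfl⟩
  have haff := spider_affine h.pos f hlap
  simp only [← hσ] at haff
  have hsum : ∑ i, σ i = 0 := by
    have := hlap none h.not_isLeaf_center
    rw [spider_laplacian_center h.pos, neg_eq_zero] at this
    simpa only [← hσ] using this
  -- The boundary condition at the tip of branch `i`, where the value is `f none + ℓ i * σ i`.
  have hend : ∀ i, σ i * (1 - ℓ i * μ) = μ * f none := by
    intro i
    have hp := h.pos i
    have hj : ℓ i - 1 < ℓ i := by omega
    have hl : IsLeaf (spider ℓ) (some ⟨i, ⟨ℓ i - 1, hj⟩⟩) := by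
      rw [spider_isLeaf_iff]
      omega
    have h1 := hbd _ _ hl ((spider_isRooted ℓ).adj_parent (by simp))
    obtain ⟨h2, h3⟩ := haff i (ℓ i - 1) hj
    rw [h2, h3, Nat.cast_sub hp, Nat.cast_one, sub_add_cancel] at h1
    linarith
  have hpos : ∀ i, i ≠ i₀ → 0 < 1 - (ℓ i : ℝ) * μ := by
    intro i hi
    have h1 := one_sub_pos_of_mem hr hx (h.le i hi)
    have h2 : (ℓ i : ℝ) * μ ≤ ℓ i * x := by gcongr
    linarith
  by_cases hzero : f none = 0
  · apply hf
    have hσ0 : ∀ i, i ≠ i₀ → σ i = 0 := by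
      intro i hi
      have := hend i
      rw [hzero, mul_zero] at this
      exact (mul_eq_zero.1 this).resolve_right (hpos i hi).ne'
    have hσ1 : σ i₀ = 0 := by
      rw [Finset.sum_eq_single i₀ (fun i _ hi => hσ0 i hi) (by simp)] at hsum
      exact hsum
    have hσ2 : ∀ i, σ i = 0 := by
      intro i
      by_cases hi : i = i₀
      · rw [hi, hσ1]
      · exact hσ0 i hi
    ext z
    rcases z with _ | ⟨i, j, hj⟩
    · exact hzero
    · rw [(haff i j hj).2, hzero, hσ2 i]
      simp
  · have hne : ∀ i, 1 - (ℓ i : ℝ) * μ ≠ 0 := by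
      intro i hi
      have := hend i
      rw [hi, mul_zero] at this
      exact mul_ne_zero hμ hzero this.symm
    have hsumμ : ∑ i, legResponse μ (ℓ i) = 0 := by
      have h1 : ∀ i, σ i = μ * f none * legResponse μ (ℓ i) := by
        intro i
        unfold legResponse
        rw [mul_one_div, eq_div_iff (hne i), hend i]
      simp only [h1, ← Finset.mul_sum] at hsum
      exact (mul_eq_zero.1 hsum).resolve_left (mul_ne_zero hμ hzero)
    have hlong : 1 - ((r : ℝ) + 1) * μ < 0 := by
      by_contra hge
      push Not at hge
      have h1 : ∀ i, 0 < legResponse μ (ℓ i) := by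
        intro i
        refine one_div_pos.2 ?_
        by_cases hi : i = i₀
        · refine lt_of_le_of_ne ?_ (hne i).symm
          rw [hi, h.long, cast_succ_mul]
          exact hge
        · exact hpos i hi
      exact (Finset.sum_pos (fun i _ => h1 i) ⟨i₀, Finset.mem_univ _⟩).ne' hsumμ
    have hμI : μ ∈ rootInterval r := by
      refine ⟨?_, hlt.trans hx.2⟩
      rw [div_lt_iff₀ (by positivity)]
      linarith
    have := h.sum_lt hμI hx hlt
    linarith

theorem lambda2_eq (h : IsSeesawLike r ℓ i₀ i₁) {x : ℝ} (hx : x ∈ rootInterval r)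
    (h0 : ∑ i, legResponse x (ℓ i) = 0) : lambda2 (spider ℓ) = x := by
  have hmem : x ∈ {μ : ℝ | μ ≠ 0 ∧ IsSteklovEigenvalue (spider ℓ) μ} :=
    ⟨(pos_of_mem hx).ne', h.isSteklovEigenvalue hx h0⟩
  refine le_antisymm (csInf_le ⟨0, ?_⟩ hmem) (le_csInf ⟨x, hmem⟩ ?_)
  · rintro μ ⟨-, hμ⟩
    exact hμ.1
  · rintro μ ⟨hμ, hev⟩
    exact h.le_of_isSteklovEigenvalue hx h0 hμ hev

end IsSeesawLike

/-! ### The upper bound for arbitrary trees, with its equality case. -/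

section Comparison

variable {V : Type*} [Fintype V] {G : SimpleGraph V} {r : ℕ} {u v x₀ y₀ : V} {p : V → V} {x : ℝ}

theorem extraLeaves_comm (G : SimpleGraph V) (x₀ y₀ : V) :
    extraLeaves G y₀ x₀ = extraLeaves G x₀ y₀ := by
  ext z
  simp only [extraLeaves, Finset.mem_filter, Finset.mem_univ, true_and]
  tauto

theorem extraLengths_comm (G : SimpleGraph V) (u v x₀ y₀ : V) :
    extraLengths G v u y₀ x₀ = extraLengths G u v x₀ y₀ := by
  unfold extraLengths
  rw [extraLeaves_comm]
  simp only [min_comm]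

/-- When the extra leaves are all on the side of `u`, the only leaf below `v` is `x₀`. So every
vertex other than `u` has a single leaf below it, and the tree is a spider centred at `u`. -/
theorem IsCenterEdge.nonempty_iso_spider (hc : IsCenterEdge G r u v x₀ y₀)
    (h : IsRooted G u p (G.dist u)) (hx₀ : IsLeaf G x₀) (hy₀ : IsLeaf G y₀)
    (hu : ∀ y, y ≠ u → y ≠ v → ∀ z z', IsLeaf G z → IsLeaf G z' → Below p y z → Below p y z' →
      z = z')
    (hside : ∀ z ∈ extraLeaves G x₀ y₀, G.dist u z < G.dist v z)
    {κ : Type*} [Fintype κ] {ℓ : κ → ℕ}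
    (hℓ : Finset.univ.val.map ℓ = (r + 1) ::ₘ r ::ₘ extraLengths G u v x₀ y₀) :
    Nonempty (G ≃g spider ℓ) := by
  classical
  have hxy : x₀ ≠ y₀ := by
    rintro rfl
    have h1 := hc.dist_ux
    have h2 := hc.dist_uy
    omega
  have hv : ∀ z, IsLeaf G z → Below p v z → z = x₀ := by
    intro z hz hb
    by_contra hne
    have h1 := (hc.below_iff h z).1 hb
    by_cases hzy : z = y₀
    · subst hzy
      rw [hc.dist_uy, hc.dist_vy] at h1
      omega
    · have := hside z (by
        simp only [extraLeaves, Finset.mem_filter, Finset.mem_univ, true_and]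
        exact ⟨hz, hne, hzy⟩)
      omega
  obtain ⟨e⟩ := h.nonempty_iso_spider (by
    intro y hy z z' hz hz' hbz hbz'
    by_cases hyv : y = v
    · subst hyv
      rw [hv z hz hbz, hv z' hz' hbz']
    · exact hu y hy hyv z z' hz hz' hbz hbz')
  have hleaves : Finset.univ.filter (fun z => IsLeaf G z)
      = Finset.cons x₀ (Finset.cons y₀ (extraLeaves G x₀ y₀) (by simp [extraLeaves]))
        (by simp [extraLeaves, hxy]) := by
    ext z
    simp only [extraLeaves, Finset.mem_filter, Finset.mem_univ, true_and, Finset.mem_cons]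
    by_cases h1 : z = x₀
    · simp [h1, hx₀]
    · by_cases h2 : z = y₀
      · simp [h2, hy₀]
      · simp [h1, h2]
  have hsub : (Finset.univ : Finset {z // IsLeaf G z}).val.map Subtype.val
      = (Finset.univ.filter (fun z => IsLeaf G z)).val := by
    have : (Finset.univ : Finset {z // IsLeaf G z}).map (Function.Embedding.subtype _)
        = Finset.univ.filter (fun z => IsLeaf G z) := by
      ext z
      simp
    rw [← this]
    rfl
  have hmap : (Finset.univ : Finset {z // IsLeaf G z}).val.map
        (fun z : {z // IsLeaf G z} => G.dist u z)
      = Finset.univ.val.map ℓ := by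
    have h1 : (Finset.univ : Finset {z // IsLeaf G z}).val.map
        (fun z : {z // IsLeaf G z} => G.dist u z)
        = ((Finset.univ : Finset {z // IsLeaf G z}).val.map Subtype.val).map (G.dist u) := by
      rw [Multiset.map_map]
      rfl
    rw [h1, hsub, hleaves, hℓ, Finset.cons_val, Finset.cons_val, Multiset.map_cons,
      Multiset.map_cons, hc.dist_ux, hc.dist_uy, extraLengths]
    congr 2
    refine Multiset.map_congr rfl fun z hz => ?_
    rw [min_eq_left (hside z hz).le]
  obtain ⟨e'⟩ := spider_iso_of_map_eq hmap
  exact ⟨e.trans e'⟩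

/-- If no choice of extra branches of total length at least `M` has a smaller response than the
value balancing the diametral path at `x`, then `lambda2` is at most `x`; the trees attaining `x`
are spiders. -/
theorem IsAdmissible.lambda2_le {n M : ℕ} (hG : IsAdmissible n (2 * r + 1) G) (hr : 1 ≤ r)
    (hn : n = 2 * r + 2 + M) (hx : x ∈ rootInterval r)
    (hopt : ∀ L : Multiset ℕ, (∀ ℓ ∈ L, 1 ≤ ℓ ∧ ℓ ≤ r) → M ≤ L.sum →
      -(legResponse x (r + 1) + legResponse x r) ≤ (L.map (legResponse x)).sum) :
    lambda2 G ≤ x ∧ (x ≤ lambda2 G → ∃ L : Multiset ℕ, (∀ ℓ ∈ L, 1 ≤ ℓ ∧ ℓ ≤ r) ∧ M ≤ L.sum ∧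
      (L.map (legResponse x)).sum = -(legResponse x (r + 1) + legResponse x r) ∧
      ∀ {κ : Type} [Fintype κ] {ℓ : κ → ℕ},
        Finset.univ.val.map ℓ = (r + 1) ::ₘ r ::ₘ L → Nonempty (G ≃g spider ℓ)) := by
  obtain ⟨hT, hcard, hdiam⟩ := hG
  obtain ⟨u, v, x₀, y₀, hc⟩ := exists_isCenterEdge hT hdiam
  obtain ⟨p, hp⟩ := exists_isRooted hT u
  obtain ⟨p', hp'⟩ := exists_isRooted hT v
  have hx₀ := hc.isLeaf_x hp
  have hy₀ := hc.symm.isLeaf_x hp'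
  have hL : ∀ ℓ ∈ extraLengths G u v x₀ y₀, 1 ≤ ℓ ∧ ℓ ≤ r := by
    intro ℓ hℓ
    obtain ⟨z, hz, rfl⟩ := Multiset.mem_map.1 hℓ
    have hz' : z ∈ extraLeaves G x₀ y₀ := hz
    simp only [extraLeaves, Finset.mem_filter] at hz'
    exact hc.min_dist_bounds hr hp hz'.2.1
  have hM := hc.le_sum_extraLengths hp hx₀ hy₀ (hcard.trans hn)
  have h1 := hc.lambda2_le hr hx hp hx₀ hy₀ (hopt _ hL hM)
  -- The reversed edge is needed when the extra leaves lie on the side of `v`, which is then the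
  -- centre of the spider.
  have h2 := hc.symm.lambda2_le hr hx hp' hy₀ hx₀
    (by rw [extraLengths_comm]; exact hopt _ hL hM)
  refine ⟨h1.1, fun hge => ⟨extraLengths G u v x₀ y₀, hL, hM, (h1.2 hge).2.1, ?_⟩⟩
  intro κ _ ℓ hℓ
  rcases (h1.2 hge).2.2 with hs | hs
  · exact hc.nonempty_iso_spider hp hx₀ hy₀ (h1.2 hge).1 hs hℓ
  · exact hc.symm.nonempty_iso_spider hp' hy₀ hx₀ (h2.2 hge).1
      (by rw [extraLeaves_comm]; exact hs) (by rw [extraLengths_comm]; exact hℓ)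

end Comparison

/-! ### Convexity of the response: balanced branch lengths are optimal. -/

section Balanced

/-- `t` copies of `c + 1` and `q - t` copies of `c`. -/
def balanced (q c t : ℕ) : Multiset ℕ :=
  Multiset.replicate t (c + 1) + Multiset.replicate (q - t) c

theorem eq_balanced {L : Multiset ℕ} {q c t : ℕ} (hmem : ∀ ℓ ∈ L, ℓ = c ∨ ℓ = c + 1)
    (hcard : L.card = q) (hsum : L.sum = q * c + t) : L = balanced q c t := by
  have h1 := Multiset.filter_add_not (fun ℓ => ℓ = c + 1) L
  have h2 : L.filter (fun ℓ => ℓ = c + 1)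
      = Multiset.replicate (L.filter (fun ℓ => ℓ = c + 1)).card (c + 1) :=
    Multiset.eq_replicate.2 ⟨rfl, fun b hb => (Multiset.mem_filter.1 hb).2⟩
  have h3 : L.filter (fun ℓ => ¬ ℓ = c + 1)
      = Multiset.replicate (L.filter (fun ℓ => ¬ ℓ = c + 1)).card c :=
    Multiset.eq_replicate.2 ⟨rfl, fun b hb =>
      (hmem b (Multiset.mem_filter.1 hb).1).resolve_right (Multiset.mem_filter.1 hb).2⟩
  obtain ⟨a, ha⟩ : ∃ a, a = (L.filter (fun ℓ => ℓ = c + 1)).card := ⟨_, rfl⟩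
  obtain ⟨b, hb⟩ : ∃ b, b = (L.filter (fun ℓ => ¬ ℓ = c + 1)).card := ⟨_, rfl⟩
  rw [h2, h3, ← ha, ← hb] at h1
  rw [← h1] at hcard hsum
  simp only [Multiset.card_add, Multiset.card_replicate, Multiset.sum_add,
    Multiset.sum_replicate, smul_eq_mul] at hcard hsum
  have hat : a = t := by
    subst hcard
    nlinarith
  rw [← h1, balanced, hat]
  congr 2
  omega

theorem map_asLengths {r q c t : ℕ} (ht : t ≤ q) :
    Finset.univ.val.map (asLengths r (q + 2) c t) = (r + 1) ::ₘ r ::ₘ balanced q c t := by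
  rw [Fin.univ_succ, Finset.cons_val, Multiset.map_cons, Finset.map_val, Multiset.map_map,
    Fin.univ_succ, Finset.cons_val, Multiset.map_cons, Finset.map_val, Multiset.map_map]
  have h0 : asLengths r (q + 2) c t 0 = r + 1 := by simp [asLengths]
  have h1 : asLengths r (q + 2) c t (Fin.succ 0) = r := by simp [asLengths]
  have h2 : ∀ i : Fin q, asLengths r (q + 2) c t (Fin.succ (Fin.succ i))
      = c + if (i : ℕ) < t then 1 else 0 := by
    intro i
    have hi : ((Fin.succ (Fin.succ i) : Fin (q + 2)) : ℕ) = i + 2 := rfl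
    unfold asLengths
    rw [hi, if_neg (by omega), if_neg (by omega)]
    split_ifs <;> omega
  simp only [Function.comp_apply, Function.Embedding.coeFn_mk, Function.comp_def, h0, h1, h2]
  congr 2
  refine eq_balanced ?_ (by simp) ?_
  · intro ℓ hℓ
    obtain ⟨i, -, rfl⟩ := Multiset.mem_map.1 hℓ
    split_ifs <;> simp
  · change ∑ i : Fin q, (c + if (i : ℕ) < t then 1 else 0) = _
    rw [Finset.sum_add_distrib, Fin.sum_univ_eq_sum_range (fun i => if i < t then 1 else 0)]
    have h3 : (Finset.range q).filter (fun i => i < t) = Finset.range t := by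
      ext i
      simp only [Finset.mem_filter, Finset.mem_range]
      omega
    rw [Finset.sum_ite, h3]
    simp

theorem sum_map_balanced {q c t : ℕ} (ht : t ≤ q) (x : ℝ) :
    ((balanced q c t).map (legResponse x)).sum
      = t * legResponse x (c + 1) + ((q : ℝ) - t) * legResponse x c := by
  simp only [balanced, Multiset.map_add, Multiset.map_replicate, Multiset.sum_add,
    Multiset.sum_replicate, nsmul_eq_mul, Nat.cast_sub ht]

theorem sum_asLengths {r q c t : ℕ} (ht : t ≤ q) :
    1 + ∑ i, asLengths r (q + 2) c t i = 2 * r + 2 + (q * c + t) := by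
  change 1 + (Finset.univ.val.map (asLengths r (q + 2) c t)).sum = _
  rw [map_asLengths ht]
  simp only [balanced, Multiset.sum_cons, Multiset.sum_add, Multiset.sum_replicate, smul_eq_mul]
  obtain ⟨k, rfl⟩ := Nat.exists_eq_add_of_le ht
  rw [Nat.add_sub_cancel_left]
  ring

theorem sum_legResponse_asLengths {r q c t : ℕ} (ht : t ≤ q) (x : ℝ) :
    ∑ i, legResponse x (asLengths r (q + 2) c t i) = legResponse x (r + 1) + legResponse x r
      + ((balanced q c t).map (legResponse x)).sum := by
  have : ∑ i, legResponse x (asLengths r (q + 2) c t i)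
      = ((Finset.univ.val.map (asLengths r (q + 2) c t)).map (legResponse x)).sum := by
    rw [Multiset.map_map]
    rfl
  rw [this, map_asLengths ht]
  simp only [Multiset.map_cons, Multiset.sum_cons, add_assoc]

theorem rootFunction_eq {r q c t : ℕ} (ht : t ≤ q) (x : ℝ) :
    rootFunction r q c t x = ∑ i, legResponse x (asLengths r (q + 2) c t i) := by
  rw [sum_legResponse_asLengths ht, sum_map_balanced ht]
  unfold rootFunction legResponse
  push_cast
  ring

theorem asLengths_isSeesawLike {r q c t : ℕ} (hr : 1 ≤ r) (hc : q = 0 ∨ 1 ≤ c ∧ c ≤ r)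
    (ht : t = 0 ∨ c + 1 ≤ r) :
    IsSeesawLike r (asLengths r (q + 2) c t) 0 1 where
  ne := by simp
  long := by simp [asLengths]
  short := by simp [asLengths]
  le := by
    intro i hi
    have h0 : (i : ℕ) ≠ 0 := fun e => hi (Fin.ext e)
    have := i.2
    simp only [asLengths, h0, if_false]
    split_ifs <;> omega
  pos := by
    intro i
    have := i.2
    simp only [asLengths]
    split_ifs <;> omega

/-- The chord of the convex response function between `c` and `c + 1` lies below it. -/
theorem chord_le {r c ℓ : ℕ} {x : ℝ} (hr : 1 ≤ r) (hx : x ∈ rootInterval r) (hc : c + 1 ≤ r)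
    (hℓ : ℓ ≤ r) :
    0 ≤ legResponse x ℓ - (legResponse x c + ((ℓ : ℝ) - c) * (legResponse x (c + 1)
      - legResponse x c)) ∧
    (legResponse x ℓ - (legResponse x c + ((ℓ : ℝ) - c) * (legResponse x (c + 1)
      - legResponse x c)) = 0 → ℓ = c ∨ ℓ = c + 1) := by
  have h0 := pos_of_mem hx
  have h1 := one_sub_pos_of_mem hr hx hℓ
  have h2 := one_sub_pos_of_mem hr hx (by omega : c ≤ r)
  have h3 := one_sub_pos_of_mem hr hx hc
  -- The excess over the chord is a second divided difference. Its numerator `(ℓ - c)(ℓ - c - 1)` is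
  -- nonnegative at integers and vanishes only at the two ends of the chord.
  have h4 : legResponse x ℓ - (legResponse x c + ((ℓ : ℝ) - c) * (legResponse x (c + 1)
      - legResponse x c)) = (((ℓ : ℝ) - c) * ((ℓ : ℝ) - c - 1)) * x ^ 2
        / ((1 - (ℓ : ℝ) * x) * (1 - (c : ℝ) * x) * (1 - ((c + 1 : ℕ) : ℝ) * x)) := by
    have key : ∀ A B C : ℝ, A ≠ 0 → B ≠ 0 → C ≠ 0 → A = 1 - ℓ * x → B = 1 - c * x →
        C = 1 - (c + 1) * x → 1 / A - (1 / B + ((ℓ : ℝ) - c) * (1 / C - 1 / B))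
          = (((ℓ : ℝ) - c) * ((ℓ : ℝ) - c - 1)) * x ^ 2 / (A * B * C) := by
      intro A B C hA hB hC eA eB eC
      field_simp
      rw [eA, eB, eC]
      ring
    exact key _ _ _ h1.ne' h2.ne' h3.ne' rfl rfl (by rw [cast_succ_mul])
  rw [h4]
  have h5 : 0 < (1 - (ℓ : ℝ) * x) * (1 - (c : ℝ) * x) * (1 - ((c + 1 : ℕ) : ℝ) * x) := by
    positivity
  refine ⟨?_, fun h => ?_⟩
  · refine div_nonneg (mul_nonneg ?_ (by positivity)) h5.le
    have : (0 : ℤ) ≤ ((ℓ : ℤ) - c) * ((ℓ : ℤ) - c - 1) := by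
      rcases le_or_gt ((ℓ : ℤ) - c) 0 with h | h
      · exact mul_nonneg_of_nonpos_of_nonpos h (by omega)
      · exact mul_nonneg h.le (by omega)
    exact_mod_cast this
  · have h6 := (div_eq_zero_iff.1 h).resolve_right h5.ne'
    have h7 := (mul_eq_zero.1 h6).resolve_right (by positivity)
    rcases mul_eq_zero.1 h7 with h8 | h8
    · left
      have : (ℓ : ℝ) = c := by linarith
      exact_mod_cast this
    · right
      have : (ℓ : ℝ) = c + 1 := by linarith
      exact_mod_cast this

theorem multiset_sum_map_nonneg (f : ℕ → ℝ) (L : Multiset ℕ) (hf : ∀ ℓ ∈ L, 0 ≤ f ℓ) :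
    0 ≤ (L.map f).sum ∧ ((L.map f).sum ≤ 0 → ∀ ℓ ∈ L, f ℓ = 0) := by
  induction L using Multiset.induction_on with
  | empty => simp
  | cons a L ih =>
    have h1 := hf a (Multiset.mem_cons_self a L)
    obtain ⟨h2, h3⟩ := ih fun ℓ hℓ => hf ℓ (Multiset.mem_cons_of_mem hℓ)
    rw [Multiset.map_cons, Multiset.sum_cons]
    refine ⟨by linarith, fun h ℓ hℓ => ?_⟩
    rcases Multiset.mem_cons.1 hℓ with rfl | hℓ
    · linarith
    · exact h3 (by linarith) ℓ hℓ

/-- The balanced choice of branches is optimal among all choices on one side of its number of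
branches. -/
theorem balanced_optimal {r q c t : ℕ} {x : ℝ} (hr : 1 ≤ r) (hx : x ∈ rootInterval r)
    (hc : c + 1 ≤ r) (ht : t ≤ q) {L : Multiset ℕ} (hL : ∀ ℓ ∈ L, 1 ≤ ℓ ∧ ℓ ≤ r)
    (hsum : q * c + t ≤ L.sum)
    (hcard : L.card = q ∨ 0 < ((L.card : ℝ) - q) * (1 - (2 * (c : ℝ) + 1) * x)) :
    L = balanced q c t ∨
      ((balanced q c t).map (legResponse x)).sum < (L.map (legResponse x)).sum := by
  have h0 := pos_of_mem hx
  have h2 := one_sub_pos_of_mem hr hx (by omega : c ≤ r)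
  have h3 := one_sub_pos_of_mem hr hx hc
  obtain ⟨Δ, hΔ⟩ : ∃ Δ, Δ = legResponse x (c + 1) - legResponse x c := ⟨_, rfl⟩
  obtain ⟨a, ha⟩ : ∃ a, a = legResponse x c - c * Δ := ⟨_, rfl⟩
  have hΔpos : 0 < Δ := by
    rw [hΔ, sub_pos]
    exact one_div_lt_one_div_of_lt h3 (by push_cast; nlinarith)
  -- The chord is `ℓ ↦ a + ℓ Δ`. Its intercept `a` is the price of one more branch at fixed total
  -- length, so its sign decides whether more branches help.
  have ha' : a = (1 - (2 * (c : ℝ) + 1) * x)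
      / ((1 - (c : ℝ) * x) * (1 - ((c + 1 : ℕ) : ℝ) * x)) := by
    have key : ∀ B C : ℝ, B ≠ 0 → C ≠ 0 → B = 1 - c * x → C = 1 - (c + 1) * x →
        1 / B - c * (1 / C - 1 / B) = (1 - (2 * (c : ℝ) + 1) * x) / (B * C) := by
      intro B C hB hC eB eC
      field_simp
      rw [eB, eC]
      ring
    rw [ha, hΔ]
    exact key _ _ h2.ne' h3.ne' rfl (by rw [cast_succ_mul])
  obtain ⟨e, he⟩ : ∃ e : ℕ → ℝ, ∀ ℓ, e ℓ = legResponse x ℓ - (legResponse x c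
      + ((ℓ : ℝ) - c) * (legResponse x (c + 1) - legResponse x c)) := ⟨_, fun _ => rfl⟩
  -- The response splits into the price of the number of branches, the price of the total length and
  -- the nonnegative excess over the chord. Each is at least its value for the balanced choice.
  have hdecomp : (L.map (legResponse x)).sum = L.card * a + L.sum * Δ + (L.map e).sum := by
    clear hL hsum hcard
    induction L using Multiset.induction_on with
    | empty => simp
    | cons b L ih =>
      simp only [Multiset.map_cons, Multiset.sum_cons, Multiset.card_cons]
      generalize L.sum = S at ih ⊢
      rw [ih, he b, ← hΔ, ha]
      push_cast
      ring
  have hpos := multiset_sum_map_nonneg e L fun ℓ hℓ => by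
    rw [he]
    exact (chord_le hr hx hc (hL ℓ hℓ).2).1
  have hval : ((balanced q c t).map (legResponse x)).sum = q * a + (q * c + t : ℕ) * Δ := by
    rw [sum_map_balanced ht, ha, hΔ]
    push_cast
    ring
  have hcard' : 0 ≤ ((L.card : ℝ) - q) * a ∧ (((L.card : ℝ) - q) * a ≤ 0 → L.card = q) := by
    rcases hcard with h | h
    · exact ⟨by rw [h]; simp, fun _ => h⟩
    · have : 0 < ((L.card : ℝ) - q) * a := by
        rw [ha', ← mul_div_assoc]
        positivity
      exact ⟨this.le, fun h' => absurd h' (not_le.2 this)⟩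
  have hsum' : ((q * c + t : ℕ) : ℝ) ≤ (L.sum : ℕ) := by exact_mod_cast hsum
  obtain ⟨S, hS⟩ : ∃ S, S = L.sum := ⟨_, rfl⟩
  rw [← hS] at hdecomp hsum' hsum
  have hmul : ((q * c + t : ℕ) : ℝ) * Δ ≤ S * Δ := mul_le_mul_of_nonneg_right hsum' hΔpos.le
  by_cases hlt : ((balanced q c t).map (legResponse x)).sum < (L.map (legResponse x)).sum
  · exact Or.inr hlt
  · left
    push Not at hlt
    rw [hval, hdecomp] at hlt
    have h4 := hcard'.2 (by linarith [hpos.1])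
    have h5 := hpos.2 (by linarith [hcard'.1])
    have h6 : (S : ℝ) ≤ ((q * c + t : ℕ) : ℝ) :=
      le_of_mul_le_mul_right (by linarith [hcard'.1, hpos.1]) hΔpos
    refine eq_balanced (fun ℓ hℓ => ?_) h4 ?_
    · refine (chord_le hr hx hc (hL ℓ hℓ).2).2 ?_
      rw [← he]
      exact h5 ℓ hℓ
    · rw [← hS]
      exact le_antisymm (by exact_mod_cast h6) hsum

end Balanced

/-! ### From optimal branch lengths to extremal trees. -/

section Candidates

variable {r q c t : ℕ}

theorem rootFunction_pos (hS : IsSeesawLike r (asLengths r (q + 2) c t) 0 1) (ht : t ≤ q)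
    {x y : ℝ} (hx : IsUniqueRoot (rootFunction r q c t) (rootInterval r) x)
    (hy : y ∈ rootInterval r) (hxy : x < y) : 0 < rootFunction r q c t y := by
  have h1 := hS.sum_lt hx.1 hy hxy
  rwa [← rootFunction_eq ht, ← rootFunction_eq ht, hx.2.1] at h1

theorem rootFunction_neg (hS : IsSeesawLike r (asLengths r (q + 2) c t) 0 1) (ht : t ≤ q)
    {x y : ℝ} (hx : IsUniqueRoot (rootFunction r q c t) (rootInterval r) x)
    (hy : y ∈ rootInterval r) (hxy : y < x) : rootFunction r q c t y < 0 := by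
  have h1 := hS.sum_lt hy hx.1 hxy
  rwa [← rootFunction_eq ht, ← rootFunction_eq ht, hx.2.1] at h1

theorem exists_isUniqueRoot (hS : IsSeesawLike r (asLengths r (q + 2) c t) 0 1) (ht : t ≤ q) :
    ∃ x, IsUniqueRoot (rootFunction r q c t) (rootInterval r) x ∧
      lambda2 (almostSeesaw r (q + 2) c t) = x := by
  obtain ⟨x, hx, h0⟩ := hS.exists_root
  refine ⟨x, ?_, hS.lambda2_eq hx h0⟩
  have h1 := hS.isUniqueRoot hx h0
  refine ⟨hx, by rw [rootFunction_eq ht, h0], fun y hy hy0 => h1.2.2 y hy ?_⟩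
  rwa [rootFunction_eq ht] at hy0

theorem almostSeesaw_isAdmissible (hS : IsSeesawLike r (asLengths r (q + 2) c t) 0 1)
    (ht : t ≤ q) {n M : ℕ} (hn : n = 2 * r + 2 + M) (hM : M = q * c + t) :
    IsAdmissible n (2 * r + 1) (almostSeesaw r (q + 2) c t) :=
  hS.isAdmissible (by rw [sum_asLengths ht, hn, hM])

/-- `L` consists of `q` balanced branches, or is worse than that at `x`. -/
def BalancedOrWorse (x : ℝ) (q c t : ℕ) (L : Multiset ℕ) : Prop :=
  L = balanced q c t ∨ ((balanced q c t).map (legResponse x)).sum < (L.map (legResponse x)).sum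

theorem BalancedOrWorse.le {x : ℝ} {L : Multiset ℕ} (h : BalancedOrWorse x q c t L) :
    ((balanced q c t).map (legResponse x)).sum ≤ (L.map (legResponse x)).sum := by
  rcases h with rfl | h
  · exact le_rfl
  · exact h.le

/-- If every choice of extra branches is one of two balanced ones or worse than one of them, then
the extremizers are the spiders of the two balanced choices with the larger root. -/
theorem extremizers_of_two_candidates {n M q₁ c₁ t₁ q₂ c₂ t₂ : ℕ} (hn : n = 2 * r + 2 + M)
    (hS₁ : IsSeesawLike r (asLengths r (q₁ + 2) c₁ t₁) 0 1) (ht₁ : t₁ ≤ q₁)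
    (hM₁ : M = q₁ * c₁ + t₁)
    (hS₂ : IsSeesawLike r (asLengths r (q₂ + 2) c₂ t₂) 0 1) (ht₂ : t₂ ≤ q₂)
    (hM₂ : M = q₂ * c₂ + t₂)
    (hD : ∀ z ∈ rootInterval r, ∀ L : Multiset ℕ, (∀ ℓ ∈ L, 1 ≤ ℓ ∧ ℓ ≤ r) → M ≤ L.sum →
      BalancedOrWorse z q₁ c₁ t₁ L ∨ BalancedOrWorse z q₂ c₂ t₂ L) :
    ∃ x y, IsUniqueRoot (rootFunction r q₁ c₁ t₁) (rootInterval r) x ∧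
      IsUniqueRoot (rootFunction r q₂ c₂ t₂) (rootInterval r) y ∧
      lambda2 (almostSeesaw r (q₁ + 2) c₁ t₁) = x ∧
      lambda2 (almostSeesaw r (q₂ + 2) c₂ t₂) = y ∧
      OnlyCandidates n (2 * r + 1) (almostSeesaw r (q₁ + 2) c₁ t₁)
        (almostSeesaw r (q₂ + 2) c₂ t₂) ∧
      (y < x → IsUniqueExtremizer n (2 * r + 1) (almostSeesaw r (q₁ + 2) c₁ t₁)) ∧
      (x < y → IsUniqueExtremizer n (2 * r + 1) (almostSeesaw r (q₂ + 2) c₂ t₂)) ∧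
      (x = y → IsExtremizer n (2 * r + 1) (almostSeesaw r (q₁ + 2) c₁ t₁) ∧
        IsExtremizer n (2 * r + 1) (almostSeesaw r (q₂ + 2) c₂ t₂)) := by
  obtain ⟨x, hx, hlx⟩ := exists_isUniqueRoot hS₁ ht₁
  obtain ⟨y, hy, hly⟩ := exists_isUniqueRoot hS₂ ht₂
  have hA₁ := almostSeesaw_isAdmissible hS₁ ht₁ hn hM₁
  have hA₂ := almostSeesaw_isAdmissible hS₂ ht₂ hn hM₂
  have hr := hS₁.r_pos
  -- At the larger root both root functions are nonnegative, which is the hypothesis under which `m`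
  -- bounds `lambda2` of every competitor.
  obtain ⟨m, hm⟩ : ∃ m, m = max x y := ⟨_, rfl⟩
  have hxm : x ≤ m := hm ▸ le_max_left x y
  have hym : y ≤ m := hm ▸ le_max_right x y
  have hmI : m ∈ rootInterval r := by
    rcases max_choice x y with h | h
    · rw [hm, h]; exact hx.1
    · rw [hm, h]; exact hy.1
  have h1 : 0 ≤ rootFunction r q₁ c₁ t₁ m := by
    rcases hxm.eq_or_lt with h | h
    · rw [← h, hx.2.1]
    · exact (rootFunction_pos hS₁ ht₁ hx hmI h).le
  have h2 : 0 ≤ rootFunction r q₂ c₂ t₂ m := by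
    rcases hym.eq_or_lt with h | h
    · rw [← h, hy.2.1]
    · exact (rootFunction_pos hS₂ ht₂ hy hmI h).le
  have e1 := rootFunction_eq (r := r) (c := c₁) ht₁ m
  have e2 := rootFunction_eq (r := r) (c := c₂) ht₂ m
  rw [sum_legResponse_asLengths ht₁] at e1
  rw [sum_legResponse_asLengths ht₂] at e2
  have hopt : ∀ L : Multiset ℕ, (∀ ℓ ∈ L, 1 ≤ ℓ ∧ ℓ ≤ r) → M ≤ L.sum →
      -(legResponse m (r + 1) + legResponse m r) ≤ (L.map (legResponse m)).sum := by
    intro L hL hLM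
    rcases hD m hmI L hL hLM with h | h <;> have := h.le <;> linarith
  have hub : ∀ H : SimpleGraph (Fin n), IsAdmissible n (2 * r + 1) H → lambda2 H ≤ m :=
    fun H hH => (hH.lambda2_le hr hn hmI hopt).1
  have hE₁ : y ≤ x → IsExtremizer n (2 * r + 1) (almostSeesaw r (q₁ + 2) c₁ t₁) := fun h =>
    ⟨hA₁, fun H hH => by
      have := hub H hH
      rwa [hm, max_eq_left h, ← hlx] at this⟩
  have hE₂ : x ≤ y → IsExtremizer n (2 * r + 1) (almostSeesaw r (q₂ + 2) c₂ t₂) := fun h =>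
    ⟨hA₂, fun H hH => by
      have := hub H hH
      rwa [hm, max_eq_right h, ← hly] at this⟩
  have key : ∀ G : SimpleGraph (Fin n), IsExtremizer n (2 * r + 1) G →
      (Nonempty (G ≃g almostSeesaw r (q₁ + 2) c₁ t₁) ∧ y ≤ x) ∨
        (Nonempty (G ≃g almostSeesaw r (q₂ + 2) c₂ t₂) ∧ x ≤ y) := by
    intro G hG
    have hge : m ≤ lambda2 G := by
      have a1 := hG.lambda2_le hA₁
      have a2 := hG.lambda2_le hA₂
      rw [hlx] at a1
      rw [hly] at a2
      rw [hm]
      exact max_le a1 a2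
    obtain ⟨L, hL, hLM, hval, hiso⟩ := (hG.1.lambda2_le hr hn hmI hopt).2 hge
    -- The lengths `L` of an extremizer balance the diametral path exactly at `m`, so they cannot be
    -- worse than a candidate. They are thus one of the candidates, and its root is `m`.
    rcases hD m hmI L hL hLM with h | h
    · left
      rcases h with rfl | h
      · refine ⟨hiso (map_asLengths ht₁), ?_⟩
        by_contra hlt
        push Not at hlt
        have := rootFunction_pos hS₁ ht₁ hx hmI (lt_of_lt_of_le hlt hym)
        linarith
      · linarith
    · right
      rcases h with rfl | h
      · refine ⟨hiso (map_asLengths ht₂), ?_⟩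
        by_contra hlt
        push Not at hlt
        have := rootFunction_pos hS₂ ht₂ hy hmI (lt_of_lt_of_le hlt hxm)
        linarith
      · linarith
  refine ⟨x, y, hx, hy, hlx, hly, fun G hG => ?_, fun h => ⟨hE₁ h.le, fun G hG => ?_⟩,
    fun h => ⟨hE₂ h.le, fun G hG => ?_⟩, fun h => ⟨hE₁ h.ge, hE₂ h.le⟩⟩
  · rcases key G hG with h | h
    · exact Or.inl h.1
    · exact Or.inr h.1
  · rcases key G hG with h' | h'
    · exact h'.1
    · exact absurd h'.2 (not_le.2 h)
  · rcases key G hG with h' | h'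
    · exact absurd h'.2 (not_le.2 h)
    · exact h'.1

/-- The case of two candidates that coincide. -/
theorem isUniqueExtremizer_of_candidate {n M : ℕ} (hn : n = 2 * r + 2 + M)
    (hS : IsSeesawLike r (asLengths r (q + 2) c t) 0 1) (ht : t ≤ q) (hM : M = q * c + t)
    (hD : ∀ z ∈ rootInterval r, ∀ L : Multiset ℕ, (∀ ℓ ∈ L, 1 ≤ ℓ ∧ ℓ ≤ r) → M ≤ L.sum →
      BalancedOrWorse z q c t L) :
    IsUniqueExtremizer n (2 * r + 1) (almostSeesaw r (q + 2) c t) := by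
  obtain ⟨x, y, hx, hy, -, -, honly, -, -, heq⟩ := extremizers_of_two_candidates hn hS ht hM hS ht
    hM fun z hz L hL hLM => Or.inl (hD z hz L hL hLM)
  refine ⟨(heq (hy.2.2 x hx.1 hx.2.1)).1, fun G hG => ?_⟩
  rcases honly G hG with h | h <;> exact h

/-- Too many branches: a balanced choice with short branches is better. -/
theorem balancedOrWorse_of_card_ge {s : ℕ} {x : ℝ} (hsr : s ≤ r) (hs2 : 2 * s ≤ r + 1)
    (hx : x ∈ rootInterval r) (hc : c + 1 ≤ s) (ht : t ≤ q) {L : Multiset ℕ}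
    (hL : ∀ ℓ ∈ L, 1 ≤ ℓ ∧ ℓ ≤ r) (hsum : q * c + t ≤ L.sum) (hcard : q ≤ L.card) :
    BalancedOrWorse x q c t L := by
  refine balanced_optimal (by omega) hx (by omega) ht hL hsum ?_
  rcases hcard.eq_or_lt with h | h
  · exact Or.inl h.symm
  · right
    have h1 : (q : ℝ) < L.card := by exact_mod_cast h
    -- From `c ≤ s - 1` follows `2c + 1 ≤ 2s - 1 ≤ r`: the chord has a positive intercept.
    have h2 : (2 * (c : ℝ) + 1) ≤ r := by exact_mod_cast (by omega : 2 * c + 1 ≤ r)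
    have h3 := one_sub_pos_of_mem (by omega) hx le_rfl
    have h4 := pos_of_mem hx
    refine mul_pos (by linarith) ?_
    nlinarith

/-- Too few branches: a balanced choice with long branches is better. -/
theorem balancedOrWorse_of_card_le {s : ℕ} {x : ℝ} (hs2 : r ≤ 2 * s)
    (hx : x ∈ rootInterval r) (hc : s ≤ c) (hcr : c + 1 ≤ r) (ht : t ≤ q) {L : Multiset ℕ}
    (hL : ∀ ℓ ∈ L, 1 ≤ ℓ ∧ ℓ ≤ r) (hsum : q * c + t ≤ L.sum) (hcard : L.card ≤ q) :
    BalancedOrWorse x q c t L := by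
  refine balanced_optimal (by omega) hx hcr ht hL hsum ?_
  rcases hcard.eq_or_lt with h | h
  · exact Or.inl h
  · right
    have h1 : (L.card : ℝ) < q := by exact_mod_cast h
    -- From `s ≤ c` follows `2c + 1 ≥ r + 1`: the chord has a negative intercept.
    have h2 : ((r : ℝ) + 1) ≤ 2 * c + 1 := by exact_mod_cast (by omega : r + 1 ≤ 2 * c + 1)
    have h3 := one_sub_succ_neg hx
    have h4 := pos_of_mem hx
    refine mul_pos_of_neg_of_neg (by linarith) ?_
    nlinarith

/-- Equal branches may be seen at either end of a chord. This permits comparison with the chord on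
their left, in particular when the one on their right leaves the range `ℓ ≤ r`. -/
theorem balanced_succ (q c : ℕ) : balanced q c q = balanced q (c + 1) 0 := by
  simp [balanced]

theorem balancedOrWorse_succ {x : ℝ} {L : Multiset ℕ} (h : BalancedOrWorse x q c q L) :
    BalancedOrWorse x q (c + 1) 0 L := by
  unfold BalancedOrWorse at h ⊢
  rwa [← balanced_succ]

/-- The path with `2 r + 2` vertices, rooted at a central vertex. -/
theorem pathGraph_isRooted (r : ℕ) :
    IsRooted (SimpleGraph.pathGraph (2 * r + 2)) ⟨r, by omega⟩
      (fun i => ⟨if (i : ℕ) < r then i + 1 else if (i : ℕ) = r then r else i - 1, by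
        have := i.2
        split_ifs <;> omega⟩)
      (fun i => (i - r) + (r - i)) where
  adj_iff := by
    intro x y
    rw [SimpleGraph.pathGraph_adj]
    simp only [ne_eq, Fin.ext_iff]
    split_ifs <;> omega
  parent_root := by simp
  depth_root := by simp
  depth_parent := by
    intro x hx
    simp only [ne_eq, Fin.ext_iff] at hx ⊢
    split_ifs <;> omega

/-- The path with `2 r + 2` vertices is the spider with two branches. -/
theorem nonempty_iso_pathGraph (r c : ℕ) :
    Nonempty (almostSeesaw r 2 c 0 ≃g SimpleGraph.pathGraph (2 * r + 2)) := by
  have h0 : asLengths r 2 c 0 0 = r + 1 := by simp [asLengths]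
  have h1 : asLengths r 2 c 0 1 = r := by simp [asLengths]
  have hlt : ∀ i : Fin 2, i = 0 ∨ i = 1 := by decide
  -- The centre goes to position `r`; the long branch runs to the right up to `2r + 1` and the short
  -- one to the left down to `0`.
  let f : Option (Σ i : Fin 2, Fin (asLengths r 2 c 0 i)) → ℕ := fun z =>
    z.elim r fun w => if w.1 = 0 then r + 1 + w.2 else r - 1 - w.2
  have hf : ∀ z, f z < 2 * r + 2 := by
    rintro (_ | ⟨i, j, hj⟩)
    · simp only [f, Option.elim_none]
      omega
    · rcases hlt i with rfl | rfl
      · rw [h0] at hj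
        simp only [f, Option.elim_some, if_true]
        omega
      · simp only [f, Option.elim_some, one_ne_zero, if_false]
        omega
  have hinj : Function.Injective f := by
    rintro (_ | ⟨i, j, hj⟩) (_ | ⟨i', j', hj'⟩) h
    · rfl
    · rcases hlt i' with rfl | rfl
      · simp only [f, Option.elim_some, Option.elim_none, if_true] at h
        omega
      · rw [h1] at hj'
        simp only [f, Option.elim_some, Option.elim_none, one_ne_zero, if_false] at h
        omega
    · rcases hlt i with rfl | rfl
      · simp only [f, Option.elim_some, Option.elim_none, if_true] at h
        omega
      · rw [h1] at hj
        simp only [f, Option.elim_some, Option.elim_none, one_ne_zero, if_false] at h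
        omega
    · rcases hlt i with rfl | rfl <;> rcases hlt i' with rfl | rfl
      · simp only [f, Option.elim_some, if_true] at h
        have : j = j' := by omega
        subst this
        rfl
      · rw [h1] at hj'
        simp only [f, Option.elim_some, if_true, one_ne_zero, if_false] at h
        omega
      · rw [h1] at hj
        simp only [f, Option.elim_some, if_true, one_ne_zero, if_false] at h
        omega
      · rw [h1] at hj hj'
        simp only [f, Option.elim_some, one_ne_zero, if_false] at h
        have : j = j' := by omega
        subst this
        rfl
  let e : Option (Σ i : Fin 2, Fin (asLengths r 2 c 0 i)) → Fin (2 * r + 2) :=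
    fun z => ⟨f z, hf z⟩
  have he : Function.Bijective e := by
    rw [Fintype.bijective_iff_injective_and_card]
    refine ⟨fun z w h => hinj (congrArg Fin.val h), ?_⟩
    rw [Fintype.card_option, Fintype.card_sigma]
    simp only [Fintype.card_fin, Fin.sum_univ_two, h0, h1]
    omega
  refine (spider_isRooted _).nonempty_iso (pathGraph_isRooted r) (Equiv.ofBijective e he) rfl ?_
  rintro (_ | ⟨i, _ | j, hj⟩) hx
  · exact absurd rfl hx
  · rcases hlt i with rfl | rfl
    · simp only [Equiv.ofBijective_apply, e, f, spiderParent, Option.elim_some, Option.elim_none,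
        if_true, Fin.mk.injEq]
      split_ifs <;> omega
    · rw [h1] at hj
      simp only [Equiv.ofBijective_apply, e, f, spiderParent, Option.elim_some, Option.elim_none,
        one_ne_zero, if_false, Fin.mk.injEq]
      split_ifs <;> omega
  · rcases hlt i with rfl | rfl
    · simp only [Equiv.ofBijective_apply, e, f, spiderParent, Option.elim_some, if_true,
        Fin.mk.injEq]
      split_ifs <;> omega
    · rw [h1] at hj
      simp only [Equiv.ofBijective_apply, e, f, spiderParent, Option.elim_some, one_ne_zero,
        if_false, Fin.mk.injEq]
      split_ifs <;> omega

end Candidates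

/-! ### The threshold polynomial and the constant `κ`. -/

section Threshold

variable {r s t : ℕ} {x y : ℝ}

/-- The threshold polynomial decides which of the two candidates is smaller at `x`. -/
theorem rootFunction_sub (hr : 1 ≤ r) (hs : 1 ≤ s) (hsr : s + 1 ≤ r) {k : ℕ} (hk : s ≤ k)
    (hx : x ∈ rootInterval r) :
    ∃ D : ℝ, 0 < D ∧ rootFunction r k s t x
      - rootFunction r (k + 1) (s - 1) (k + t + 1 - s) x = - thresholdPoly s t x / D := by
  have h1 := one_sub_pos_of_mem hr hx (by omega : s - 1 ≤ r)
  have h2 := one_sub_pos_of_mem hr hx (by omega : s ≤ r)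
  have h3 := one_sub_pos_of_mem hr hx hsr
  rw [Nat.cast_sub hs, Nat.cast_one] at h1
  rw [cast_succ_mul] at h3
  refine ⟨(1 - ((s : ℝ) - 1) * x) * (1 - s * x) * (1 - ((s : ℝ) + 1) * x), by positivity, ?_⟩
  -- The terms in `k` cancel, which is why the polynomial depends on `s` and `t` only.
  have key : ∀ A B C : ℝ, A ≠ 0 → B ≠ 0 → C ≠ 0 → A = 1 - ((s : ℝ) - 1) * x → B = 1 - s * x →
      C = 1 - ((s : ℝ) + 1) * x →
      (t : ℝ) / C + ((k : ℝ) - t) / B - (((k : ℝ) + t + 1 - s) / B + ((s : ℝ) - t) / A)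
        = - thresholdPoly s t x / (A * B * C) := by
    intro A B C hA hB hC eA eB eC
    unfold thresholdPoly
    field_simp
    rw [eA, eB, eC]
    ring
  rw [← key _ _ _ h1.ne' h2.ne' h3.ne' rfl rfl rfl]
  unfold rootFunction
  rw [Nat.cast_sub (by omega : s ≤ k + t + 1), Nat.cast_sub hs]
  push_cast
  rw [sub_add_cancel]
  ring

/-- In the variable `m = 1/x`, which ranges over `(r, r+1)`, the bracket is `(m - s)(m - 2s) + (s -
2t - 1)`. The sign of `P_{s,t}` is read off from this form. -/
theorem thresholdPoly_eq (s t : ℕ) {x : ℝ} (hx : x ≠ 0) :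
    thresholdPoly s t x = x ^ 2 * ((1 / x) ^ 2 - 3 * s * (1 / x)
      + (2 * (s : ℝ) ^ 2 + s - 2 * t - 1)) := by
  unfold thresholdPoly
  field_simp

theorem inv_mem_of_mem (hr : 1 ≤ r) (hx : x ∈ rootInterval r) :
    (r : ℝ) < 1 / x ∧ 1 / x < (r : ℝ) + 1 := by
  have h0 := pos_of_mem hx
  have h1 := one_sub_pos_of_mem hr hx le_rfl
  have h2 := one_sub_succ_neg hx
  constructor
  · rw [lt_div_iff₀ h0]; linarith
  · rw [div_lt_iff₀ h0]; linarith

theorem mem_of_inv_mem (hr : 1 ≤ r) {m : ℝ} (h1 : (r : ℝ) < m) (h2 : m < (r : ℝ) + 1) :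
    1 / m ∈ rootInterval r := by
  have hr' : (0 : ℝ) < r := by exact_mod_cast hr
  exact ⟨one_div_lt_one_div_of_lt (hr'.trans h1) h2, one_div_lt_one_div_of_lt hr' h1⟩

/-- To the left of `y`, the threshold polynomial is larger, up to positive factors. -/
theorem thresholdPoly_compare (hr : 1 ≤ r) (hsr : 3 * s ≤ 2 * r) (hx : x ∈ rootInterval r)
    (hy : y ∈ rootInterval r) (hxy : x < y) :
    thresholdPoly s t y / y ^ 2 < thresholdPoly s t x / x ^ 2 := by
  have hx0 := pos_of_mem hx
  have hy0 := pos_of_mem hy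
  rw [thresholdPoly_eq s t hx0.ne', thresholdPoly_eq s t hy0.ne',
    mul_div_cancel_left₀ _ (by positivity), mul_div_cancel_left₀ _ (by positivity)]
  have h1 := inv_mem_of_mem hr hx
  have h2 := inv_mem_of_mem hr hy
  have h3 : 1 / y < 1 / x := one_div_lt_one_div_of_lt hx0 hxy
  -- The vertex `3s/2` of the quadratic in `1/x` is at most `r`, so the quadratic increases on the
  -- range of `1/x`.
  have h4 : 3 * (s : ℝ) ≤ 2 * r := by exact_mod_cast hsr
  nlinarith

/-- Here `1/x > 2s`, so the product `(m - s)(m - 2s)` is positive and `s - 2t - 1` is nonnegative.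
-/
theorem thresholdPoly_pos (hr : r = 2 * s) (hs : 1 ≤ s) (ht : 2 * t + 1 ≤ s)
    (hx : x ∈ rootInterval r) : 0 < thresholdPoly s t x := by
  have hx0 := pos_of_mem hx
  obtain ⟨h1, -⟩ := inv_mem_of_mem (by omega) hx
  rw [thresholdPoly_eq s t hx0.ne']
  have h2 : (r : ℝ) = 2 * s := by exact_mod_cast hr
  have h3 : 2 * (t : ℝ) + 1 ≤ s := by exact_mod_cast ht
  have h4 : (1 : ℝ) ≤ s := by exact_mod_cast hs
  rw [h2] at h1
  have : 0 < (1 / x) ^ 2 - 3 * s * (1 / x) + (2 * (s : ℝ) ^ 2 + s - 2 * t - 1) := by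
    nlinarith [mul_pos (by linarith : 0 < 1 / x - 2 * (s : ℝ)) (by linarith : 0 < 1 / x - s)]
  positivity

/-- Here `s < 1/x < 2s`, so the product is negative and `s - 2t - 1` is at most zero. -/
theorem thresholdPoly_neg (hr : r + 1 = 2 * s) (hs : 2 ≤ s) (ht : s ≤ 2 * t + 1) (ht1 : 1 ≤ t)
    (hx : x ∈ rootInterval r) : thresholdPoly s t x < 0 := by
  have hx0 := pos_of_mem hx
  obtain ⟨h1, h1'⟩ := inv_mem_of_mem (by omega) hx
  rw [thresholdPoly_eq s t hx0.ne']
  have h2 : (r : ℝ) + 1 = 2 * s := by exact_mod_cast hr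
  have h3 : (s : ℝ) ≤ 2 * t + 1 := by exact_mod_cast ht
  have h4 : (2 : ℝ) ≤ s := by exact_mod_cast hs
  have h5 : (1 : ℝ) ≤ t := by exact_mod_cast ht1
  have : (1 / x) ^ 2 - 3 * s * (1 / x) + (2 * (s : ℝ) ^ 2 + s - 2 * t - 1) < 0 := by
    nlinarith [mul_pos (by linarith : 0 < 2 * (s : ℝ) - 1 / x) (by linarith : 0 < 1 / x - s)]
  have h6 : 0 < x ^ 2 := by positivity
  nlinarith

/-- The quadratic in `m = 1/x` changes sign between `r` and `r + 1`. For `r = 2s` its end values are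
`s - 2t - 1` and `2s - 2t`; for `r = 2s - 1` they are `-2t` and `s - 2t - 1`. -/
theorem exists_root_thresholdPoly (hs : 2 ≤ s) (ht1 : 1 ≤ t) (hts : t + 1 ≤ s)
    (h : (r = 2 * s ∧ s ≤ 2 * t) ∨ (r + 1 = 2 * s ∧ 2 * t + 2 ≤ s)) :
    ∃ ζ, IsUniqueRoot (thresholdPoly s t) (rootInterval r) ζ := by
  have hr : 1 ≤ r := by omega
  have hsr : 3 * s ≤ 2 * r := by omega
  have h4 : (2 : ℝ) ≤ s := by exact_mod_cast hs
  have h5 : (1 : ℝ) ≤ t := by exact_mod_cast ht1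
  have h6 : (t : ℝ) + 1 ≤ s := by exact_mod_cast hts
  obtain ⟨m, hm, hm0⟩ : ∃ m ∈ Set.Ioo (r : ℝ) ((r : ℝ) + 1),
      m ^ 2 - 3 * s * m + (2 * (s : ℝ) ^ 2 + s - 2 * t - 1) = 0 := by
    have hcont : ContinuousOn (fun m : ℝ => m ^ 2 - 3 * s * m
        + (2 * (s : ℝ) ^ 2 + s - 2 * t - 1)) (Set.Icc (r : ℝ) ((r : ℝ) + 1)) := by fun_prop
    refine intermediate_value_Ioo (by linarith) hcont ⟨?_, ?_⟩
    · rcases h with ⟨h1, h2⟩ | ⟨h1, h2⟩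
      · have e1 : (r : ℝ) = 2 * s := by exact_mod_cast h1
        have e2 : (s : ℝ) ≤ 2 * t := by exact_mod_cast h2
        simp only [e1]
        nlinarith
      · have e1 : (r : ℝ) = 2 * s - 1 := by
          have : (r : ℝ) + 1 = 2 * s := by exact_mod_cast h1
          linarith
        simp only [e1]
        nlinarith
    · rcases h with ⟨h1, h2⟩ | ⟨h1, h2⟩
      · have e1 : (r : ℝ) = 2 * s := by exact_mod_cast h1
        simp only [e1]
        nlinarith
      · have e1 : (r : ℝ) = 2 * s - 1 := by
          have : (r : ℝ) + 1 = 2 * s := by exact_mod_cast h1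
          linarith
        have e2 : 2 * (t : ℝ) + 2 ≤ s := by exact_mod_cast h2
        simp only [e1]
        nlinarith
  have hζ := mem_of_inv_mem hr hm.1 hm.2
  have hmpos : 0 < m := lt_of_le_of_lt (Nat.cast_nonneg r) hm.1
  have hroot : thresholdPoly s t (1 / m) = 0 := by
    rw [thresholdPoly_eq s t (by positivity), one_div_one_div, hm0, mul_zero]
  refine ⟨1 / m, hζ, hroot, fun y hy hy0 => ?_⟩
  rcases lt_trichotomy y (1 / m) with hlt | heq | hlt
  · have := thresholdPoly_compare (t := t) hr hsr hy hζ hlt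
    rw [hroot, hy0, zero_div, zero_div] at this
    exact absurd this (lt_irrefl _)
  · exact heq
  · have := thresholdPoly_compare (t := t) hr hsr hζ hy hlt
    rw [hroot, hy0, zero_div, zero_div] at this
    exact absurd this (lt_irrefl _)

/-- The sign of `k - κ` is the sign at `z` of the root function of the second candidate. -/
theorem sub_kappa (hr : 1 ≤ r) (hs : 1 ≤ s) (hsr : s ≤ r) {k : ℕ} (hk : s ≤ k) {z : ℝ}
    (hz : z ∈ rootInterval r) :
    (k : ℝ) - kappa r s t z
      = (1 - s * z) * rootFunction r (k + 1) (s - 1) (k + t + 1 - s) z := by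
  have h2 := one_sub_pos_of_mem hr hz hsr
  unfold kappa rootFunction
  rw [Nat.cast_sub (by omega : s ≤ k + t + 1), Nat.cast_sub hs]
  push_cast
  rw [sub_add_cancel]
  generalize 1 / (1 - ((r : ℝ) + 1) * z) = a
  generalize 1 / (1 - (r : ℝ) * z) = b
  generalize 1 - ((s : ℝ) - 1) * z = c
  field_simp
  ring

end Threshold

/-! ### The arithmetic of `M = ks + t` and the comparison of the two candidates. -/

section Cases

variable {r s k t M : ℕ}

/-- The quotient is `s + t / k`. For `s ≤ k` the second term vanishes; for `s ≥ 3` the bound `t / k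
≤ t / 2` leaves enough room below `r ≥ 2s - 1`. -/
theorem div_add_one_le (hM : M = k * s + t) (hk : 2 ≤ k) (ht : t + 1 ≤ s) (hsr : s + 1 ≤ r)
    (hs2 : 2 * s ≤ r + 1) (hks : s ≤ k ∨ 3 ≤ s) : s ≤ M / k ∧ M / k + 1 ≤ r := by
  subst hM
  have h1 : (k * s + t) / k = s + t / k := by
    rw [Nat.mul_add_div (by omega)]
  rw [h1]
  refine ⟨Nat.le_add_right _ _, ?_⟩
  rcases hks with h | h
  · rw [Nat.div_eq_of_lt (by omega)]
    omega
  · have : t / k ≤ t / 2 := Nat.div_le_div_left hk (by norm_num)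
    omega

theorem div_succ_bounds (hM : M = k * s + t) (hk : 1 ≤ k) (ht : t + 1 ≤ s) (hs : 2 ≤ s) :
    1 ≤ M / (k + 1) ∧ M / (k + 1) + 1 ≤ s := by
  subst hM
  constructor
  · rw [Nat.one_le_div_iff (by omega)]
    nlinarith
  · rw [Nat.succ_le_iff, Nat.div_lt_iff_lt_mul (by omega)]
    nlinarith

theorem isSeesawLike_div (hM : M = k * s + t) (hk : 1 ≤ k) (ht1 : 1 ≤ t) (ht : t + 1 ≤ s)
    (hsr : s + 1 ≤ r) (hs2 : 2 * s ≤ r + 1) :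
    IsSeesawLike r (asLengths r (k + 2) (M / k) (M % k)) 0 1 := by
  rcases hk.eq_or_lt with h1 | h1
  · subst h1
    rw [Nat.div_one, Nat.mod_one]
    exact asLengths_isSeesawLike (by omega) (Or.inr (by omega)) (Or.inl rfl)
  · have := div_add_one_le hM h1 ht hsr hs2 (by omega)
    exact asLengths_isSeesawLike (by omega) (Or.inr (by omega)) (Or.inr (by omega))

theorem isSeesawLike_div_succ (hM : M = k * s + t) (hk : 1 ≤ k) (ht1 : 1 ≤ t) (ht : t + 1 ≤ s)
    (hsr : s + 1 ≤ r) :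
    IsSeesawLike r (asLengths r (k + 1 + 2) (M / (k + 1)) (M % (k + 1))) 0 1 := by
  have := div_succ_bounds hM hk ht (by omega)
  exact asLengths_isSeesawLike (by omega) (Or.inr (by omega)) (Or.inr (by omega))

/-- The optimal numbers of extra branches are the two integers next to `M / s`. -/
theorem balancedOrWorse_or (hM : M = k * s + t) (hk : 1 ≤ k) (ht1 : 1 ≤ t) (ht : t + 1 ≤ s)
    (hsr : s + 1 ≤ r) (hs2 : 2 * s ≤ r + 1) (hrs : r ≤ 2 * s) {z : ℝ} (hz : z ∈ rootInterval r)
    {L : Multiset ℕ} (hL : ∀ ℓ ∈ L, 1 ≤ ℓ ∧ ℓ ≤ r) (hLM : M ≤ L.sum) :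
    BalancedOrWorse z k (M / k) (M % k) L ∨
      BalancedOrWorse z (k + 1) (M / (k + 1)) (M % (k + 1)) L := by
  rcases Nat.lt_or_ge k L.card with hcard | hcard
  · right
    have := div_succ_bounds hM hk ht (by omega)
    refine balancedOrWorse_of_card_ge (by omega) hs2 hz this.2
      (Nat.mod_lt M (by omega)).le hL ?_ hcard
    rwa [Nat.div_add_mod]
  · left
    rcases hk.eq_or_lt with h1 | h1
    · subst h1
      -- A single branch of length `M = s + t` may have length exactly `r`, so the chord from `M -
      -- 1` to `M` is used; its left end is still at least `s`.
      obtain ⟨c, rfl⟩ : ∃ c, M = c + 1 := ⟨M - 1, by omega⟩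
      rw [Nat.div_one, Nat.mod_one]
      exact balancedOrWorse_succ (balancedOrWorse_of_card_le hrs hz (by omega) (by omega) le_rfl
        hL (by omega) hcard)
    · have := div_add_one_le hM h1 ht hsr hs2 (by omega)
      refine balancedOrWorse_of_card_le hrs hz this.1 this.2 (Nat.mod_lt M (by omega)).le hL ?_
        hcard
      rwa [Nat.div_add_mod]

theorem qMinus_eq (hM : M = k * s + t) (hk : 1 ≤ k) (ht : t + 1 ≤ s) : qMinus s M = k := by
  unfold qMinus
  rw [hM, mul_comm, Nat.mul_add_div (by omega), Nat.div_eq_of_lt (by omega)]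
  omega

theorem qPlus_eq (hM : M = k * s + t) (ht1 : 1 ≤ t) (ht : t ≤ s) : qPlus s M = k + 1 := by
  unfold qPlus
  have hs : (0 : ℚ) < s := by exact_mod_cast (by omega : 0 < s)
  have h1 : (1 : ℚ) ≤ t := by exact_mod_cast ht1
  have h2 : (t : ℚ) ≤ s := by exact_mod_cast ht
  rw [Nat.ceil_eq_iff (by omega)]
  subst hM
  push_cast
  constructor
  · rw [lt_div_iff₀ hs]
    linarith
  · rw [div_le_iff₀ hs]
    nlinarith

theorem asLengths_three (r M : ℕ) : asLengths r 3 M 0 = ![r + 1, r, M] := by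
  ext i
  fin_cases i <;> simp [asLengths]

/-- The comparison of the two candidates when the number of branches is large. -/
theorem extremizers_of_large_quotient {n : ℕ} (hn : n = 2 * r + 2 + M) (hM : M = k * s + t)
    (ht1 : 1 ≤ t) (ht : t + 1 ≤ s) (hsk : s ≤ k) (hsr : s + 1 ≤ r) (hs2 : 2 * s ≤ r + 1)
    (hrs : r ≤ 2 * s) :
    OnlyCandidates n (2 * r + 1) (treeA r s k t) (treeB r s k t) ∧
      (r = 2 * s → 2 * t + 1 ≤ s → IsUniqueExtremizer n (2 * r + 1) (treeA r s k t)) ∧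
      (r + 1 = 2 * s → s ≤ 2 * t + 1 → IsUniqueExtremizer n (2 * r + 1) (treeB r s k t)) ∧
      ((r = 2 * s ∧ s ≤ 2 * t) ∨ (r + 1 = 2 * s ∧ 2 * t + 2 ≤ s) →
        ∃ ζ : ℝ, IsUniqueRoot (thresholdPoly s t) (rootInterval r) ζ ∧
          (kappa r s t ζ < (k : ℝ) →
            IsUniqueExtremizer n (2 * r + 1) (treeA r s k t)) ∧
          ((k : ℝ) < kappa r s t ζ →
            IsUniqueExtremizer n (2 * r + 1) (treeB r s k t)) ∧
          ((k : ℝ) = kappa r s t ζ →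
            IsExtremizer n (2 * r + 1) (treeA r s k t) ∧
            IsExtremizer n (2 * r + 1) (treeB r s k t))) := by
  have hk : 1 ≤ k := by omega
  have hr : 1 ≤ r := by omega
  have hA := isSeesawLike_div hM hk ht1 ht hsr hs2
  have hB := isSeesawLike_div_succ hM hk ht1 ht hsr
  have hD := fun z (hz : z ∈ rootInterval r) (L : Multiset ℕ)
    (hL : ∀ ℓ ∈ L, 1 ≤ ℓ ∧ ℓ ≤ r) (hLM : M ≤ L.sum) =>
    balancedOrWorse_or hM hk ht1 ht hsr hs2 hrs hz hL hLM
  have e1 : M / k = s ∧ M % k = t := by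
    rw [Nat.div_mod_unique (by omega)]
    exact ⟨by rw [hM]; ring, by omega⟩
  have e2 : M / (k + 1) = s - 1 ∧ M % (k + 1) = k + t + 1 - s := by
    rw [Nat.div_mod_unique (by omega)]
    refine ⟨?_, by omega⟩
    obtain ⟨s', rfl⟩ : ∃ s', s = s' + 1 := ⟨s - 1, by omega⟩
    have : k + t + 1 - (s' + 1) + s' = k + t := by omega
    rw [hM, Nat.add_sub_cancel]
    nlinarith
  rw [e1.1, e1.2] at hA
  rw [e2.1, e2.2] at hB
  rw [e1.1, e1.2, e2.1, e2.2] at hD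
  have htA : t ≤ k := by omega
  have htB : k + t + 1 - s ≤ k + 1 := by omega
  obtain ⟨x, y, hx, hy, -, -, honly, hxy, hyx, heq⟩ := extremizers_of_two_candidates hn hA htA hM
    hB htB (by rw [← e2.1, ← e2.2, Nat.div_add_mod]) hD
  have hsub : ∀ z ∈ rootInterval r, ∃ D : ℝ, 0 < D ∧ rootFunction r k s t z
      - rootFunction r (k + 1) (s - 1) (k + t + 1 - s) z = - thresholdPoly s t z / D :=
    fun z hz => rootFunction_sub hr (by omega) hsr hsk hz
  -- A positive threshold polynomial at the root `y` of `B` makes the root function of `A` negative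
  -- there. As that function increases, its root lies further right.
  have hA_wins : 0 < thresholdPoly s t y → y < x := by
    intro hP
    obtain ⟨D, hD0, hD1⟩ := hsub y hy.1
    rw [hy.2.1, sub_zero] at hD1
    have hneg : rootFunction r k s t y < 0 := by
      rw [hD1]
      exact div_neg_of_neg_of_pos (by linarith) hD0
    by_contra hle
    push Not at hle
    rcases hle.eq_or_lt with h | h
    · rw [← h, hx.2.1] at hneg
      exact lt_irrefl _ hneg
    · exact (rootFunction_pos hA htA hx hy.1 h).not_gt hneg
  have hB_wins : thresholdPoly s t y < 0 → x < y := by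
    intro hP
    obtain ⟨D, hD0, hD1⟩ := hsub y hy.1
    rw [hy.2.1, sub_zero] at hD1
    have hpos : 0 < rootFunction r k s t y := by
      rw [hD1]
      exact div_pos (by linarith) hD0
    by_contra hle
    push Not at hle
    rcases hle.eq_or_lt with h | h
    · rw [h, hx.2.1] at hpos
      exact lt_irrefl _ hpos
    · exact (rootFunction_neg hA htA hx hy.1 h).not_gt hpos
  refine ⟨honly, fun h1 h2 => ?_, fun h1 h2 => ?_, fun h => ?_⟩
  · exact hxy (hA_wins (thresholdPoly_pos h1 (by omega) h2 hy.1))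
  · exact hyx (hB_wins (thresholdPoly_neg h1 (by omega) h2 ht1 hy.1))
  · obtain ⟨ζ, hζ⟩ := exists_root_thresholdPoly (by omega) ht1 ht h
    have hκ := sub_kappa (t := t) hr (by omega : 1 ≤ s) (by omega) hsk hζ.1
    have hpos := one_sub_pos_of_mem hr hζ.1 (by omega : s ≤ r)
    have hcmp : ∀ {a b}, a ∈ rootInterval r → b ∈ rootInterval r → a < b →
        thresholdPoly s t b / b ^ 2 < thresholdPoly s t a / a ^ 2 := fun ha hb hab =>
      thresholdPoly_compare hr (by omega) ha hb hab
    -- The sign of `k - κ` tells on which side of `ζ` the root `y` of `B` lies. This gives the sign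
    -- of the threshold polynomial at `y`, hence the winner. If `k = κ`, both root functions vanish
    -- at `ζ`.
    refine ⟨ζ, hζ, fun hk1 => ?_, fun hk1 => ?_, fun hk1 => ?_⟩
    · refine hxy (hA_wins ?_)
      have h1 : 0 < rootFunction r (k + 1) (s - 1) (k + t + 1 - s) ζ := by
        by_contra hle
        push Not at hle
        nlinarith
      have h2 : y < ζ := by
        by_contra hle
        push Not at hle
        rcases hle.eq_or_lt with h3 | h3
        · rw [h3, hy.2.1] at h1
          exact lt_irrefl _ h1
        · exact (rootFunction_neg hB htB hy hζ.1 h3).not_gt h1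
      have h3 := hcmp hy.1 hζ.1 h2
      rw [hζ.2.1, zero_div] at h3
      have h4 := pos_of_mem hy.1
      exact (div_pos_iff_of_pos_right (by positivity)).1 h3
    · refine hyx (hB_wins ?_)
      have h1 : rootFunction r (k + 1) (s - 1) (k + t + 1 - s) ζ < 0 := by
        by_contra hle
        push Not at hle
        nlinarith
      have h2 : ζ < y := by
        by_contra hle
        push Not at hle
        rcases hle.eq_or_lt with h3 | h3
        · rw [← h3, hy.2.1] at h1
          exact lt_irrefl _ h1
        · exact (rootFunction_pos hB htB hy hζ.1 h3).not_gt h1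
      have h3 := hcmp hζ.1 hy.1 h2
      rw [hζ.2.1, zero_div] at h3
      have h4 := pos_of_mem hy.1
      by_contra hle
      push Not at hle
      exact h3.not_ge (div_nonneg hle (by positivity))
    · refine heq ?_
      rw [hk1, sub_self] at hκ
      have h1 := (mul_eq_zero.1 hκ.symm).resolve_left hpos.ne'
      have h2 := hy.2.2 ζ hζ.1 h1
      obtain ⟨D, hD0, hD1⟩ := hsub ζ hζ.1
      rw [h1, hζ.2.1, sub_zero, neg_zero, zero_div] at hD1
      rw [← h2, hx.2.2 ζ hζ.1 hD1]

end Cases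

end SteklovTree

/-! ### The theorem, by ranges of `M`. -/

theorem theorem4p3 (r s n M : ℕ) (hr : 2 ≤ r) (hs : s = ⌈(r : ℚ) / 2⌉₊)
    (hn : 2 * r + 2 ≤ n) (hM : M = n - (2 * r + 2)) :
    -- order 2 r + 2
    (M = 0 → IsUniqueExtremizer n (2 * r + 1) (SimpleGraph.pathGraph (2 * r + 2))) ∧
    -- few extra vertices
    (1 ≤ M → M < s →
      qMinus s M = 1 ∧ qPlus s M = 1 ∧
      IsUniqueExtremizer n (2 * r + 1) (almostSeesaw r 3 M 0) ∧
      Nonempty (almostSeesaw r 3 M 0 ≃g spider ![r + 1, r, M])) ∧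
    -- s divides M
    (1 ≤ M → s ∣ M →
      qMinus s M = M / s ∧ qPlus s M = M / s ∧
      IsUniqueExtremizer n (2 * r + 1) (almostSeesaw r (M / s + 2) s 0)) ∧
    -- M not divisible by s, large quotient
    (∀ k t : ℕ, M = k * s + t → 1 ≤ t → t + 1 ≤ s → s ≤ k →
      OnlyCandidates n (2 * r + 1) (treeA r s k t) (treeB r s k t) ∧
      (r = 2 * s → 2 * t + 1 ≤ s → IsUniqueExtremizer n (2 * r + 1) (treeA r s k t)) ∧
      (r + 1 = 2 * s → s ≤ 2 * t + 1 → IsUniqueExtremizer n (2 * r + 1) (treeB r s k t)) ∧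
      ((r = 2 * s ∧ s ≤ 2 * t) ∨ (r + 1 = 2 * s ∧ 2 * t + 2 ≤ s) →
        ∃ ζ : ℝ, IsUniqueRoot (thresholdPoly s t) (rootInterval r) ζ ∧
          (kappa r s t ζ < (k : ℝ) →
            IsUniqueExtremizer n (2 * r + 1) (treeA r s k t)) ∧
          ((k : ℝ) < kappa r s t ζ →
            IsUniqueExtremizer n (2 * r + 1) (treeB r s k t)) ∧
          ((k : ℝ) = kappa r s t ζ →
            IsExtremizer n (2 * r + 1) (treeA r s k t) ∧
            IsExtremizer n (2 * r + 1) (treeB r s k t)))) ∧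
    -- the remaining orders
    (∀ k t : ℕ, M = k * s + t → 1 ≤ k → k + 1 ≤ s → 1 ≤ t → t + 1 ≤ s →
      OnlyCandidates n (2 * r + 1) (candidate r M (qMinus s M)) (candidate r M (qPlus s M)) ∧
      ∃ x y : ℝ,
        IsUniqueRoot (rootFunction r (qMinus s M) (M / qMinus s M) (M % qMinus s M))
          (rootInterval r) x ∧
        IsUniqueRoot (rootFunction r (qPlus s M) (M / qPlus s M) (M % qPlus s M))
          (rootInterval r) y ∧
        lambda2 (candidate r M (qMinus s M)) = x ∧
        lambda2 (candidate r M (qPlus s M)) = y ∧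
        (y < x → IsUniqueExtremizer n (2 * r + 1) (candidate r M (qMinus s M))) ∧
        (x < y → IsUniqueExtremizer n (2 * r + 1) (candidate r M (qPlus s M))) ∧
        (x = y → IsExtremizer n (2 * r + 1) (candidate r M (qMinus s M)) ∧
          IsExtremizer n (2 * r + 1) (candidate r M (qPlus s M)))) ∧
    {m : ℕ | ∃ k t : ℕ, m = 2 * r + 2 + (k * s + t) ∧
      1 ≤ k ∧ k + 1 ≤ s ∧ 1 ≤ t ∧ t + 1 ≤ s}.Finite := by
  have hs2 : 2 * s ≤ r + 1 ∧ r ≤ 2 * s := by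
    have h1 : (r : ℚ) / 2 ≤ s := hs ▸ Nat.le_ceil _
    have h2 : (s : ℚ) < r / 2 + 1 := hs ▸ Nat.ceil_lt_add_one (by positivity)
    have h3 : (r : ℚ) ≤ 2 * s := by linarith
    have h4 : (2 : ℚ) * s < r + 2 := by linarith
    have h5 : r ≤ 2 * s := by exact_mod_cast h3
    have h6 : 2 * s < r + 2 := by exact_mod_cast h4
    omega
  have hn' : n = 2 * r + 2 + M := by omega
  have hr1 : 1 ≤ r := by omega
  refine ⟨fun hM0 => ?_, fun hM1 hMs => ?_, fun hM1 hsM => ?_, fun k t hkt ht1 hts hsk => ?_,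
    fun k t hkt hk1 hks ht1 hts => ?_, ?_⟩
  · subst hM0
    obtain ⟨e⟩ := nonempty_iso_pathGraph r 0
    have hS : IsSeesawLike r (asLengths r (0 + 2) 0 0) 0 1 :=
      asLengths_isSeesawLike hr1 (Or.inl rfl) (Or.inl rfl)
    refine IsUniqueExtremizer.of_iso e
      (isUniqueExtremizer_of_candidate (q := 0) hn' hS le_rfl (by simp) ?_)
    intro z hz L hL _
    -- No extra branch is compared with the chord from `0` to `1`; the parameter `1` replaces the
    -- `s` of the theorem to allow `c = 0`.
    exact balancedOrWorse_of_card_ge (s := 1) hr1 (by omega) hz le_rfl le_rfl hL (by simp)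
      (Nat.zero_le _)
  · have h1 : M / s = 0 := Nat.div_eq_of_lt hMs
    refine ⟨by simp [qMinus, h1], ?_, ?_, ?_⟩
    · have := qPlus_eq (s := s) (k := 0) (t := M) (M := M) (by simp) hM1 hMs.le
      simpa using this
    · have hS : IsSeesawLike r (asLengths r (1 + 2) M 0) 0 1 :=
        asLengths_isSeesawLike hr1 (Or.inr (by omega)) (Or.inl rfl)
      refine isUniqueExtremizer_of_candidate (q := 1) hn' hS (by omega) (by simp) ?_
      intro z hz L hL hLM
      refine balancedOrWorse_of_card_ge (by omega) hs2.1 hz hMs (by omega) hL (by omega) ?_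
      rw [Nat.one_le_iff_ne_zero, ne_eq, Multiset.card_eq_zero]
      rintro rfl
      rw [Multiset.sum_zero] at hLM
      omega
    · exact spider_iso_of_map_eq (by rw [asLengths_three])
  · obtain ⟨q, rfl⟩ := hsM
    have hs1 : 1 ≤ s := by
      by_contra h
      have : s = 0 := by omega
      subst this
      omega
    have hq1 : 1 ≤ q := by
      by_contra h
      have : q = 0 := by omega
      subst this
      omega
    have h1 : s * q / s = q := Nat.mul_div_cancel_left q (by omega)
    rw [h1]
    refine ⟨by simp [qMinus, h1, hq1], ?_, ?_⟩
    · unfold qPlus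
      have hs0 : (s : ℚ) ≠ 0 := by exact_mod_cast (by omega : s ≠ 0)
      rw [Nat.cast_mul, mul_div_cancel_left₀ _ hs0, Nat.ceil_natCast]
    · have hS : IsSeesawLike r (asLengths r (q + 2) s 0) 0 1 :=
        asLengths_isSeesawLike hr1 (Or.inr (by omega)) (Or.inl rfl)
      refine isUniqueExtremizer_of_candidate hn' hS (by omega) (by rw [add_zero, mul_comm]) ?_
      intro z hz L hL hLM
      -- Length `s` is the right end of the chord from `s - 1`, with positive intercept, and the
      -- left end of the chord to `s + 1`, with negative intercept. The first excludes more than `q`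
      -- branches and the second fewer.
      rcases le_total q L.card with hcard | hcard
      · obtain ⟨c, rfl⟩ : ∃ c, s = c + 1 := ⟨s - 1, by omega⟩
        exact balancedOrWorse_succ (balancedOrWorse_of_card_ge (by omega) hs2.1 hz le_rfl le_rfl
          hL (by linarith) hcard)
      · exact balancedOrWorse_of_card_le hs2.2 hz le_rfl (by omega) (by omega) hL
          (by rw [add_zero, mul_comm]; exact hLM) hcard
  · exact extremizers_of_large_quotient hn' hkt ht1 hts hsk (by omega) hs2.1 hs2.2
  · have hA := isSeesawLike_div (r := r) hkt hk1 ht1 hts (by omega) hs2.1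
    have hB := isSeesawLike_div_succ (r := r) hkt hk1 ht1 hts (by omega)
    obtain ⟨x, y, hx, hy, hlx, hly, honly, h1, h2, h3⟩ := extremizers_of_two_candidates hn' hA
      (Nat.mod_lt M (by omega)).le (Nat.div_add_mod M k).symm hB (Nat.mod_lt M (by omega)).le
      (Nat.div_add_mod M (k + 1)).symm
      fun z hz L hL hLM => balancedOrWorse_or hkt hk1 ht1 hts (by omega) hs2.1 hs2.2 hz hL hLM
    rw [qMinus_eq hkt hk1 hts, qPlus_eq hkt ht1 (by omega)]
    exact ⟨honly, x, y, hx, hy, hlx, hly, h1, h2, h3⟩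
  · refine (Set.finite_Iic (2 * r + 2 + (s * s + s))).subset ?_
    rintro m ⟨k, t, rfl, -, hk, -, ht⟩
    have : k * s ≤ s * s := Nat.mul_le_mul_right s (by omega)
    simp only [Set.mem_Iic]
    omega
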